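/- **Functions in superspace.** Let $\mathbb{S}$ be the space of formal power series over $\mathbb{Q}$ of bounded degree in the variables $x_1,x_2,\ldots$ and $\theta_1,\theta_2,\ldots$, where the $x_i$ do not commute with each other, $x_i\theta_j=\theta_jx_i$ and $\theta_i\theta_j=-\theta_j\theta_i$. The group $\mathfrak{S}_n$ acts linearly on $\mathbb{S}$ by $s(x_i)=x_{s(i)}$, $s(\theta_i)=\theta_{s(i)}$, where $s(i)=i$ for $i>n$. An element of $\mathbb{S}$ is *symmetric* if it is invariant under $\mathfrak{S}_n$ for all $n$. **Superpartitions.** A *superpartition* is an array $\Lambda=(\Lambda_1,\ldots,\Lambda_m;\Lambda_{m+1},\ldots,\Lambda_k)$ of nonnegative integers with $\Lambda_1>\cdots>\Lambda_m$ and $\Lambda_{m+1}\ge\cdots\ge\Lambda_k$. Let $n=\Lambda_1+\cdots+\Lambda_k$ and $\operatorname{df}(\Lambda)=m$. It is identified with the pair of diagrams $\Lambda^+=\operatorname{sort}(\Lambda_1,\ldots,\Lambda_k)$ and $\Lambda^\oplus=\operatorname{sort}(\Lambda_1+1,\ldots,\Lambda_m+1,\Lambda_{m+1},\ldots,\Lambda_k)$;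 equivalently, with a pair $\Lambda^+\subseteq\Lambda^\oplus$ of Young diagrams such that $\Lambda^\oplus/\Lambda^+$ has at most one cell in each row and in each column. The $n$ cells of $\Lambda^+$ are the *boxes* and the $m$ cells of $\Lambda^\oplus/\Lambda^+$ are the *circles* of $\Lambda$. Circles are numbered from top to bottom. A skew diagram $\lambda/\mu$ (with $\mu\subseteq\lambda$) is a *horizontal $r$-strip* if it has $r$ cells, at most one in each column. **Tableaux.** A *super semistandard Young tableau* $T$ of shape $\Lambda$ is a sequence $\Lambda_{(0)},\Lambda_{(1)},\Lambda_{(2)},\ldots$ of superpartitions with $\Lambda_{(0)}=\emptyset$ and $\Lambda_{(i)}=\Lambda$ for all large $i$, such that for each $i\ge1$ there is a weight $\alpha_i\in\{0,1,2,\ldots\}\cup\{\bar0,\bar1,\bar2,\ldots\}$, where $|a|=|\bar a|=a$, with the following properties. 1. $D_i=\Lambda_{(i)}^+/\Lambda_{(i-1)}^+$ is a horizontal $|\alpha_i|$-strip. 2. If $\alpha_i=a$ is not barred, then $\operatorname{df}(\Lambda_{(i)})=\operatorname{df}(\Lambda_{(i-1)})$, and for each $j$, if the $j$th circle of $\Lambda_{(i-1)}$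 is in row $r$, then the $j$th circle of $\Lambda_{(i)}$ is in row $r$ if row $r$ of $D_i$ is empty, and in row $r+1$ otherwise. 3. If $\alpha_i=\bar a$ is barred, then $\operatorname{df}(\Lambda_{(i)})=\operatorname{df}(\Lambda_{(i-1)})+1$; $\Lambda_{(i)}$ has a (necessarily unique) circle, the *new circle*, in a column $c$ such that column $c$ of $D_i$ is empty and every column to the left of it in $D_i$ is nonempty; and the diagram obtained from $\Lambda_{(i)}$ by removing the new circle satisfies the conditions of 2 in place of $\Lambda_{(i)}$. The tableau $T$ fills the shape $\Lambda$ with positive integers: the boxes of $D_i$ are labelled $i$; if $\alpha_i$ is barred, the new circle of $\Lambda_{(i)}$ is labelled $i$; and circles keep their labels when they move, i.e. the $j$th circle in 2 (and in the last condition of 3) keeps the label of the $j$th circle of $\Lambda_{(i-1)}$. Let $c(t)$ be the resulting label of a box or circle $t$ of $\Lambda$, let $T^s_1,\ldots,T^s_n$ be the boxes, read row by row from top to bottom and from left to right in each row, and let $T^a_1,\ldots,T^a_m$ be the circles from top to bottom. Let $sSSYT(\Lambda)$ be the set of all these tableaux. **Schur functions.** The Schur function of $\Lambda$ in noncommuting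 variables in superspace is \[S_\Lambda=\sum_{T\in sSSYT(\Lambda)}\theta_{c(T^a_1)}\cdots\theta_{c(T^a_m)}\sum_{\sigma\in\mathfrak{S}_n}x_{c(T^s_{\sigma(1)})}\cdots x_{c(T^s_{\sigma(n)})}\in\mathbb{S},\] where every monomial occurs in the terms of only finitely many $T$. **Theorem.** For every superpartition $\Lambda$, the function $S_\Lambda$ is symmetric. -/

import Mathlib

namespace Superspace

/-! ### Functions in noncommuting variables in superspace -/

/-- The number of inversions of a word. -/
def inv : List ℕ+ → ℕ
  | [] => 0
  | a :: l => l.countP (fun b => decide (b < a)) + inv l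

/-- The `ℚ`-vector space of formal power series of bounded degree in noncommuting variables
`x₁, x₂, …` and anticommuting variables `θ₁, θ₂, …`, where every `x` commutes with every `θ`.
Up to these relations a monomial is written in a unique way as `θ_{s₁} ⋯ θ_{s_m} x_{b₁} ⋯ x_{b_n}`
with `s₁ < ⋯ < s_m`. The series `f` is the family of its coefficients: `f (S, b)` is the coefficient
of that monomial, where `S = {s₁, …, s_m}` and `b = [b₁, …, b_n]`. -/
def SSeries : Submodule ℚ (Finset ℕ+ × List ℕ+ → ℚ) where
  carrier := {f | ∃ d : ℕ, ∀ u, f u ≠ 0 → u.1.card + u.2.length ≤ d}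
  zero_mem' := ⟨0, fun _ h => absurd rfl h⟩
  add_mem' := by
    rintro f g ⟨d, hd⟩ ⟨e, he⟩
    refine ⟨max d e, fun u hu => ?_⟩
    by_cases hf : f u = 0
    · have hg : g u ≠ 0 := fun hg => hu (by simp [hf, hg])
      exact (he u hg).trans (le_max_right _ _)
    · exact (hd u hf).trans (le_max_left _ _)
  smul_mem' := by
    rintro q f ⟨d, hd⟩
    exact ⟨d, fun u hu => hd u (fun h => hu (by simp [h]))⟩

/-- The coefficients of the monomial `θ_{a₁} ⋯ θ_{a_m} x_{b₁} ⋯ x_{b_n}`: it vanishes if a `θ` is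
repeated, and otherwise sorting the anticommuting variables produces the sign `(-1) ^ inv a`. -/
def monomialFun (a b : List ℕ+) (u : Finset ℕ+ × List ℕ+) : ℚ :=
  if a.Nodup ∧ a.toFinset = u.1 ∧ b = u.2 then (-1) ^ inv a else 0

/-- The monomial `θ_{a₁} ⋯ θ_{a_m} x_{b₁} ⋯ x_{b_n}`. -/
def monomial (a b : List ℕ+) : SSeries :=
  ⟨monomialFun a b, a.length + b.length, by
    intro u hu
    have h : a.Nodup ∧ a.toFinset = u.1 ∧ b = u.2 := by
      by_contra h
      exact hu (if_neg h)
    rw [← h.2.1, ← h.2.2]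
    exact Nat.add_le_add_right (List.toFinset_card_le a) _⟩

/-- The linear action of a permutation of the indices, `s(x_i) = x_{s(i)}` and
`s(θ_i) = θ_{s(i)}`. It sends the monomial `θ_{r₁} ⋯ θ_{r_m} x_v` with `r₁ < ⋯ < r_m` to
`θ_{s(r₁)} ⋯ θ_{s(r_m)} x_{s(v)}`, so that the coefficient at `(S, w)` comes from `R = s⁻¹(S)` and
`v = s⁻¹(w)`, with the sign of sorting `s(r₁), …, s(r_m)`. -/
def permute (s : Equiv.Perm ℕ+) : SSeries →ₗ[ℚ] SSeries where
  toFun f := ⟨fun u =>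
      (-1) ^ inv (((u.1.map s.symm.toEmbedding).sort (· ≤ ·)).map s) *
        f.1 (u.1.map s.symm.toEmbedding, u.2.map s.symm), by
    obtain ⟨d, hd⟩ := f.2
    refine ⟨d, fun u hu => ?_⟩
    have := hd _ (right_ne_zero_of_mul hu)
    simpa using this⟩
  map_add' f g := by
    ext u
    simp [mul_add]
  map_smul' q f := by
    ext u
    simp only [Submodule.coe_smul, Pi.smul_apply, smul_eq_mul, RingHom.id_apply]
    ring

theorem inv_map_perm (s : ℕ+ → ℕ+) (hs : Function.Injective s) {l l' : List ℕ+} (h : l.Perm l')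
    (hl : l.Nodup) : (-1 : ℚ) ^ inv (l.map s) * (-1) ^ inv l =
      (-1) ^ inv (l'.map s) * (-1) ^ inv l' := by
  induction h with
  | nil => rfl
  | cons a h ih =>
    have ih := ih (List.nodup_cons.1 hl).2
    simp only [List.map_cons, inv, pow_add, h.countP_eq, (h.map s).countP_eq]
    linear_combination
      (-1 : ℚ) ^ (List.countP (fun b => decide (b < s a)) (List.map s _)) *
        (-1) ^ (List.countP (fun b => decide (b < a)) _) * ih
  | swap a b l =>
    have hab : b ≠ a := by
      have := (List.nodup_cons.1 hl).1
      simp only [List.mem_cons, not_or] at this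
      exact this.1
    simp only [List.map_cons, inv, List.countP_cons, pow_add, decide_eq_true_eq]
    rcases lt_or_gt_of_ne hab with h1 | h1 <;>
      rcases lt_or_gt_of_ne (hs.ne hab) with h2 | h2 <;>
      simp only [h1, h2, h1.not_gt, h2.not_gt, if_true, if_false, pow_zero, pow_one] <;> ring
  | trans h1 h2 ih1 ih2 => rw [ih1 hl, ih2 (h1.nodup_iff.1 hl)]

theorem inv_sorted {l : List ℕ+} (h : l.Pairwise (· ≤ ·)) : inv l = 0 := by
  induction l with
  | nil => rfl
  | cons a l ih =>
    rw [List.pairwise_cons] at h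
    have h0 : l.countP (fun b => decide (b < a)) = 0 := by
      rw [List.countP_eq_zero]
      intro b hb
      simpa using h.1 b hb
    rw [inv, h0, ih h.2]

/-- The action on monomials is the substitution of the variables. -/
theorem permute_monomial (s : Equiv.Perm ℕ+) (a b : List ℕ+) :
    permute s (monomial a b) = monomial (a.map s) (b.map s) := by
  refine Subtype.ext (funext fun u => ?_)
  change (-1) ^ inv (((u.1.map s.symm.toEmbedding).sort (· ≤ ·)).map s) *
    monomialFun a b (u.1.map s.symm.toEmbedding, u.2.map s.symm) =
    monomialFun (a.map s) (b.map s) u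
  have e1 : a.toFinset = u.1.map s.symm.toEmbedding ↔ (a.map s).toFinset = u.1 := by
    have h : (a.map s).toFinset = a.toFinset.map s.toEmbedding := by
      ext c
      rw [List.mem_toFinset, Finset.mem_map_equiv, List.mem_toFinset, List.mem_map]
      constructor
      · rintro ⟨d, hd, rfl⟩
        simpa using hd
      · intro hc
        exact ⟨s.symm c, hc, by simp⟩
    rw [h]
    constructor
    · intro h'
      rw [h']
      ext c
      simp
    · intro h'
      rw [← h']
      ext c
      simp
  have e2 : b = u.2.map s.symm ↔ b.map s = u.2 := by
    constructor
    · rintro rfl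
      simp
    · rintro h
      rw [← h]
      simp
  unfold monomialFun
  simp only [e1, e2, List.nodup_map_iff s.injective]
  split_ifs with h
  · obtain ⟨h1, h2, h3⟩ := h
    have hp : ((u.1.map s.symm.toEmbedding).sort (· ≤ ·)).Perm a := by
      rw [← e1.2 h2, List.perm_ext_iff_of_nodup (Finset.sort_nodup _ _) h1]
      simp
    have := inv_map_perm s s.injective hp (Finset.sort_nodup _ _)
    rw [inv_sorted (Finset.pairwise_sort _ _), pow_zero, mul_one] at this
    rw [this, mul_assoc, ← mul_pow]
    simp
  · simp

/-- A function in superspace is symmetric if for every `n` it is invariant under the permutations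
of the indices `1, …, n`. -/
def IsSymmetric (f : SSeries) : Prop :=
  ∀ (n : ℕ) (s : Equiv.Perm ℕ+), (∀ i : ℕ+, n < (i : ℕ) → s i = i) → permute s f = f

/-! ### Superpartitions and their diagrams -/

/-- A superpartition `(Λ₁, …, Λ_m; Λ_{m+1}, …, Λ_k)` with `Λ₁ > ⋯ > Λ_m ≥ 0` and
`Λ_{m+1} ≥ ⋯ ≥ Λ_k ≥ 0`. -/
structure Superpartition where
  fermionic : List ℕ
  symmetric : List ℕ
  fermionic_strict : fermionic.Pairwise (· > ·)
  symmetric_weak : symmetric.Pairwise (· ≥ ·)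

/-- The set of cells of a skew diagram. -/
def skew (lam mu : YoungDiagram) : Finset (ℕ × ℕ) := lam.cells \ mu.cells

/-- At most one cell in each column. -/
def ColumnsAtMostOne (s : Finset (ℕ × ℕ)) : Prop := ∀ p ∈ s, ∀ q ∈ s, p.2 = q.2 → p = q

/-- At most one cell in each row. -/
def RowsAtMostOne (s : Finset (ℕ × ℕ)) : Prop := ∀ p ∈ s, ∀ q ∈ s, p.1 = q.1 → p = q

/-- `lam / mu` is a horizontal `r`-strip. -/
def IsHorizontalStrip (lam mu : YoungDiagram) (r : ℕ) : Prop :=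
  mu ≤ lam ∧ lam.card = mu.card + r ∧ ColumnsAtMostOne (skew lam mu)

/-- A super Young diagram: a pair of Young diagrams `plus ⊆ oplus` whose difference has at most one
cell in each row and in each column. The cells of the difference are the circles. Cells are
pairs (row, column), both counted from `0`. -/
@[ext]
structure SuperDiagram where
  plus : YoungDiagram
  oplus : YoungDiagram
  le : plus ≤ oplus
  columns : ColumnsAtMostOne (skew oplus plus)
  rows : RowsAtMostOne (skew oplus plus)

/-- The Young diagram whose row lengths are the entries of `l`, sorted in decreasing order. -/
def sortDiagram (l : List ℕ) : YoungDiagram :=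
  YoungDiagram.ofRowLens ((l : Multiset ℕ).sort (· ≥ ·))
    (Multiset.pairwise_sort _ _).sortedGE

theorem getElem_iff_countP (w : List ℕ) (hw : w.Pairwise (· ≥ ·)) (i j : ℕ) :
    (∃ h : i < w.length, j < w[i]) ↔ i < w.countP (fun a => decide (j < a)) := by
  induction w generalizing i with
  | nil => simp
  | cons b w ih =>
    rw [List.pairwise_cons] at hw
    by_cases hb : j < b
    · rw [List.countP_cons_of_pos (by simpa using hb)]
      cases i with
      | zero => simpa using hb
      | succ i =>
        have := ih hw.2 i
        simpa using this
    · have h0 : w.countP (fun a => decide (j < a)) = 0 := by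
        rw [List.countP_eq_zero]
        intro a ha
        have := hw.1 a ha
        simp only [decide_eq_true_eq]
        omega
      rw [List.countP_cons_of_neg (by simpa using hb), h0]
      simp only [Nat.not_lt_zero, iff_false, not_exists]
      intro h hj
      cases i with
      | zero => exact hb (by simpa using hj)
      | succ i =>
        have h1 : i < w.length := by simpa using h
        have h2 := hw.1 _ (List.getElem_mem h1)
        have h3 : j < w[i] := by simpa using hj
        omega

theorem mem_sortDiagram (l : List ℕ) (i j : ℕ) :
    (i, j) ∈ sortDiagram l ↔ i < l.countP (fun a => decide (j < a)) := by
  unfold sortDiagram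
  rw [YoungDiagram.mem_ofRowLens, getElem_iff_countP _ (Multiset.pairwise_sort _ _)]
  have h : ((l : Multiset ℕ).sort (· ≥ ·)).Perm l := by
    rw [← Multiset.coe_eq_coe, Multiset.sort_eq]
  rw [h.countP_eq]

theorem countP_succ_le (l : List ℕ) (hl : l.Pairwise (· > ·)) (j : ℕ) :
    (l.map (· + 1)).countP (fun a => decide (j < a)) ≤ l.countP (fun a => decide (j < a)) + 1 := by
  induction l with
  | nil => simp
  | cons b l ih =>
    rw [List.pairwise_cons] at hl
    have ih := ih hl.2
    by_cases h1 : j < b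
    · rw [List.map_cons, List.countP_cons_of_pos (by simp; omega),
        List.countP_cons_of_pos (by simpa using h1)]
      omega
    · have h0 : (l.map (· + 1)).countP (fun a => decide (j < a)) = 0 := by
        rw [List.countP_eq_zero]
        intro a ha
        obtain ⟨c, hc, rfl⟩ := List.mem_map.1 ha
        have := hl.1 c hc
        simp only [decide_eq_true_eq]
        omega
      rw [List.map_cons, List.countP_cons, h0]
      split_ifs <;> omega

/-- The super Young diagram of a superpartition `Λ`: the diagram `Λ⁺` of all its components and the
diagram `Λ^⊕` in which each fermionic component is increased by one. -/
def Superpartition.toDiagram (L : Superpartition) : SuperDiagram where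
  plus := sortDiagram (L.fermionic ++ L.symmetric)
  oplus := sortDiagram (L.fermionic.map (· + 1) ++ L.symmetric)
  le := by
    rintro ⟨i, j⟩ h
    rw [mem_sortDiagram] at h ⊢
    refine lt_of_lt_of_le h ?_
    rw [List.countP_append, List.countP_append, List.countP_map]
    refine Nat.add_le_add_right (List.countP_mono_left ?_) _
    intro a _ ha
    simp only [Function.comp_apply, decide_eq_true_eq] at ha ⊢
    omega
  columns := by
    rintro ⟨i, j⟩ hp ⟨i', j'⟩ hq (rfl : j = j')
    simp only [skew, Finset.mem_sdiff, YoungDiagram.mem_cells, mem_sortDiagram,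
      List.countP_append] at hp hq
    have := countP_succ_le L.fermionic L.fermionic_strict j
    have : i = i' := by omega
    rw [this]
  rows := by
    have key : ∀ i j j' : ℕ, j < j' →
        (i, j) ∈ skew (sortDiagram (L.fermionic.map (· + 1) ++ L.symmetric))
          (sortDiagram (L.fermionic ++ L.symmetric)) →
        (i, j') ∈ skew (sortDiagram (L.fermionic.map (· + 1) ++ L.symmetric))
          (sortDiagram (L.fermionic ++ L.symmetric)) → False := by
      intro i j j' hj hp hq
      simp only [skew, Finset.mem_sdiff, YoungDiagram.mem_cells, mem_sortDiagram,
        List.countP_append, List.countP_map] at hp hq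
      have h1 : L.fermionic.countP ((fun a => decide (j' < a)) ∘ (· + 1)) ≤
          L.fermionic.countP (fun a => decide (j < a)) := by
        refine List.countP_mono_left ?_
        intro a _ ha
        simp only [Function.comp_apply, decide_eq_true_eq] at ha ⊢
        omega
      have h2 : L.symmetric.countP (fun a => decide (j' < a)) ≤
          L.symmetric.countP (fun a => decide (j < a)) := by
        refine List.countP_mono_left ?_
        intro a _ ha
        simp only [decide_eq_true_eq] at ha ⊢
        omega
      omega
    rintro ⟨i, j⟩ hp ⟨i', j'⟩ hq (rfl : i = i')
    rcases lt_trichotomy j j' with h | h | h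
    · exact (key i j j' h hp hq).elim
    · rw [h]
    · exact (key i j' j h hq hp).elim

namespace SuperDiagram

/-- The empty diagram. -/
def empty : SuperDiagram where
  plus := ⊥
  oplus := ⊥
  le := le_rfl
  columns := by
    intro p hp
    simp [skew] at hp
  rows := by
    intro p hp
    simp [skew] at hp

/-- The circles of a super Young diagram. -/
def circles (D : SuperDiagram) : Finset (ℕ × ℕ) := skew D.oplus D.plus

/-- The fermionic degree. -/
def df (D : SuperDiagram) : ℕ := D.circles.card

/-- The rows that contain a circle. As a row contains at most one circle, the `j`th circle from top
to bottom lies in the `j`th smallest element of this set. -/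
def circleRows (D : SuperDiagram) : Finset ℕ := D.circles.image Prod.fst

end SuperDiagram

/-! ### Super semistandard Young tableaux -/

/-- The elements `0, 1, 2, …` and `0̄, 1̄, 2̄, …` of which a weight consists. -/
inductive Weight where
  | plain (a : ℕ) : Weight
  | barred (a : ℕ) : Weight

open Classical in
/-- The circles of `A` move as prescribed to a set `R` of rows, where `mu` is the diagram which
replaces `A.plus`: there are as many of them as elements of `R`, and the `j`th element of `R` is
the row `r` of the `j`th circle of `A` if the `r`th row of `mu / A.plus` is empty, and `r + 1`
otherwise. -/
def CirclesMove (A : SuperDiagram) (mu : YoungDiagram) (R : Finset ℕ) : Prop :=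
  R.sort (· ≤ ·) = (A.circleRows.sort (· ≤ ·)).map
    (fun r => if ∃ p ∈ skew mu A.plus, p.1 = r then r + 1 else r)

/-- The cell `p` is a circle of `B`, its column in `B.plus / A.plus` is empty, and every column to
the left of it is nonempty. There is at most one such `p`. -/
def IsNewCircle (A B : SuperDiagram) (p : ℕ × ℕ) : Prop :=
  p ∈ B.circles ∧ (∀ q ∈ skew B.plus A.plus, q.2 ≠ p.2) ∧
    ∀ c < p.2, ∃ q ∈ skew B.plus A.plus, q.2 = c

/-- The conditions on two consecutive diagrams of a tableau, with the corresponding entry of the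
weight. -/
def IsStep (A B : SuperDiagram) : Weight → Prop
  | .plain a => IsHorizontalStrip B.plus A.plus a ∧ B.df = A.df ∧ CirclesMove A B.plus B.circleRows
  | .barred a => IsHorizontalStrip B.plus A.plus a ∧ B.df = A.df + 1 ∧
      ∃ p, IsNewCircle A B p ∧ CirclesMove A B.plus (B.circleRows.erase p.1)

/-- A super semistandard Young tableau of shape `D`, filled with positive integers. The diagram
`chain i` consists of what is filled with labels `≤ i`, and `weight i` is the entry of the weight
that belongs to the label `i + 1`; labels that are not used have weight `0`. -/
structure Tableau (D : SuperDiagram) where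
  chain : ℕ → SuperDiagram
  weight : ℕ → Weight
  chain_zero : chain 0 = SuperDiagram.empty
  step : ∀ i, IsStep (chain i) (chain (i + 1)) (weight i)
  eventually : ∃ N, ∀ i, N ≤ i → chain i = D

namespace Tableau

variable {D : SuperDiagram}

/-- The label of a box: the box `p` is filled with `i + 1` if it lies in
`(chain (i + 1)).plus / (chain i).plus`. -/
noncomputable def boxLabel (T : Tableau D) (p : ℕ × ℕ) : ℕ+ :=
  Nat.succPNat (sInf {i | p ∈ (T.chain (i + 1)).plus})

/-- The labels of the boxes, row by row from top to bottom and from left to right in each row. -/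
noncomputable def boxWord (T : Tableau D) : List ℕ+ :=
  (List.range (D.plus.colLen 0)).flatMap fun i =>
    (List.range (D.plus.rowLen i)).map fun j => T.boxLabel (i, j)

open Classical in
/-- The labels of the circles of `chain i`, from top to bottom: a circle keeps its label when it
moves, and the new circle of `chain (i + 1)`, if there is one, gets the label `i + 1` and is
inserted below the circles of `chain (i + 1)` that lie above it. -/
noncomputable def circleWordAt (T : Tableau D) : ℕ → List ℕ+
  | 0 => []
  | i + 1 =>
    match T.weight i with
    | .plain _ => T.circleWordAt i
    | .barred _ => (T.circleWordAt i).insertIdx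
        ((T.chain (i + 1)).circles.filter fun q =>
          ∃ p, IsNewCircle (T.chain i) (T.chain (i + 1)) p ∧ q.1 < p.1).card
        (Nat.succPNat i)

open Classical in
/-- The labels of the circles of the tableau, from top to bottom. -/
noncomputable def circleWord (T : Tableau D) : List ℕ+ := T.circleWordAt (Nat.find T.eventually)

/-- `[θx]^T = θ_{c(T^a_1)} ⋯ θ_{c(T^a_m)} ∑_σ x_{c(T^s_{σ(1)})} ⋯ x_{c(T^s_{σ(n)})}`. -/
noncomputable def term (T : Tableau D) : SSeries :=
  ∑ s : Equiv.Perm (Fin T.boxWord.length),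
    monomial T.circleWord (List.ofFn fun k => T.boxWord.get (s k))

end Tableau


/-! ### Local finiteness of the sum over all tableaux -/

theorem SuperDiagram.card_circleRows (D : SuperDiagram) : D.circleRows.card = D.df :=
  Finset.card_image_of_injOn fun p hp q hq h => D.rows p hp q hq h

/-- The circle in a given row lies immediately to the right of the boxes of that row. -/
theorem SuperDiagram.snd_circle (D : SuperDiagram) {p : ℕ × ℕ} (hp : p ∈ D.circles) :
    p.2 = D.plus.rowLen p.1 := by
  obtain ⟨i, j⟩ := p
  have h := hp
  simp only [circles, skew, Finset.mem_sdiff, YoungDiagram.mem_cells,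
    YoungDiagram.mem_iff_lt_rowLen] at h
  have hq : (i, D.plus.rowLen i) ∈ D.circles := by
    simp only [circles, skew, Finset.mem_sdiff, YoungDiagram.mem_cells,
      YoungDiagram.mem_iff_lt_rowLen]
    omega
  exact congrArg Prod.snd (D.rows _ hp _ hq rfl)

theorem SuperDiagram.ext_of_rows {A B : SuperDiagram} (h : A.plus = B.plus)
    (hr : A.circleRows = B.circleRows) : A = B := by
  have key : ∀ {A B : SuperDiagram}, A.plus = B.plus → A.circleRows = B.circleRows →
      A.oplus ≤ B.oplus := by
    intro A B h hr p hp
    by_cases hpp : p ∈ A.plus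
    · rw [h] at hpp
      exact B.le hpp
    · have hc : p ∈ A.circles := by
        simpa [circles, skew] using ⟨hp, hpp⟩
      have hm : p.1 ∈ B.circleRows := by
        rw [← hr]
        exact Finset.mem_image_of_mem _ hc
      obtain ⟨q, hq, hqp⟩ := Finset.mem_image.1 hm
      have : q = p := by
        refine Prod.ext hqp ?_
        rw [B.snd_circle hq, A.snd_circle hc, hqp, h]
      rw [this] at hq
      exact (Finset.mem_sdiff.1 hq).1
  exact SuperDiagram.ext h (le_antisymm (key h hr) (key h.symm hr.symm))

theorem CirclesMove.card_eq {A : SuperDiagram} {mu : YoungDiagram} {R : Finset ℕ}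
    (h : CirclesMove A mu R) : R.card = A.df := by
  have := congrArg List.length h
  simpa [A.card_circleRows] using this

theorem IsNewCircle.unique {A B : SuperDiagram} {p q : ℕ × ℕ} (hp : IsNewCircle A B p)
    (hq : IsNewCircle A B q) : p = q := by
  refine B.columns p hp.1 q hq.1 ?_
  rcases lt_trichotomy p.2 q.2 with h | h | h
  · obtain ⟨c, hc, hc'⟩ := hq.2.2 _ h
    exact (hp.2.1 c hc hc').elim
  · exact h
  · obtain ⟨c, hc, hc'⟩ := hp.2.2 _ h
    exact (hq.2.1 c hc hc').elim

/-- Only finitely many super Young diagrams have their boxes in a given diagram. -/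
theorem finite_diagrams (mu : YoungDiagram) : {D : SuperDiagram | D.plus ≤ mu}.Finite := by
  classical
  let U : Finset (ℕ × ℕ) := mu.cells ∪ mu.cells.image (fun p => (p.1 + 1, p.2)) ∪
    mu.cells.image (fun p => (p.1, p.2 + 1)) ∪ {(0, 0)}
  refine Set.Finite.of_finite_image (f := fun D => (D.plus.cells, D.oplus.cells))
    (Set.Finite.subset ((U.powerset ×ˢ U.powerset).finite_toSet) ?_) ?_
  · rintro _ ⟨D, hD, rfl⟩
    have h1 : D.plus.cells ⊆ U := fun p hp => by
      have : p ∈ mu.cells := hD hp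
      simp only [U, Finset.mem_union]
      tauto
    simp only [Finset.coe_product, Set.mem_prod, Finset.mem_coe, Finset.mem_powerset]
    refine ⟨h1, ?_⟩
    rintro ⟨i, j⟩ hp
    by_cases hpp : (i, j) ∈ D.plus.cells
    · exact h1 hpp
    have hc : (i, j) ∈ D.circles := Finset.mem_sdiff.2 ⟨hp, hpp⟩
    rcases i with _ | i
    · rcases j with _ | j
      · simp [U]
      · have h2 : (0, j) ∈ D.plus.cells := by
          by_contra hn
          have h3 : (0, j) ∈ D.oplus.cells := D.oplus.up_left_mem le_rfl (Nat.le_succ j) hp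
          have := D.rows _ hc _ (Finset.mem_sdiff.2 ⟨h3, hn⟩) rfl
          simp at this
        have h3 : (0, j) ∈ mu.cells := hD h2
        simp only [U, Finset.mem_union]
        exact Or.inl (Or.inr (Finset.mem_image.2 ⟨_, h3, rfl⟩))
    · have h2 : (i, j) ∈ D.plus.cells := by
        by_contra hn
        have h3 : (i, j) ∈ D.oplus.cells := D.oplus.up_left_mem (Nat.le_succ i) le_rfl hp
        have := D.columns _ hc _ (Finset.mem_sdiff.2 ⟨h3, hn⟩) rfl
        simp at this
      have h3 : (i, j) ∈ mu.cells := hD h2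
      simp only [U, Finset.mem_union]
      exact Or.inl (Or.inl (Or.inr (Finset.mem_image.2 ⟨_, h3, rfl⟩)))
  · intro A _ B _ h
    simp only [Prod.mk.injEq] at h
    exact SuperDiagram.ext (YoungDiagram.ext h.1) (YoungDiagram.ext h.2)

namespace Tableau

variable {D : SuperDiagram}

theorem strip (T : Tableau D) (i : ℕ) :
    ∃ a, IsHorizontalStrip (T.chain (i + 1)).plus (T.chain i).plus a := by
  have h := T.step i
  cases hw : T.weight i with
  | plain a => rw [hw] at h; exact ⟨a, h.1⟩
  | barred a => rw [hw] at h; exact ⟨a, h.1⟩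

theorem plus_mono (T : Tableau D) : Monotone fun i => (T.chain i).plus :=
  monotone_nat_of_le_succ fun i => (T.strip i).choose_spec.1

theorem plus_le (T : Tableau D) (i : ℕ) : (T.chain i).plus ≤ D.plus := by
  obtain ⟨N, hN⟩ := T.eventually
  have h := T.plus_mono (le_max_left i N)
  simp only [hN _ (le_max_right i N)] at h
  exact h

theorem ext_chain {T T' : Tableau D} (h : T.chain = T'.chain) : T = T' := by
  have hw : T.weight = T'.weight := by
    funext i
    have h1 := T.step i
    have h2 := T'.step i
    rw [← h] at h2
    cases hw : T.weight i with
    | plain a =>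
      cases hw' : T'.weight i with
      | plain b =>
        rw [hw] at h1
        rw [hw'] at h2
        have := h1.1.2.1
        have := h2.1.2.1
        congr 1
        omega
      | barred b =>
        rw [hw] at h1
        rw [hw'] at h2
        have := h1.2.1
        have := h2.2.1
        omega
    | barred a =>
      cases hw' : T'.weight i with
      | plain b =>
        rw [hw] at h1
        rw [hw'] at h2
        have := h1.2.1
        have := h2.2.1
        omega
      | barred b =>
        rw [hw] at h1
        rw [hw'] at h2
        have := h1.1.2.1
        have := h2.1.2.1
        congr 1
        omega
  cases T
  cases T'
  simp only at h hw
  subst h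
  subst hw
  rfl

open Classical in
theorem insert_pos_le (T : Tableau D) (i a : ℕ) (hw : T.weight i = .barred a) :
    ((T.chain (i + 1)).circles.filter fun q =>
      ∃ p, IsNewCircle (T.chain i) (T.chain (i + 1)) p ∧ q.1 < p.1).card ≤ (T.chain i).df := by
  have h := T.step i
  rw [hw] at h
  obtain ⟨_, hd, p, hp, _⟩ := h
  have : ((T.chain (i + 1)).circles.filter fun q =>
      ∃ p, IsNewCircle (T.chain i) (T.chain (i + 1)) p ∧ q.1 < p.1) ⊂
      (T.chain (i + 1)).circles := by
    refine Finset.filter_ssubset.2 ⟨p, hp.1, ?_⟩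
    rintro ⟨q, hq, hlt⟩
    rw [hp.unique hq] at hlt
    exact lt_irrefl _ hlt
  have := Finset.card_lt_card this
  unfold SuperDiagram.df at *
  omega

theorem length_circleWordAt (T : Tableau D) (i : ℕ) :
    (T.circleWordAt i).length = (T.chain i).df := by
  induction i with
  | zero => simp [circleWordAt, T.chain_zero, SuperDiagram.df, SuperDiagram.circles,
      SuperDiagram.empty, skew]
  | succ i ih =>
    have h := T.step i
    cases hw : T.weight i with
    | plain a =>
      rw [hw] at h
      simp only [circleWordAt, hw]
      rw [ih, h.2.1]
    | barred a =>
      have hle := T.insert_pos_le i a hw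
      rw [hw] at h
      simp only [circleWordAt, hw]
      rw [List.length_insertIdx_of_le_length (by rw [ih]; exact hle), ih, h.2.1]

theorem circleWordAt_mono (T : Tableau D) {i j : ℕ} (hij : i ≤ j) :
    T.circleWordAt i ⊆ T.circleWordAt j := by
  induction j, hij using Nat.le_induction with
  | base => exact List.Subset.refl _
  | succ j _ ih =>
    intro a ha
    replace ha := ih ha
    cases hw : T.weight j with
    | plain b => simpa only [circleWordAt, hw] using ha
    | barred b =>
      have hle := T.insert_pos_le j b hw
      rw [← T.length_circleWordAt j] at hle
      simp only [circleWordAt, hw]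
      exact (List.mem_insertIdx hle).2 (Or.inr ha)

open Classical in
theorem chain_of_find_le (T : Tableau D) {i : ℕ} (hi : Nat.find T.eventually ≤ i) :
    T.chain i = D :=
  Nat.find_spec T.eventually i hi

theorem length_circleWord (T : Tableau D) : T.circleWord.length = D.df := by
  classical
  unfold circleWord
  rw [length_circleWordAt, T.chain_of_find_le le_rfl]

theorem length_boxWord (T : Tableau D) :
    T.boxWord.length = ((List.range (D.plus.colLen 0)).map D.plus.rowLen).sum := by
  simp [boxWord, List.length_flatMap]

/-- Every label at which the chain changes occurs in the tableau. -/
theorem mem_of_chain_ne (T : Tableau D) (i : ℕ) (h : T.chain i ≠ T.chain (i + 1)) :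
    Nat.succPNat i ∈ T.circleWord ∨ Nat.succPNat i ∈ T.boxWord := by
  classical
  have hi : i < Nat.find T.eventually := by
    by_contra hn
    exact h (by rw [T.chain_of_find_le (by omega), T.chain_of_find_le (by omega)])
  by_cases hp : (T.chain i).plus = (T.chain (i + 1)).plus
  · left
    have hs := T.step i
    cases hw : T.weight i with
    | plain a =>
      rw [hw] at hs
      refine absurd (SuperDiagram.ext_of_rows hp ?_) h
      have hm := hs.2.2
      have h0 : skew (T.chain (i + 1)).plus (T.chain i).plus = ∅ := by simp [skew, hp]
      simp only [CirclesMove, h0, Finset.notMem_empty, false_and, exists_false, if_false,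
        List.map_id'] at hm
      have := congrArg List.toFinset hm
      simpa using this.symm
    | barred a =>
      refine T.circleWordAt_mono (Nat.succ_le_of_lt hi) ?_
      have hle := T.insert_pos_le i a hw
      rw [← T.length_circleWordAt i] at hle
      simp only [circleWordAt, hw]
      exact (List.mem_insertIdx hle).2 (Or.inl rfl)
  · right
    have hlt : (T.chain i).plus < (T.chain (i + 1)).plus :=
      lt_of_le_of_ne (T.plus_mono (Nat.le_succ i)) hp
    obtain ⟨⟨r, c⟩, h1, h2⟩ := Finset.exists_of_ssubset (YoungDiagram.cells_ssubset_iff.2 hlt)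
    have h3 : (r, c) ∈ D.plus := T.plus_le _ h1
    have hlab : T.boxLabel (r, c) = Nat.succPNat i := by
      unfold boxLabel
      congr 1
      refine le_antisymm (Nat.sInf_le h1) (le_csInf ⟨i, h1⟩ ?_)
      intro k hk
      by_contra hn
      exact h2 (T.plus_mono (show k + 1 ≤ i by omega) hk)
    rw [← hlab]
    simp only [boxWord, List.mem_flatMap, List.mem_range, List.mem_map]
    refine ⟨r, ?_, c, YoungDiagram.mem_iff_lt_rowLen.1 h3, rfl⟩
    exact YoungDiagram.mem_iff_lt_colLen.1 (D.plus.up_left_mem le_rfl (Nat.zero_le c) h3)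

theorem finite_stable (N : ℕ) : {T : Tableau D | ∀ i, N ≤ i → T.chain i = D}.Finite := by
  refine Set.Finite.of_finite_image (f := fun T (i : Fin N) => T.chain i)
    (Set.Finite.subset (Set.Finite.pi' fun _ : Fin N => finite_diagrams D.plus) ?_) ?_
  · rintro _ ⟨T, _, rfl⟩ i
    exact T.plus_le _
  · intro T hT T' hT' h
    refine ext_chain (funext fun i => ?_)
    by_cases hi : i < N
    · exact congrFun h ⟨i, hi⟩
    · rw [hT i (by omega), hT' i (by omega)]

/-- A monomial that occurs in `[θx]^T` has exactly the labels of `T` as indices. -/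
theorem of_term_ne_zero (T : Tableau D) (u : Finset ℕ+ × List ℕ+) (h : T.term.1 u ≠ 0) :
    T.circleWord.toFinset = u.1 ∧ u.2.Perm T.boxWord := by
  unfold term at h
  rw [Submodule.coe_sum, Finset.sum_apply] at h
  obtain ⟨s, _, hs⟩ := Finset.exists_ne_zero_of_sum_ne_zero h
  have hm : T.circleWord.Nodup ∧ T.circleWord.toFinset = u.1 ∧
      (List.ofFn fun k => T.boxWord.get (s k)) = u.2 := by
    by_contra hn
    exact hs (if_neg hn)
  refine ⟨hm.2.1, ?_⟩
  rw [← hm.2.2]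
  have := Equiv.Perm.ofFn_comp_perm s T.boxWord.get
  rw [List.ofFn_get] at this
  exact this

/-- Every monomial occurs in `[θx]^T` for only finitely many tableaux `T` of shape `D`. -/
theorem finite_support_term (u : Finset ℕ+ × List ℕ+) :
    (Function.support fun T : Tableau D => T.term.1 u).Finite := by
  classical
  obtain ⟨N, hN⟩ : ∃ N : ℕ, ∀ a ∈ u.1 ∪ u.2.toFinset, (a : ℕ) ≤ N :=
    ⟨(u.1 ∪ u.2.toFinset).sup fun a => (a : ℕ), fun a ha =>
      Finset.le_sup (f := fun a : ℕ+ => (a : ℕ)) ha⟩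
  refine (finite_stable (D := D) N).subset fun T hT => ?_
  obtain ⟨h1, h2⟩ := T.of_term_ne_zero u hT
  have hstep : ∀ i, N ≤ i → T.chain i = T.chain (i + 1) := by
    intro i hi
    by_contra hn
    have hmem : Nat.succPNat i ∈ u.1 ∪ u.2.toFinset := by
      rw [Finset.mem_union, ← h1, List.mem_toFinset, List.mem_toFinset, h2.mem_iff]
      exact T.mem_of_chain_ne i hn
    have := hN _ hmem
    simp only [Nat.succPNat_coe] at this
    omega
  have hconst : ∀ i j, N ≤ i → i ≤ j → T.chain i = T.chain j := by
    intro i j hi hij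
    induction j, hij using Nat.le_induction with
    | base => rfl
    | succ j hj ih => rw [ih, hstep j (by omega)]
  intro i hi
  obtain ⟨M, hM⟩ := T.eventually
  rw [hconst i (max i M) hi (le_max_left _ _), hM _ (le_max_right _ _)]

end Tableau

/-! ### Schur functions -/

/-- The sum of `[θx]^T` over all super semistandard Young tableaux `T` of shape `D`. The sum is
formed coefficientwise, and each coefficient is a finite sum by `Tableau.finite_support_term`. -/
noncomputable def schurOfDiagram (D : SuperDiagram) : SSeries :=
  ⟨fun u => ∑ᶠ T : Tableau D, T.term.1 u,
    D.df + ((List.range (D.plus.colLen 0)).map D.plus.rowLen).sum, by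
      intro u hu
      obtain ⟨T, hT⟩ : ∃ T : Tableau D, T.term.1 u ≠ 0 := by
        by_contra hn
        push Not at hn
        exact hu (by simp [hn])
      obtain ⟨h1, h2⟩ := T.of_term_ne_zero u hT
      rw [← h1, h2.length_eq, T.length_boxWord, ← T.length_circleWord]
      exact Nat.add_le_add_right (List.toFinset_card_le _) _⟩

/-- The Schur function `S_Λ` of a superpartition in noncommuting variables in superspace. -/
noncomputable def schur (L : Superpartition) : SSeries := schurOfDiagram L.toDiagram

end Superspace

/-! Symmetry need only be tested on the exchange of two consecutive indices. Inserting the largest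
label at position `p` of a word of length `l` creates `l - p` inversions. Hence the sign of the
`θ`-word of a tableau is a constant depending only on the number of circles, times the product over
the steps of `(-1)` to the number of circles above the new one (`Tableau.sign_circleWordAt`). The
coefficient of a monomial is therefore a constant times a signed count of chains of diagrams whose
weight is read off from the monomial (`schurOfDiagram_apply`). Exchanging two consecutive entries of
the weight affects only one intermediate diagram, so everything reduces to `stepSum_swap`: for fixed
`A` and `C`, the signed number of diagrams `B` between them is invariant under exchange of the two
weights, up to a sign `-1` when both are barred.

For this, record the sizes of the two steps by variables `x` and `y`. If `lam` and `nu` are the row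
lengths of `A` and `C`, row `r` of `B` ranges independently between `max (lam r) (nu (r + 1))` and
`min (nu r) (lam (r - 1))`, while circles and signs interact only between neighbouring rows. The
generating function is thus a product of transfer matrices on 32 states, one for each row
(`pathSum_eq`). What a row does depends only on whether its length is maximal or minimal in its
interval and on how `nu r` compares with `lam (r - 1)`.

The exchange of `x` and `y` reflects each interval, which exchanges maximal and minimal lengths. The
vectors at `(x, y)` and `(y, x)` are in general not equal, but they satisfy the linear relations
`Inv`, one system for each type of comparison, with coefficients in `k = y / x`. These relations
propagate across every row (`Inv.transfer`); the only input about the row lengths is the geometric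
sum identity in `RowWeights`. Below the last row all other states have died out and the relations
become the desired exchange formula (`pathSum_swap`). Comparing coefficients of powers of `x` gives
`stepSum_swap`. -/

namespace Superspace

/-! ### Row transfer matrices and the relations they preserve. -/

/-- Comparison of a row of the outer diagram with the previous row of the inner diagram. -/
inductive Boundary where
  | lt
  | eq
  | gt

namespace Boundary

/-- Whether a row moves in the second step. -/
def snd : Boundary → Bool → Bool
  | gt, _ => true
  | _, mx => !mx

/-- Whether there is a gap above a row after the first step. -/
def gap : Boundary → Bool → Bool
  | lt, _ => true
  | _, mx => !mx

/-- Whether a row moves in the first step. -/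
def fst : Boundary → Bool → Bool
  | gt, _ => true
  | _, mn => !mn

/-- Whether there is no gap below a row in the second step. -/
def full : Boundary → Bool → Bool
  | lt, _ => false
  | _, mn => mn

end Boundary

/-- States of the row transfer. -/
@[ext]
structure RowState where
  -- `e1`, `e2`: the new circle of the first or second step lies in an earlier row. `c1`, `c2`: the
  -- first or second step pushes a circle from the previous row into the present one. `d`: the
  -- previous row of the middle diagram is as long as the present row of the outer diagram, so the
  -- second step leaves no gap there.
  e1 : Bool
  e2 : Bool
  c1 : Bool
  c2 : Bool
  d : Bool
deriving DecidableEq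

/-- The states are quintuples. -/
def RowState.equiv : Bool × Bool × Bool × Bool × Bool ≃ RowState where
  toFun u := ⟨u.1, u.2.1, u.2.2.1, u.2.2.2.1, u.2.2.2.2⟩
  invFun s := (s.e1, s.e2, s.c1, s.c2, s.d)
  left_inv _ := rfl
  right_inv _ := rfl

instance : Fintype RowState := Fintype.ofEquiv _ RowState.equiv

/-- The number of circles in a row after the first step, where `k` counts the circles that were in
this row before and did not move. -/
def midCount (k : Bool) (s : RowState) (e1 : Bool) : ℕ :=
  k.toNat + s.c1.toNat + (e1 && !s.e1).toNat

/-- The admissible transitions of states across a row. -/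
def RowOK (k b g1 σ : Bool) (s : RowState) (e1 e2 c2 : Bool) : Bool :=
  (bif s.e1 then e1 && !g1 else !e1 || g1) &&
  (bif s.e2 then e2 && s.d else !e2 || !s.d) &&
  decide (midCount k s e1 ≤ 1) &&
  c2 == (decide (midCount k s e1 = 1) && b) &&
  decide (σ.toNat = (decide (midCount k s e1 = 1) && !b).toNat + s.c2.toNat + (e2 && !s.e2).toNat)

/-- The sign with which new circles are inserted. -/
def rowSign (p : ℚ) (s : RowState) (e1 e2 : Bool) : ℚ :=
  (bif e1 && !s.e1 then bif s.c1 then -p else p else 1) *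
  (bif e2 && !s.e2 then bif (s.c1 ^^ s.c2) ^^ s.e1 then -p else p else 1)

/-- The matrix of a row transfer. -/
def rowEntry (p : ℚ) (k b g1 σ : Bool) (s : RowState) (e1 e2 c2 : Bool) : ℚ :=
  bif RowOK k b g1 σ s e1 e2 c2 then rowSign p s e1 e2 else 0

/-- The insertion of the new circle of the first step. -/
def insertFst (p : ℚ) (g1 : Bool) (Z : RowState → ℚ) (s : RowState) : ℚ :=
  bif s.e1 then
    bif g1 then bif s.c1 then p * Z ⟨false, s.e2, false, s.c2, s.d⟩ else 0
    else Z ⟨true, s.e2, s.c1, s.c2, s.d⟩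
  else Z ⟨false, s.e2, s.c1, s.c2, s.d⟩

/-- The insertion of the new circle of the second step. -/
def insertSnd (p : ℚ) (Z : RowState → ℚ) (e1 e2 c1 c2 : Bool) : ℚ :=
  bif e2 then
    Z ⟨e1, true, c1, c2, true⟩ +
      bif c2 then (bif e1 ^^ c1 then -p else p) * Z ⟨e1, false, c1, false, false⟩ else 0
  else Z ⟨e1, false, c1, c2, false⟩ + Z ⟨e1, false, c1, c2, true⟩

/-- The motion of the circles across a row. -/
def moveRow (k b σ : Bool) (Q : Bool → Bool → ℚ) (c2 : Bool) : ℚ :=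
  bif b then bif k && !c2 then 0 else Q (c2 && !k) σ
  else bif c2 then 0 else (bif k then 0 else Q false σ) + (bif σ then Q (!k) false else 0)

/-- The transfer of states across a row. -/
def rowMap (p : ℚ) (k b g1 σ : Bool) (Z : RowState → ℚ) (e1 e2 c2 : Bool) : ℚ :=
  moveRow k b σ (insertSnd p (insertFst p g1 Z) e1 e2) c2

/-- The transfer across a row, where `W` collects the weights of the possible lengths of the row
according to whether they are maximal and minimal. -/
def rowTransfer (tA tB : Boundary) (p : ℚ) (ρ σ : Bool) (W : Bool → Bool → ℚ)
    (Z : RowState → ℚ) (s : RowState) : ℚ :=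
  ∑ mx : Bool, ∑ mn : Bool, bif (s.c1 == (ρ && tB.fst mn)) && s.d == tB.full mn then
    W mx mn * rowMap p (ρ && !tB.fst mn) (tA.snd mx) (tA.gap mx) σ Z s.e1 s.e2 s.c2 else 0

theorem sum_rowState (f : RowState → ℚ) :
    ∑ s, f s = ∑ e1, ∑ e2, ∑ c1, ∑ c2, ∑ d, f ⟨e1, e2, c1, c2, d⟩ := by
  rw [← RowState.equiv.sum_comp]
  simp only [Fintype.sum_prod_type]
  rfl

set_option maxHeartbeats 4000000 in
-- A matrix row has few nonzero entries, and its action factors into inserting the two new circles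
-- and then moving circles. Between these operations `c1` and `c2` mean "arrived or newly created".
-- Inserting the first circle flips both `e1` and `c1`, so the parity that determines the second
-- sign is still visible afterwards. The factored form keeps the later identities small.
theorem sum_rowEntry (p : ℚ) (k b g1 σ : Bool) (Z : RowState → ℚ) (e1 e2 c2 : Bool) :
    ∑ s, rowEntry p k b g1 σ s e1 e2 c2 * Z s = rowMap p k b g1 σ Z e1 e2 c2 := by
  rw [sum_rowState]
  simp only [Fintype.sum_bool]
  cases k <;> cases b <;> cases g1 <;> cases σ <;> cases e1 <;> cases e2 <;> cases c2 <;>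
    simp [rowEntry, RowOK, rowSign, midCount, rowMap, moveRow, insertSnd, insertFst] <;> ring

/-- The relations between the transfer vector `Z` at `(x, y)` and the transfer vector `Y` at `(y,
x)`
at a boundary, where `k = y / x` and `p` is the sign of the number of circles above. -/
def Inv (t : Boundary) (p k : ℚ) (Z Y : RowState → ℚ) : Prop :=
  match t with
  -- Here the middle row above is longer than the present outer row, so `d` is false. There is also
  -- a gap above this row in both steps, which excludes a new circle placed earlier; states with
  -- `e1` or `e2` cannot continue and need no relation.
  | .lt =>
    (∀ e1 e2 c1 c2, Z ⟨e1, e2, c1, c2, true⟩ = 0 ∧ Y ⟨e1, e2, c1, c2, true⟩ = 0) ∧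
    Y ⟨false, false, false, false, false⟩ = Z ⟨false, false, false, false, false⟩ ∧
    Y ⟨false, false, true, false, false⟩ = k * Z ⟨false, false, true, false, false⟩ ∧
    Y ⟨false, false, false, true, false⟩ =
      Z ⟨false, false, false, true, false⟩ + (1 - k) * Z ⟨false, false, true, false, false⟩ ∧
    Y ⟨false, false, true, true, false⟩ = k * Z ⟨false, false, true, true, false⟩
  -- A push in the first step makes the middle row above longer than its inner row, which here has
  -- the length of the present outer row; so `c1` and `d` exclude each other. The nonzero entries
  -- with `d` false must be kept, as they feed the correction terms of the next row.
  | .eq =>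
    (∀ e1 e2 c2, Z ⟨e1, e2, true, c2, true⟩ = 0 ∧ Y ⟨e1, e2, true, c2, true⟩ = 0) ∧
    Y ⟨false, false, false, false, false⟩ = k * Z ⟨false, false, false, false, false⟩ ∧
    Y ⟨false, false, false, false, true⟩ =
      Z ⟨false, false, false, false, true⟩ + (1 - k) * Z ⟨false, false, false, false, false⟩ ∧
    Y ⟨false, false, true, false, false⟩ = k * Z ⟨false, false, true, false, false⟩ ∧
    Y ⟨false, false, false, true, false⟩ = k * Z ⟨false, false, false, true, false⟩ ∧
    Y ⟨false, false, false, true, true⟩ =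
      Z ⟨false, false, false, true, true⟩ + (1 - k) * (Z ⟨false, false, false, true, false⟩ +
        Z ⟨false, false, true, false, false⟩) ∧
    Y ⟨false, false, true, true, false⟩ = k * Z ⟨false, false, true, true, false⟩ ∧
    Y ⟨false, true, false, false, true⟩ =
      Z ⟨true, false, false, false, false⟩ + Z ⟨true, false, false, false, true⟩ ∧
    Y ⟨true, false, false, false, true⟩ =
      Z ⟨false, true, false, false, true⟩ - Y ⟨true, false, false, false, false⟩ ∧
    Y ⟨false, true, false, true, true⟩ =
      Z ⟨true, false, false, true, false⟩ + Z ⟨true, false, false, true, true⟩ +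
        Z ⟨true, false, true, false, false⟩ - p * k * Z ⟨false, false, false, false, false⟩ ∧
    Y ⟨true, false, false, true, true⟩ =
      Z ⟨false, true, false, true, true⟩ +
        p * Z ⟨false, false, false, false, false⟩ - Y ⟨true, false, false, true, false⟩ - Y ⟨true, false, true, false, false⟩ ∧
    Y ⟨true, true, false, false, true⟩ = - Z ⟨true, true, false, false, true⟩ ∧
    Y ⟨true, true, false, true, true⟩ =
      - Z ⟨true, true, false, true, true⟩ + p * (Z ⟨true, false, false, false, false⟩ +
        Y ⟨true, false, false, false, false⟩)
  | .gt =>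
    (∀ c1 c2, Y ⟨false, false, c1, c2, false⟩ = k * Z ⟨false, false, c1, c2, false⟩) ∧
    (∀ c1 c2, Y ⟨false, false, c1, c2, true⟩ =
      Z ⟨false, false, c1, c2, true⟩ + (1 - k) * Z ⟨false, false, c1, c2, false⟩) ∧
    Y ⟨false, true, false, false, true⟩ =
      Z ⟨true, false, false, false, false⟩ + Z ⟨true, false, false, false, true⟩ ∧
    Y ⟨true, false, false, false, true⟩ =
      Z ⟨false, true, false, false, true⟩ - Y ⟨true, false, false, false, false⟩ ∧
    Y ⟨false, true, true, false, true⟩ =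
      Z ⟨true, false, true, false, false⟩ + Z ⟨true, false, true, false, true⟩ ∧
    Y ⟨true, false, true, false, true⟩ =
      Z ⟨false, true, true, false, true⟩ - Y ⟨true, false, true, false, false⟩ ∧
    Y ⟨false, true, false, true, true⟩ =
      Z ⟨true, false, false, true, false⟩ +
        Z ⟨true, false, false, true, true⟩ - p * k * Z ⟨false, false, false, false, false⟩ ∧
    Y ⟨true, false, false, true, true⟩ =
      Z ⟨false, true, false, true, true⟩ +
        p * Z ⟨false, false, false, false, false⟩ - Y ⟨true, false, false, true, false⟩ ∧
    Y ⟨false, true, true, true, true⟩ =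
      Z ⟨true, false, true, true, false⟩ + Z ⟨true, false, true, true, true⟩ +
        p * k * Z ⟨false, false, true, false, false⟩ ∧
    Y ⟨true, false, true, true, true⟩ =
      Z ⟨false, true, true, true, true⟩ - p * Z ⟨false, false, true, false, false⟩ -
        Y ⟨true, false, true, true, false⟩ ∧
    Y ⟨true, true, false, false, true⟩ = - Z ⟨true, true, false, false, true⟩ ∧
    Y ⟨true, true, true, false, true⟩ = - Z ⟨true, true, true, false, true⟩ ∧
    Y ⟨true, true, false, true, true⟩ =
      - Z ⟨true, true, false, true, true⟩ + p * (Z ⟨true, false, false, false, false⟩ +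
        Y ⟨true, false, false, false, false⟩) ∧
    Y ⟨true, true, true, true, true⟩ =
      - Z ⟨true, true, true, true, true⟩ - p * (Z ⟨true, false, true, false, false⟩ +
        Y ⟨true, false, true, false, false⟩)

/-- The weights of a row for the variables `(x, y)` and `(y, x)`. -/
structure RowWeights (k : ℚ) (W V : Bool → Bool → ℚ) : Prop where
  swap : ∀ mx mn, V mx mn = W mn mx
  ratio : W false true = k * W true false - (1 - k) * W false false

/-- In this and the next eight cases both sides are linear in the entries of `Z` and `Y`. Rewriting
`V` by `swap`, the weight `W false true` by `ratio`, and the entries of `Y` by the relations above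
the row leaves polynomial identities for each pair `ρ`, `σ`. -/
theorem Inv.transfer_lt_lt {p k : ℚ} (ρ σ : Bool) {W V : Bool → Bool → ℚ} {Z Y : RowState → ℚ}
    (h : Inv .lt p k Z Y) (hW : RowWeights k W V) :
    Inv .lt (bif ρ then -p else p) k
      (rowTransfer .lt .lt p ρ σ W Z) (rowTransfer .lt .lt p ρ σ V Y) := by
  simp only [Inv] at h
  obtain ⟨h0, h⟩ := h
  simp only [Bool.forall_bool] at h0
  cases ρ <;> cases σ <;>
    simp [Inv, rowTransfer, rowMap, moveRow, insertSnd, insertFst, Boundary.fst, Boundary.snd,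
      Boundary.full, Boundary.gap, h, h0, hW.swap, hW.ratio]
  all_goals refine ⟨?_, ?_⟩
  all_goals try ring_nf
  all_goals simp

theorem Inv.transfer_lt_eq {p k : ℚ} (ρ σ : Bool) {W V : Bool → Bool → ℚ} {Z Y : RowState → ℚ}
    (h : Inv .lt p k Z Y) (hW : RowWeights k W V) :
    Inv .eq (bif ρ then -p else p) k
      (rowTransfer .lt .eq p ρ σ W Z) (rowTransfer .lt .eq p ρ σ V Y) := by
  simp only [Inv] at h
  obtain ⟨h0, h⟩ := h
  simp only [Bool.forall_bool] at h0
  cases ρ <;> cases σ <;>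
    simp [Inv, rowTransfer, rowMap, moveRow, insertSnd, insertFst, Boundary.fst, Boundary.snd,
      Boundary.full, Boundary.gap, h, h0, hW.swap, hW.ratio]
  all_goals refine ⟨?_, ?_⟩
  all_goals try ring_nf
  all_goals simp

theorem Inv.transfer_lt_gt {p k : ℚ} (ρ σ : Bool) {W V : Bool → Bool → ℚ} {Z Y : RowState → ℚ}
    (h : Inv .lt p k Z Y) (hW : RowWeights k W V) :
    Inv .gt (bif ρ then -p else p) k
      (rowTransfer .lt .gt p ρ σ W Z) (rowTransfer .lt .gt p ρ σ V Y) := by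
  simp only [Inv] at h
  obtain ⟨h0, h⟩ := h
  simp only [Bool.forall_bool] at h0
  cases ρ <;> cases σ <;>
    simp [Inv, rowTransfer, rowMap, moveRow, insertSnd, insertFst, Boundary.fst, Boundary.snd,
      Boundary.full, Boundary.gap, h, h0, hW.swap, hW.ratio]
  all_goals refine ⟨?_, ?_⟩
  all_goals try ring_nf
  all_goals simp

/-- When `ρ` holds, a length that is both maximal and minimal would break the relations. The
condition `hc` excludes it; geometrically, the inner row with the circle is strictly shorter than
the inner row above it. -/
theorem Inv.transfer_eq_lt {p k : ℚ} (ρ σ : Bool) {W V : Bool → Bool → ℚ} {Z Y : RowState → ℚ}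
    (h : Inv .eq p k Z Y) (hW : RowWeights k W V) (hc : ρ = true → W true true = 0) :
    Inv .lt (bif ρ then -p else p) k
      (rowTransfer .eq .lt p ρ σ W Z) (rowTransfer .eq .lt p ρ σ V Y) := by
  simp only [Inv] at h
  obtain ⟨h0, h⟩ := h
  simp only [Bool.forall_bool] at h0
  cases ρ <;> cases σ <;>
    simp [Inv, rowTransfer, rowMap, moveRow, insertSnd, insertFst, Boundary.fst, Boundary.snd,
      Boundary.full, Boundary.gap, h, h0, hW.swap, hW.ratio, hc]
  all_goals refine ⟨?_, ?_⟩
  all_goals try ring_nf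
  all_goals simp

theorem Inv.transfer_eq_eq {p k : ℚ} (ρ σ : Bool) {W V : Bool → Bool → ℚ} {Z Y : RowState → ℚ}
    (h : Inv .eq p k Z Y) (hW : RowWeights k W V) (hc : ρ = true → W true true = 0) :
    Inv .eq (bif ρ then -p else p) k
      (rowTransfer .eq .eq p ρ σ W Z) (rowTransfer .eq .eq p ρ σ V Y) := by
  simp only [Inv] at h
  obtain ⟨h0, h⟩ := h
  simp only [Bool.forall_bool] at h0
  cases ρ <;> cases σ <;>
    simp [Inv, rowTransfer, rowMap, moveRow, insertSnd, insertFst, Boundary.fst, Boundary.snd,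
      Boundary.full, Boundary.gap, h, h0, hW.swap, hW.ratio, hc]
  all_goals refine ⟨?_, ?_⟩
  all_goals try ring_nf
  all_goals simp

theorem Inv.transfer_eq_gt {p k : ℚ} (ρ σ : Bool) {W V : Bool → Bool → ℚ} {Z Y : RowState → ℚ}
    (h : Inv .eq p k Z Y) (hW : RowWeights k W V) :
    Inv .gt (bif ρ then -p else p) k
      (rowTransfer .eq .gt p ρ σ W Z) (rowTransfer .eq .gt p ρ σ V Y) := by
  simp only [Inv] at h
  obtain ⟨h0, h⟩ := h
  simp only [Bool.forall_bool] at h0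
  cases ρ <;> cases σ <;>
    simp [Inv, rowTransfer, rowMap, moveRow, insertSnd, insertFst, Boundary.fst, Boundary.snd,
      Boundary.full, Boundary.gap, h, h0, hW.swap, hW.ratio]
  all_goals refine ⟨?_, ?_⟩
  all_goals try ring_nf
  all_goals simp

theorem Inv.transfer_gt_lt {p k : ℚ} (ρ σ : Bool) {W V : Bool → Bool → ℚ} {Z Y : RowState → ℚ}
    (h : Inv .gt p k Z Y) (hW : RowWeights k W V) (hc : ρ = true → W true true = 0) :
    Inv .lt (bif ρ then -p else p) k
      (rowTransfer .gt .lt p ρ σ W Z) (rowTransfer .gt .lt p ρ σ V Y) := by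
  simp only [Inv] at h
  obtain ⟨h0, h⟩ := h
  simp only [Bool.forall_bool] at h0
  cases ρ <;> cases σ <;>
    simp [Inv, rowTransfer, rowMap, moveRow, insertSnd, insertFst, Boundary.fst, Boundary.snd,
      Boundary.full, Boundary.gap, h, h0, hW.swap, hW.ratio, hc]
  all_goals refine ⟨?_, ?_⟩
  all_goals try ring_nf
  all_goals simp

theorem Inv.transfer_gt_eq {p k : ℚ} (ρ σ : Bool) {W V : Bool → Bool → ℚ} {Z Y : RowState → ℚ}
    (h : Inv .gt p k Z Y) (hW : RowWeights k W V) (hc : ρ = true → W true true = 0) :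
    Inv .eq (bif ρ then -p else p) k
      (rowTransfer .gt .eq p ρ σ W Z) (rowTransfer .gt .eq p ρ σ V Y) := by
  simp only [Inv] at h
  obtain ⟨h0, h⟩ := h
  simp only [Bool.forall_bool] at h0
  cases ρ <;> cases σ <;>
    simp [Inv, rowTransfer, rowMap, moveRow, insertSnd, insertFst, Boundary.fst, Boundary.snd,
      Boundary.full, Boundary.gap, h, h0, hW.swap, hW.ratio, hc]
  all_goals refine ⟨?_, ?_⟩
  all_goals try ring_nf
  all_goals simp

theorem Inv.transfer_gt_gt {p k : ℚ} (ρ σ : Bool) {W V : Bool → Bool → ℚ} {Z Y : RowState → ℚ}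
    (h : Inv .gt p k Z Y) (hW : RowWeights k W V) :
    Inv .gt (bif ρ then -p else p) k
      (rowTransfer .gt .gt p ρ σ W Z) (rowTransfer .gt .gt p ρ σ V Y) := by
  simp only [Inv] at h
  obtain ⟨h0, h⟩ := h
  simp only [Bool.forall_bool] at h0
  cases ρ <;> cases σ <;>
    simp [Inv, rowTransfer, rowMap, moveRow, insertSnd, insertFst, Boundary.fst, Boundary.snd,
      Boundary.full, Boundary.gap, h, h0, hW.swap, hW.ratio]
  all_goals refine ⟨?_, ?_⟩
  all_goals try ring_nf
  all_goals simp

theorem Inv.transfer {tA tB : Boundary} {p k : ℚ} {ρ : Bool} (σ : Bool) {W V : Bool → Bool → ℚ}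
    {Z Y : RowState → ℚ} (h : Inv tA p k Z Y) (hW : RowWeights k W V)
    (hc : tA ≠ .lt → tB ≠ .gt → ρ = true → W true true = 0) :
    Inv tB (bif ρ then -p else p) k
      (rowTransfer tA tB p ρ σ W Z) (rowTransfer tA tB p ρ σ V Y) := by
  cases tA <;> cases tB
  · exact h.transfer_lt_lt ρ σ hW
  · exact h.transfer_lt_eq ρ σ hW
  · exact h.transfer_lt_gt ρ σ hW
  · exact h.transfer_eq_lt ρ σ hW (hc (by simp) (by simp))
  · exact h.transfer_eq_eq ρ σ hW (hc (by simp) (by simp))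
  · exact h.transfer_eq_gt ρ σ hW
  · exact h.transfer_gt_lt ρ σ hW (hc (by simp) (by simp))
  · exact h.transfer_gt_eq ρ σ hW (hc (by simp) (by simp))
  · exact h.transfer_gt_gt ρ σ hW

end Superspace

/-! ### Weights of row lengths and the recursion over the rows. -/

namespace Superspace

/-- The generating function of the lengths between `lo` and `hi`, split according to whether
they are maximal and minimal. -/
def rowWeight (x y : ℚ) (lo hi : ℕ) (mx mn : Bool) : ℚ :=
  ∑ u ∈ Finset.Icc lo hi with decide (u = hi) = mx ∧ decide (u = lo) = mn,
    x ^ (u - lo) * y ^ (hi - u)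

theorem sum_rowWeight (x y : ℚ) (lo hi : ℕ) (f : Bool → Bool → ℚ) :
    ∑ mx, ∑ mn, rowWeight x y lo hi mx mn * f mx mn =
      ∑ u ∈ Finset.Icc lo hi,
        x ^ (u - lo) * y ^ (hi - u) * f (decide (u = hi)) (decide (u = lo)) := by
  simp only [rowWeight, Finset.sum_filter, Finset.sum_mul]
  rw [Finset.sum_congr rfl fun mx _ => Finset.sum_comm, Finset.sum_comm]
  refine Finset.sum_congr rfl fun u _ => ?_
  cases decide (u = hi) <;> cases decide (u = lo) <;> simp

theorem rowWeight_self (x y : ℚ) {lo hi : ℕ} (h : lo ≠ hi) : rowWeight x y lo hi true true = 0 := by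
  rw [rowWeight, Finset.filter_false_of_mem, Finset.sum_empty]
  intro u _
  simp only [decide_eq_true_eq, not_and]
  omega

/-- The reflection `u ↦ lo + hi - u` exchanges the two exponents and the two ends of the interval.
-/
theorem rowWeight_swap (x y : ℚ) (lo hi : ℕ) (mx mn : Bool) :
    rowWeight y x lo hi mx mn = rowWeight x y lo hi mn mx := by
  unfold rowWeight
  refine Finset.sum_nbij' (fun u => lo + hi - u) (fun u => lo + hi - u) ?_ ?_ ?_ ?_ ?_
  · intro u hu
    simp only [Finset.mem_filter, Finset.mem_Icc] at hu ⊢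
    refine ⟨by omega, ?_, ?_⟩
    · rw [← hu.2.2]
      exact decide_eq_decide.2 (by omega)
    · rw [← hu.2.1]
      exact decide_eq_decide.2 (by omega)
  · intro u hu
    simp only [Finset.mem_filter, Finset.mem_Icc] at hu ⊢
    refine ⟨by omega, ?_, ?_⟩
    · rw [← hu.2.2]
      exact decide_eq_decide.2 (by omega)
    · rw [← hu.2.1]
      exact decide_eq_decide.2 (by omega)
  · intro u hu
    simp only [Finset.mem_filter, Finset.mem_Icc] at hu
    omega
  · intro u hu
    simp only [Finset.mem_filter, Finset.mem_Icc] at hu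
    omega
  · intro u hu
    simp only [Finset.mem_filter, Finset.mem_Icc] at hu
    rw [mul_comm]
    congr 2 <;> omega

theorem sum_pow_Icc (x y : ℚ) {lo hi : ℕ} (h : lo ≤ hi) :
    (∑ u ∈ Finset.Icc lo hi, x ^ (u - lo) * y ^ (hi - u)) * (x - y) =
      x ^ (hi - lo + 1) - y ^ (hi - lo + 1) := by
  rw [← geom_sum₂_mul]
  congr 1
  rw [← Finset.Ico_succ_right_eq_Icc, Finset.sum_Ico_eq_sum_range]
  simp only [Order.succ_eq_add_one]
  rw [show hi + 1 - lo = hi - lo + 1 by omega]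
  refine Finset.sum_congr rfl fun i hi => ?_
  rw [Finset.mem_range] at hi
  congr 2 <;> omega

/-- For `d = hi - lo > 0`, let `s` be the contribution of the interior lengths. The geometric sum
gives `(x - y) * (x ^ d + s + y ^ d) = x ^ (d + 1) - y ^ (d + 1)`, that is, `x * y ^ d = y * x ^ d -
(x - y) * s`. Division by `x` is the relation `ratio`. For `d = 0` or an empty interval all three
weights in it vanish. -/
theorem rowWeights (x y : ℚ) (hx : x ≠ 0) (lo hi : ℕ) :
    RowWeights (y / x) (rowWeight x y lo hi) (rowWeight y x lo hi) where
  swap := rowWeight_swap x y lo hi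
  ratio := by
    rcases lt_trichotomy lo hi with h | h | h
    · have h1 : rowWeight x y lo hi false true = y ^ (hi - lo) := by
        rw [rowWeight, Finset.sum_eq_single_of_mem lo]
        · simp
        · simp; omega
        · intro u hu hne
          simp only [Finset.mem_filter, decide_eq_true_eq] at hu
          exact absurd hu.2.2 hne
      have h2 : rowWeight x y lo hi true false = x ^ (hi - lo) := by
        rw [rowWeight, Finset.sum_eq_single_of_mem hi]
        · simp
        · simp; omega
        · intro u hu hne
          simp only [Finset.mem_filter, decide_eq_true_eq] at hu
          exact absurd hu.2.1 hne
      have h3 := rowWeight_self x y h.ne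
      have h4 := sum_rowWeight x y lo hi fun _ _ => 1
      simp only [mul_one, Fintype.sum_bool, h1, h2, h3] at h4
      have h5 := sum_pow_Icc x y h.le
      rw [← h4] at h5
      rw [h1, h2]
      field_simp
      rw [pow_succ, pow_succ] at h5
      linear_combination h5
    · subst h
      have h0 : ∀ a b : Bool, a ≠ b → rowWeight x y lo lo a b = 0 := by
        intro a b hab
        rw [rowWeight, Finset.filter_false_of_mem, Finset.sum_empty]
        rintro u _ ⟨h1, h2⟩
        exact hab (h1.symm.trans h2)
      have h1 : rowWeight x y lo lo false false = 0 := by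
        rw [rowWeight, Finset.filter_false_of_mem, Finset.sum_empty]
        intro u hu
        simp only [Finset.mem_Icc] at hu
        simp
        omega
      rw [h0 _ _ (by simp), h0 _ _ (by simp), h1]
      simp
    · simp [rowWeight, Finset.Icc_eq_empty_of_lt h]

section

variable (lam nu : ℕ → ℕ) (rho sigma : ℕ → Bool)

/-- The comparison of the row `r` of `nu` with the row `r - 1` of `lam`. -/
def boundaryType : ℕ → Boundary
  | 0 => .lt
  | r + 1 => if nu (r + 1) < lam r then .lt else if nu (r + 1) = lam r then .eq else .gt

/-- The least possible length of a row between `lam` and `nu`. -/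
def rowLo (r : ℕ) : ℕ := max (lam r) (nu (r + 1))

/-- The greatest possible length of a row between `lam` and `nu`. -/
def rowHi : ℕ → ℕ
  | 0 => nu 0
  | r + 1 => min (nu (r + 1)) (lam r)

/-- The sign of the number of circles in the first `r` rows. -/
def circleSign : ℕ → ℚ
  | 0 => 1
  | r + 1 => bif rho r then -circleSign r else circleSign r

/-- There is a gap between a row of length `u` and the previous row of `lam`. -/
def gapAbove (u : ℕ) : ℕ → Bool
  | 0 => true
  | r + 1 => decide (u < lam r)

/-- The state above the first row. -/
def initialState : RowState := ⟨false, false, false, false, false⟩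

/-- The contributions of the first rows to the generating function of the diagrams between `lam`
and `nu`. -/
def rowVector (x y : ℚ) : ℕ → RowState → ℚ
  | 0 => fun s => if s = initialState then 1 else 0
  | r + 1 => rowTransfer (boundaryType lam nu r) (boundaryType lam nu (r + 1)) (circleSign rho r)
      (rho r) (sigma r) (rowWeight x y (rowLo lam nu r) (rowHi lam nu r)) (rowVector x y r)

variable {lam nu rho}

theorem inv_rowVector {x y : ℚ} (hx : x ≠ 0) (h : ∀ r, rho (r + 1) = true → lam (r + 1) < lam r)
    (r : ℕ) : Inv (boundaryType lam nu r) (circleSign rho r) (y / x)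
      (rowVector lam nu rho sigma x y r) (rowVector lam nu rho sigma y x r) := by
  induction r with
  | zero => simp [Inv, boundaryType, rowVector, initialState]
  | succ r ih =>
    refine ih.transfer (sigma r) (rowWeights x y hx _ _) ?_
    intro h1 h2 h3
    refine rowWeight_self x y ?_
    cases r with
    | zero => exact absurd rfl h1
    | succ r =>
      -- The two boundary types make `lam (r + 1)` the lower end and `lam r` the upper end of the
      -- interval, and the circle forces these to differ.
      have := h r h3
      simp only [boundaryType] at h1 h2
      simp only [rowLo, rowHi]
      split_ifs at h1 h2 <;> simp at h1 h2 <;> omega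

variable (lam nu rho)

/-- The contribution of a row of length `u` with given states above and below. -/
def rowFactor (x y : ℚ) (r u : ℕ) (s s' : RowState) : ℚ :=
  if rowLo lam nu r ≤ u ∧ u ≤ rowHi lam nu r ∧ s'.c1 = (rho r && decide (lam r < u)) ∧
      s'.d = decide (u = nu (r + 1)) then
    x ^ (u - rowLo lam nu r) * y ^ (rowHi lam nu r - u) *
      rowEntry (circleSign rho r) (rho r && !decide (lam r < u)) (decide (u < nu r))
        (gapAbove lam u r) (sigma r) s s'.e1 s'.e2 s'.c2
  else 0

variable {lam nu}

/-- Once the comparison at a boundary is known, the conditions on `u` depend only on whether `u` is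
an end of its interval. The four lemmas of this kind justify collecting the lengths into the four
numbers `W mx mn`. -/
theorem fst_boundaryType {r u : ℕ} (h : rowLo lam nu r ≤ u) :
    (boundaryType lam nu (r + 1)).fst (decide (u = rowLo lam nu r)) = decide (lam r < u) := by
  generalize hl : rowLo lam nu r = l at *
  simp only [rowLo, boundaryType] at hl ⊢
  split_ifs <;> simp only [Boundary.fst] <;> rw [Bool.eq_iff_iff] <;> simp <;> omega

theorem full_boundaryType {r u : ℕ} (h : rowLo lam nu r ≤ u) :
    (boundaryType lam nu (r + 1)).full (decide (u = rowLo lam nu r)) =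
      decide (u = nu (r + 1)) := by
  generalize hl : rowLo lam nu r = l at *
  simp only [rowLo, boundaryType] at hl ⊢
  split_ifs <;> simp only [Boundary.full] <;> rw [Bool.eq_iff_iff] <;> simp <;> omega

theorem snd_boundaryType {r u : ℕ} (h : u ≤ rowHi lam nu r) :
    (boundaryType lam nu r).snd (decide (u = rowHi lam nu r)) = decide (u < nu r) := by
  generalize hl : rowHi lam nu r = l at *
  cases r with
  | zero =>
    simp only [rowHi, boundaryType] at hl ⊢
    simp only [Boundary.snd]
    rw [Bool.eq_iff_iff]
    simp
    omega
  | succ r =>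
    simp only [rowHi, boundaryType] at hl ⊢
    split_ifs <;> simp only [Boundary.snd] <;> rw [Bool.eq_iff_iff] <;> simp <;> omega

theorem gap_boundaryType {r u : ℕ} (h : u ≤ rowHi lam nu r) :
    (boundaryType lam nu r).gap (decide (u = rowHi lam nu r)) = gapAbove lam u r := by
  generalize hl : rowHi lam nu r = l at *
  cases r with
  | zero => rfl
  | succ r =>
    simp only [rowHi, boundaryType, gapAbove] at hl ⊢
    split_ifs <;> simp only [Boundary.gap] <;> rw [Bool.eq_iff_iff] <;> simp <;> omega

/-- This undoes the grouping by maximality and minimality: each length gets its own term, as needed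
for an expansion into paths. The bound `K` is free because lengths above `rowHi` contribute nothing.
-/
theorem rowVector_succ (x y : ℚ) (r : ℕ) (s' : RowState) {K : ℕ} (hK : rowHi lam nu r < K) :
    rowVector lam nu rho sigma x y (r + 1) s' = ∑ u : Fin K, ∑ s,
      rowFactor lam nu rho sigma x y r u s s' * rowVector lam nu rho sigma x y r s := by
  have h1 : ∀ u : ℕ, ∑ s, rowFactor lam nu rho sigma x y r u s s' *
      rowVector lam nu rho sigma x y r s =
      if u ∈ Finset.Icc (rowLo lam nu r) (rowHi lam nu r) then
        x ^ (u - rowLo lam nu r) * y ^ (rowHi lam nu r - u) *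
          (bif (s'.c1 == (rho r && decide (lam r < u))) && s'.d == decide (u = nu (r + 1)) then
            rowMap (circleSign rho r) (rho r && !decide (lam r < u)) (decide (u < nu r))
              (gapAbove lam u r) (sigma r) (rowVector lam nu rho sigma x y r) s'.e1 s'.e2 s'.c2
          else 0) else 0 := by
    intro u
    simp only [rowFactor, Finset.mem_Icc]
    by_cases hu : rowLo lam nu r ≤ u ∧ u ≤ rowHi lam nu r
    · rw [if_pos hu, ← sum_rowEntry]
      by_cases h : s'.c1 = (rho r && decide (lam r < u)) ∧ s'.d = decide (u = nu (r + 1))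
      · have h' : ((s'.c1 == (rho r && decide (lam r < u))) && s'.d == decide (u = nu (r + 1)))
            = true := by
          simpa using h
        rw [h', cond_true, Finset.mul_sum]
        refine Finset.sum_congr rfl fun s _ => ?_
        rw [if_pos ⟨hu.1, hu.2, h⟩, mul_assoc]
      · have h' : ((s'.c1 == (rho r && decide (lam r < u))) && s'.d == decide (u = nu (r + 1)))
            = false := by
          rw [Bool.eq_false_iff]
          simpa using h
        rw [h', cond_false, mul_zero]
        refine Finset.sum_eq_zero fun s _ => ?_
        rw [if_neg (by tauto), zero_mul]
    · rw [if_neg hu]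
      refine Finset.sum_eq_zero fun s _ => ?_
      rw [if_neg (by tauto), zero_mul]
  rw [Fin.sum_univ_eq_sum_range (fun u => ∑ s, rowFactor lam nu rho sigma x y r u s s' *
      rowVector lam nu rho sigma x y r s) K]
  simp only [h1]
  rw [← Finset.sum_filter]
  have h2 : {u ∈ Finset.range K | u ∈ Finset.Icc (rowLo lam nu r) (rowHi lam nu r)} =
      Finset.Icc (rowLo lam nu r) (rowHi lam nu r) := by
    ext u
    simp only [Finset.mem_filter, Finset.mem_range, Finset.mem_Icc]
    omega
  rw [h2]
  simp only [rowVector, rowTransfer]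
  have h3 := sum_rowWeight x y (rowLo lam nu r) (rowHi lam nu r) fun mx mn =>
    bif (s'.c1 == (rho r && (boundaryType lam nu (r + 1)).fst mn)) &&
      s'.d == (boundaryType lam nu (r + 1)).full mn then
    rowMap (circleSign rho r) (rho r && !(boundaryType lam nu (r + 1)).fst mn)
      ((boundaryType lam nu r).snd mx) ((boundaryType lam nu r).gap mx) (sigma r)
      (rowVector lam nu rho sigma x y r) s'.e1 s'.e2 s'.c2 else 0
  refine Eq.trans ?_ (h3.trans ?_)
  · refine Finset.sum_congr rfl fun mx _ => Finset.sum_congr rfl fun mn _ => ?_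
    cases (s'.c1 == (rho r && (boundaryType lam nu (r + 1)).fst mn)) &&
      s'.d == (boundaryType lam nu (r + 1)).full mn <;> simp
  · refine Finset.sum_congr rfl fun u hu => ?_
    rw [Finset.mem_Icc] at hu
    simp only [fst_boundaryType hu.1, full_boundaryType hu.1, snd_boundaryType hu.2,
      gap_boundaryType hu.2]

end

end Superspace

/-! ### Matrix products as sums over paths. -/

namespace Superspace

theorem sum_snoc {α : Type*} [Fintype α] {n : ℕ} (f : (Fin (n + 1) → α) → ℚ) :
    ∑ t, f t = ∑ a, ∑ t : Fin n → α, f (Fin.snoc (α := fun _ => α) t a) := by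
  rw [← (Fin.snocEquiv fun _ => α).sum_comp, Fintype.sum_prod_type]
  rfl

/-- A vector obtained from an initial vector by multiplication with matrices is a sum over paths. -/
theorem sum_paths {S : Type*} [Fintype S] [DecidableEq S] {K : ℕ} (F : ℕ → ℕ → S → S → ℚ) (s0 : S)
    (V : ℕ → S → ℚ) (h0 : ∀ s, V 0 s = if s = s0 then 1 else 0) (N : ℕ)
    (hs : ∀ r < N, ∀ s', V (r + 1) s' = ∑ u : Fin K, ∑ s, F r u s s' * V r s) (s' : S) :
    V N s' = ∑ st : Fin (N + 1) → S, ∑ mu : Fin N → Fin K,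
      if st 0 = s0 ∧ st (Fin.last N) = s' then
        ∏ r : Fin N, F r (mu r) (st r.castSucc) (st r.succ) else 0 := by
  induction N generalizing s' with
  | zero =>
    rw [h0, ← (Equiv.funUnique (Fin 1) S).symm.sum_comp]
    simp [Fin.last, ite_and, eq_comm (a := s0)]
  | succ N ih =>
    have ih := ih fun r hr => hs r (Nat.lt_succ_of_lt hr)
    have h1 : ∀ (a : S) (t : Fin (N + 1) → S) (u : Fin K) (m : Fin N → Fin K),
        (if (Fin.snoc (α := fun _ => S) t a : Fin (N + 2) → S) 0 = s0 ∧
            (Fin.snoc (α := fun _ => S) t a : Fin (N + 2) → S) (Fin.last (N + 1)) = s' then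
          ∏ r : Fin (N + 1), F r ((Fin.snoc (α := fun _ => Fin K) m u : Fin (N + 1) → Fin K) r)
            ((Fin.snoc (α := fun _ => S) t a : Fin (N + 2) → S) r.castSucc)
            ((Fin.snoc (α := fun _ => S) t a : Fin (N + 2) → S) r.succ) else 0) =
        if a = s' then if t 0 = s0 then F N u (t (Fin.last N)) s' *
          ∏ r : Fin N, F r (m r) (t r.castSucc) (t r.succ) else 0 else 0 := by
      intro a t u m
      rw [Fin.prod_univ_castSucc]
      simp only [← Fin.castSucc_zero, Fin.snoc_castSucc, Fin.snoc_last, Fin.succ_castSucc,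
        Fin.succ_last, Fin.val_castSucc, Fin.val_last]
      by_cases ha : a = s'
      · subst ha
        simp only [and_true, if_true, mul_comm]
      · simp [ha]
    rw [sum_snoc, hs N (Nat.lt_succ_self N)]
    simp only [sum_snoc (α := Fin K), h1]
    simp only [Finset.sum_ite_irrel, Finset.sum_const_zero, Finset.sum_ite_eq', Finset.mem_univ,
      if_true]
    have h2 : ∀ (u : Fin K), ∑ s, F N u s s' * V N s = ∑ t : Fin (N + 1) → S,
        ∑ m : Fin N → Fin K, if t 0 = s0 then F N u (t (Fin.last N)) s' *
          ∏ r : Fin N, F r (m r) (t r.castSucc) (t r.succ) else 0 := by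
      intro u
      simp only [ih, Finset.mul_sum]
      rw [Finset.sum_comm]
      refine Finset.sum_congr rfl fun t _ => ?_
      rw [Finset.sum_comm]
      refine Finset.sum_congr rfl fun m _ => ?_
      simp only [mul_ite, mul_zero, ite_and]
      split_ifs <;> simp
    simp only [h2]
    rw [Finset.sum_comm]
    refine Finset.sum_congr rfl fun t _ => ?_
    split_ifs <;> simp

end Superspace

/-! ### Steps in terms of row lengths, and runs of row states. -/

namespace Superspace

/-- Whether a circle arrives in a row from the previous row. -/
def pushed (lam mu : ℕ → ℕ) (rho : ℕ → Bool) : ℕ → Bool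
  | 0 => false
  | r + 1 => rho r && decide (lam r < mu r)

/-- Whether the new circle lies above a row. -/
def placed (n : Option ℕ) (r : ℕ) : Bool := n.any fun s => decide (s < r)

/-- Whether there is no gap below the previous row in the second step. -/
def tight (mu nu : ℕ → ℕ) : ℕ → Bool
  | 0 => false
  | r + 1 => decide (mu r = nu (r + 1))

/-- A step from `lam` to `mu`, where the rows with a circle are given by `rho` and `m` and
the new circle is in the row `n`. -/
structure RowStep (lam mu : ℕ → ℕ) (rho m : ℕ → Bool) (n : Option ℕ) : Prop where
  le : ∀ r, lam r ≤ mu r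
  interlace : ∀ r, mu (r + 1) ≤ lam r
  gap : ∀ r, n = some (r + 1) → mu (r + 1) < lam r
  full : ∀ s, n = some s → ∀ r, s ≤ r → mu (r + 1) = lam r
  circ : ∀ r, (m r).toNat = (rho r && !decide (lam r < mu r)).toNat +
    (pushed lam mu rho r).toNat + (decide (n = some r)).toNat

/-- The states of two consecutive steps. -/
def rowState (lam mu nu : ℕ → ℕ) (rho m : ℕ → Bool) (n1 n2 : Option ℕ) (r : ℕ) : RowState :=
  ⟨placed n1 r, placed n2 r, pushed lam mu rho r, pushed mu nu m r, tight mu nu r⟩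

theorem placed_succ (n : Option ℕ) (r : ℕ) :
    placed n (r + 1) = (placed n r || decide (n = some r)) := by
  cases n with
  | none => simp [placed]
  | some s =>
    simp only [placed, Option.any_some, Option.some.injEq]
    rw [Bool.eq_iff_iff]
    simp
    omega

theorem not_placed_self {n : Option ℕ} {r : ℕ} (h : n = some r) : placed n r = false := by
  subst h
  simp [placed]

theorem placed_new (n : Option ℕ) (r : ℕ) :
    (placed n (r + 1) && !placed n r) = decide (n = some r) := by
  rw [placed_succ]
  by_cases h : n = some r
  · simp [h, not_placed_self]
  · simp [h]

variable {lam mu nu : ℕ → ℕ} {rho m sigma : ℕ → Bool} {n n1 n2 : Option ℕ}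

namespace RowStep

/-- Above row `r`, a step adds the new circle if it was placed there and loses the circle pushed
from row `r - 1` into row `r`. All other moves stay above row `r`. -/
theorem circleSign_eq (h : RowStep lam mu rho m n) (r : ℕ) :
    circleSign m r = circleSign rho r * (bif placed n r then -1 else 1) *
      (bif pushed lam mu rho r then -1 else 1) := by
  induction r with
  | zero =>
    have : placed n 0 = false := by cases n <;> simp [placed]
    simp [circleSign, pushed, this]
  | succ r ih =>
    have h1 := h.circ r
    have h2 : decide (n = some r) = true → placed n r = false := fun hn =>
      not_placed_self (of_decide_eq_true hn)
    rw [placed_succ,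
      show circleSign m (r + 1) = bif m r then -circleSign m r else circleSign m r from rfl,
      show circleSign rho (r + 1) = bif rho r then -circleSign rho r else circleSign rho r from rfl,
      show pushed lam mu rho (r + 1) = (rho r && decide (lam r < mu r)) from rfl, ih]
    generalize decide (n = some r) = d at *
    generalize placed n r = q at *
    generalize pushed lam mu rho r = u at *
    generalize decide (lam r < mu r) = v at *
    generalize m r = w at *
    generalize rho r = z at *
    cases z <;> cases d <;> cases q <;> cases u <;> cases v <;> cases w <;> simp at *

/-- Every row below the new circle is filled up to the end of the previous inner row. This lemma and
the next three turn the position of the new circle into the local conditions on `e1` and `e2`. -/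
theorem gapAbove_of_placed (h : RowStep lam mu rho m n) {r : ℕ} (hr : placed n r = true) :
    gapAbove lam (mu r) r = false := by
  cases n with
  | none => simp [placed] at hr
  | some s =>
    simp only [placed, Option.any_some, decide_eq_true_eq] at hr
    obtain ⟨r, rfl⟩ : ∃ q, r = q + 1 := ⟨r - 1, by omega⟩
    simp [gapAbove, h.full s rfl r (by omega)]

theorem gapAbove_of_new (h : RowStep lam mu rho m n) {r : ℕ} (hr : n = some r) :
    gapAbove lam (mu r) r = true := by
  cases r with
  | zero => rfl
  | succ r => simpa [gapAbove] using h.gap r hr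

theorem tight_of_placed (h : RowStep mu nu m sigma n) {r : ℕ} (hr : placed n r = true) :
    tight mu nu r = true := by
  cases n with
  | none => simp [placed] at hr
  | some s =>
    simp only [placed, Option.any_some, decide_eq_true_eq] at hr
    obtain ⟨r, rfl⟩ : ∃ q, r = q + 1 := ⟨r - 1, by omega⟩
    simp [tight, h.full s rfl r (by omega)]

theorem tight_of_new (h : RowStep mu nu m sigma n) {r : ℕ} (hr : n = some r) :
    tight mu nu r = false := by
  cases r with
  | zero => rfl
  | succ r => simpa [tight] using (h.gap r hr).ne'

theorem rowOK (h1 : RowStep lam mu rho m n1) (h2 : RowStep mu nu m sigma n2) (r : ℕ) :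
    RowOK (rho r && !decide (lam r < mu r)) (decide (mu r < nu r)) (gapAbove lam (mu r) r) (sigma r)
      (rowState lam mu nu rho m n1 n2 r) (placed n1 (r + 1)) (placed n2 (r + 1))
      (pushed mu nu m (r + 1)) = true := by
  have hm : midCount (rho r && !decide (lam r < mu r)) (rowState lam mu nu rho m n1 n2 r)
      (placed n1 (r + 1)) = (m r).toNat := by
    simp only [midCount, rowState, placed_new, h1.circ r]
  have e1 : (bif placed n1 r then placed n1 (r + 1) && !gapAbove lam (mu r) r
      else !placed n1 (r + 1) || gapAbove lam (mu r) r) = true := by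
    cases hp : placed n1 r with
    | true => simp [h1.gapAbove_of_placed hp, placed_succ, hp]
    | false =>
      by_cases hn : n1 = some r
      · simp [h1.gapAbove_of_new hn]
      · simp [placed_succ, hp, hn]
  have e2 : (bif placed n2 r then placed n2 (r + 1) && tight mu nu r
      else !placed n2 (r + 1) || !tight mu nu r) = true := by
    cases hp : placed n2 r with
    | true => simp [h2.tight_of_placed hp, placed_succ, hp]
    | false =>
      by_cases hn : n2 = some r
      · simp [h2.tight_of_new hn]
      · simp [placed_succ, hp, hn]
  unfold RowOK
  rw [hm]
  simp only [rowState, e1, e2, placed_new]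
  have h3 := h2.circ r
  rw [h3, show pushed mu nu m (r + 1) = (m r && decide (mu r < nu r)) from rfl]
  cases m r <;> simp

/-- The transfer only knows the sign for the inner diagram. Applying `circleSign_eq` once or twice
expresses the signs for the middle and outer diagrams through it and the flags of the state. -/
theorem rowSign_eq (h1 : RowStep lam mu rho m n1) (h2 : RowStep mu nu m sigma n2) (r : ℕ) :
    rowSign (circleSign rho r) (rowState lam mu nu rho m n1 n2 r) (placed n1 (r + 1))
      (placed n2 (r + 1)) = (if n1 = some r then circleSign m r else 1) *
        (if n2 = some r then circleSign sigma r else 1) := by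
  unfold rowSign
  simp only [rowState, placed_new, h2.circleSign_eq, h1.circleSign_eq]
  by_cases hn1 : n1 = some r <;> by_cases hn2 : n2 = some r <;>
    simp only [hn1, hn2, not_placed_self] <;> cases placed n1 r <;>
    cases pushed lam mu rho r <;> cases pushed mu nu m r <;> simp

theorem rowFactor_eq (h1 : RowStep lam mu rho m n1) (h2 : RowStep mu nu m sigma n2) (x y : ℚ)
    (r : ℕ) : rowFactor lam nu rho sigma x y r (mu r) (rowState lam mu nu rho m n1 n2 r)
      (rowState lam mu nu rho m n1 n2 (r + 1)) =
      x ^ (mu r - rowLo lam nu r) * y ^ (rowHi lam nu r - mu r) *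
        ((if n1 = some r then circleSign m r else 1) *
          (if n2 = some r then circleSign sigma r else 1)) := by
  unfold rowFactor
  rw [if_pos]
  · unfold rowEntry
    have hok := h1.rowOK h2 r
    have hs := h1.rowSign_eq h2 r
    rw [show (rowState lam mu nu rho m n1 n2 (r + 1)).e1 = placed n1 (r + 1) from rfl,
      show (rowState lam mu nu rho m n1 n2 (r + 1)).e2 = placed n2 (r + 1) from rfl,
      show (rowState lam mu nu rho m n1 n2 (r + 1)).c2 = pushed mu nu m (r + 1) from rfl,
      hok, cond_true, hs]
  · refine ⟨max_le (h1.le r) (h2.interlace r), ?_, rfl, rfl⟩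
    cases r with
    | zero => exact h2.le 0
    | succ r => exact le_min (h2.le _) (h1.interlace r)

end RowStep

/-- The relation of the states above and below a row of length `u`. -/
structure RowRel (lam nu : ℕ → ℕ) (rho sigma : ℕ → Bool) (r u : ℕ) (s s' : RowState) : Prop where
  lo : rowLo lam nu r ≤ u
  hi : u ≤ rowHi lam nu r
  c1 : s'.c1 = (rho r && decide (lam r < u))
  d : s'.d = decide (u = nu (r + 1))
  ok : RowOK (rho r && !decide (lam r < u)) (decide (u < nu r)) (gapAbove lam u r) (sigma r)
    s s'.e1 s'.e2 s'.c2 = true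

theorem RowRel.of_rowFactor_ne_zero {x y : ℚ} {r u : ℕ} {s s' : RowState}
    (h : rowFactor lam nu rho sigma x y r u s s' ≠ 0) : RowRel lam nu rho sigma r u s s' := by
  unfold rowFactor at h
  split_ifs at h with hc
  · refine ⟨hc.1, hc.2.1, hc.2.2.1, hc.2.2.2, ?_⟩
    unfold rowEntry at h
    by_contra hn
    rw [Bool.not_eq_true] at hn
    simp [hn] at h
  · exact absurd rfl h

open Classical in
/-- The place where a flag is raised. -/
noncomputable def flagRow (f : ℕ → Bool) : Option ℕ :=
  if h : ∃ r, f (r + 1) = true then some (Nat.find h) else none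

/-- A flag that never falls is determined by the row in which it is raised; the position found by
`Nat.find` recovers it. -/
theorem placed_flagRow {f : ℕ → Bool} (h0 : f 0 = false) (h : ∀ r, f r = true → f (r + 1) = true)
    (r : ℕ) : placed (flagRow f) r = f r := by
  classical
  unfold flagRow
  split_ifs with hf
  · simp only [placed, Option.any_some]
    rw [Bool.eq_iff_iff, decide_eq_true_iff]
    constructor
    · intro hr
      have : ∀ q, Nat.find hf + 1 ≤ q → f q = true := by
        intro q hq
        induction q, hq using Nat.le_induction with
        | base => exact Nat.find_spec hf
        | succ q _ ih => exact h q ih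
      exact this r hr
    · intro hr
      cases r with
      | zero => simp [h0] at hr
      | succ r => exact Nat.lt_succ_of_le (Nat.find_min' hf hr)
  · cases r with
    | zero => simp [placed, h0]
    | succ r =>
      have : f (r + 1) = false := by
        by_contra hn
        exact hf ⟨r, by simpa using hn⟩
      simp [placed, this]

/-- The circles in the middle of a run. -/
def runCircles (lam mu : ℕ → ℕ) (rho : ℕ → Bool) (st : ℕ → RowState) (r : ℕ) : Bool :=
  decide (midCount (rho r && !decide (lam r < mu r)) (st r) (st (r + 1)).e1 = 1)

theorem RowOK_iff {k b g1 σ : Bool} {s : RowState} {e1 e2 c2 : Bool} :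
    RowOK k b g1 σ s e1 e2 c2 = true ↔
      (s.e1 = true → e1 = true ∧ g1 = false) ∧ (s.e1 = false → e1 = true → g1 = true) ∧
      (s.e2 = true → e2 = true ∧ s.d = true) ∧ (s.e2 = false → e2 = true → s.d = false) ∧
      midCount k s e1 ≤ 1 ∧ c2 = (decide (midCount k s e1 = 1) && b) ∧
      σ.toNat = (decide (midCount k s e1 = 1) && !b).toNat + s.c2.toNat + (e2 && !s.e2).toNat := by
  unfold RowOK
  simp only [Bool.and_eq_true, decide_eq_true_iff, beq_iff_eq]
  cases s.e1 <;> cases s.e2 <;> cases e1 <;> cases e2 <;> cases g1 <;> cases s.d <;>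
    simp [and_assoc]

namespace RowRel

/-- A run of states loses no information: the rise of `e1` and `e2` locates the new circles, and the
counts `midCount` give the circles of the middle diagram. With these data the states are
reconstructed. -/
theorem rowState_flagRow {st : ℕ → RowState} (h0 : st 0 = initialState)
    (h : ∀ r, RowRel lam nu rho sigma r (mu r) (st r) (st (r + 1))) (r : ℕ) :
    rowState lam mu nu rho (runCircles lam mu rho st) (flagRow fun r => (st r).e1)
      (flagRow fun r => (st r).e2) r = st r := by
  have e1 := placed_flagRow (f := fun r => (st r).e1) (by rw [h0]; rfl)
    (fun r hr => ((RowOK_iff.1 (h r).ok).1 hr).1) r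
  have e2 := placed_flagRow (f := fun r => (st r).e2) (by rw [h0]; rfl)
    (fun r hr => ((RowOK_iff.1 (h r).ok).2.2.1 hr).1) r
  unfold rowState
  rw [e1, e2]
  cases r with
  | zero => rw [h0]; rfl
  | succ r =>
    refine RowState.ext rfl rfl (h r).c1.symm ?_ (h r).d.symm
    exact (RowOK_iff.1 (h r).ok).2.2.2.2.2.1.symm

theorem rowStep_fst {st : ℕ → RowState} (h0 : st 0 = initialState)
    (h : ∀ r, RowRel lam nu rho sigma r (mu r) (st r) (st (r + 1))) :
    RowStep lam mu rho (runCircles lam mu rho st) (flagRow fun r => (st r).e1) := by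
  have hst := rowState_flagRow h0 h
  have he : ∀ r, placed (flagRow fun r => (st r).e1) r = (st r).e1 :=
    fun r => congrArg RowState.e1 (hst r)
  have hle : ∀ r, mu (r + 1) ≤ lam r := fun r => (h (r + 1)).hi.trans (min_le_right _ _)
  constructor
  · exact fun r => (le_max_left _ _).trans (h r).lo
  · exact hle
  · intro r hr
    have h1 := not_placed_self hr
    have h2 := placed_succ (flagRow fun r => (st r).e1) (r + 1)
    rw [decide_eq_true hr, Bool.or_true, he] at h2
    rw [he] at h1
    simpa [gapAbove] using (RowOK_iff.1 (h (r + 1)).ok).2.1 h1 h2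
  · intro s hs r hr
    have h1 : (st (r + 1)).e1 = true := by
      rw [← he, hs]
      simp [placed]
      omega
    have h2 := ((RowOK_iff.1 (h (r + 1)).ok).1 h1).2
    simp only [gapAbove, decide_eq_false_iff_not] at h2
    exact le_antisymm (hle r) (not_lt.1 h2)
  · intro r
    have h1 := (RowOK_iff.1 (h r).ok).2.2.2.2.1
    have h2 : (runCircles lam mu rho st r).toNat =
        midCount (rho r && !decide (lam r < mu r)) (st r) (st (r + 1)).e1 := by
      unfold runCircles
      generalize midCount (rho r && !decide (lam r < mu r)) (st r) (st (r + 1)).e1 = q at h1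
      interval_cases q <;> rfl
    rw [h2, ← placed_new, he, he, midCount]
    have := congrArg RowState.c1 (hst r)
    simp only [rowState] at this
    rw [this]

theorem rowStep_snd {st : ℕ → RowState} (h0 : st 0 = initialState)
    (h : ∀ r, RowRel lam nu rho sigma r (mu r) (st r) (st (r + 1))) :
    RowStep mu nu (runCircles lam mu rho st) sigma (flagRow fun r => (st r).e2) := by
  have hst := rowState_flagRow h0 h
  have he : ∀ r, placed (flagRow fun r => (st r).e2) r = (st r).e2 :=
    fun r => congrArg RowState.e2 (hst r)
  have hle : ∀ r, nu (r + 1) ≤ mu r := fun r => (le_max_right _ _).trans (h r).lo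
  constructor
  · intro r
    refine (h r).hi.trans ?_
    cases r with
    | zero => exact le_rfl
    | succ r => exact min_le_left _ _
  · exact hle
  · intro r hr
    have h1 := not_placed_self hr
    have h2 := placed_succ (flagRow fun r => (st r).e2) (r + 1)
    rw [decide_eq_true hr, Bool.or_true, he] at h2
    rw [he] at h1
    have h3 := (RowOK_iff.1 (h (r + 1)).ok).2.2.2.1 h1 h2
    rw [(h r).d, decide_eq_false_iff_not] at h3
    exact lt_of_le_of_ne (hle r) (Ne.symm h3)
  · intro s hs r hr
    have h1 : (st (r + 1)).e2 = true := by
      rw [← he, hs]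
      simp [placed]
      omega
    have h2 := ((RowOK_iff.1 (h (r + 1)).ok).2.2.1 h1).2
    rw [(h r).d, decide_eq_true_iff] at h2
    exact h2.symm
  · intro r
    rw [(RowOK_iff.1 (h r).ok).2.2.2.2.2.2, ← placed_new, he, he]
    have := congrArg RowState.c2 (hst r)
    simp only [rowState] at this
    rw [this]
    rfl

end RowRel

end Superspace

/-! ### Super diagrams as row lengths together with circle rows. -/

namespace Superspace

namespace SuperDiagram

theorem mem_circles {D : SuperDiagram} {p : ℕ × ℕ} : p ∈ D.circles ↔ p ∈ D.oplus ∧ p ∉ D.plus := by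
  simp [circles, skew]

theorem mem_circleRows {D : SuperDiagram} {r : ℕ} :
    r ∈ D.circleRows ↔ (r, D.plus.rowLen r) ∈ D.circles := by
  constructor
  · intro h
    obtain ⟨⟨i, j⟩, hp, rfl⟩ := Finset.mem_image.1 h
    have := D.snd_circle hp
    simp only at this ⊢
    rwa [this] at hp
  · intro h
    exact Finset.mem_image.2 ⟨_, h, rfl⟩

/-- If the two rows were equally long, the cell above the circle would also be a circle, in the same
column. -/
theorem rowLen_lt {D : SuperDiagram} {r : ℕ} (h : r + 1 ∈ D.circleRows) :
    D.plus.rowLen (r + 1) < D.plus.rowLen r := by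
  by_contra hn
  have he : D.plus.rowLen r = D.plus.rowLen (r + 1) :=
    le_antisymm (not_lt.1 hn) (D.plus.rowLen_anti _ _ (Nat.le_succ r))
  rw [mem_circleRows] at h
  have h1 : (r, D.plus.rowLen (r + 1)) ∈ D.circles := by
    rw [mem_circles] at h ⊢
    refine ⟨D.oplus.up_left_mem (Nat.le_succ r) le_rfl h.1, ?_⟩
    rw [YoungDiagram.mem_iff_lt_rowLen]
    omega
  have := D.columns _ h1 _ h rfl
  simp at this

/-- Whether there is a circle in a row. -/
def hasCircle (D : SuperDiagram) (r : ℕ) : Bool := decide (r ∈ D.circleRows)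

theorem hasCircle_eq_true {D : SuperDiagram} {r : ℕ} : D.hasCircle r = true ↔ r ∈ D.circleRows := by
  simp [hasCircle]

theorem ext_rows {A B : SuperDiagram} (h1 : ∀ r, A.plus.rowLen r = B.plus.rowLen r)
    (h2 : ∀ r, A.hasCircle r = B.hasCircle r) : A = B := by
  refine ext_of_rows ?_ ?_
  · refine YoungDiagram.ext (Finset.ext fun p => ?_)
    obtain ⟨i, j⟩ := p
    rw [YoungDiagram.mem_cells, YoungDiagram.mem_cells, YoungDiagram.mem_iff_lt_rowLen,
      YoungDiagram.mem_iff_lt_rowLen, h1]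
  · ext r
    rw [← hasCircle_eq_true, ← hasCircle_eq_true, h2]

end SuperDiagram

/-- The Young diagram with given row lengths. -/
def diagramOfRows (u : ℕ → ℕ) (N : ℕ) (hu : Antitone u) : YoungDiagram where
  cells := (Finset.range N ×ˢ Finset.range (u 0)).filter fun p => p.2 < u p.1
  isLowerSet := by
    rintro ⟨i, j⟩ ⟨i', j'⟩ h hp
    simp only [Finset.coe_filter, Finset.mem_product, Finset.mem_range, Set.mem_ofPred_eq] at hp ⊢
    obtain ⟨h1, h2⟩ := Prod.mk_le_mk.1 h
    have := hu h1
    omega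

theorem mem_diagramOfRows {u : ℕ → ℕ} {N : ℕ} {hu : Antitone u} (hN : u N = 0) {i j : ℕ} :
    (i, j) ∈ diagramOfRows u N hu ↔ j < u i := by
  rw [← YoungDiagram.mem_cells]
  simp only [diagramOfRows, Finset.mem_filter, Finset.mem_product, Finset.mem_range]
  constructor
  · exact fun h => h.2
  · intro h
    refine ⟨⟨?_, h.trans_le (hu (Nat.zero_le i))⟩, h⟩
    by_contra hn
    have := hu (not_lt.1 hn)
    omega

theorem rowLen_diagramOfRows {u : ℕ → ℕ} {N : ℕ} {hu : Antitone u} (hN : u N = 0) (r : ℕ) :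
    (diagramOfRows u N hu).rowLen r = u r := by
  refine le_antisymm ?_ ?_ <;> by_contra hn <;> rw [not_le] at hn
  · rw [← YoungDiagram.mem_iff_lt_rowLen, mem_diagramOfRows hN] at hn
    exact lt_irrefl _ hn
  · rw [← mem_diagramOfRows (hu := hu) hN, YoungDiagram.mem_iff_lt_rowLen] at hn
    exact lt_irrefl _ hn

/-- A super Young diagram with given row lengths and given rows of the circles. -/
theorem exists_superDiagram {u : ℕ → ℕ} {c : ℕ → Bool} {N : ℕ} (hu : Antitone u) (hN : u N = 0)
    (hc : c N = false) (h : ∀ r, c (r + 1) = true → u (r + 1) < u r) :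
    ∃ D : SuperDiagram, (∀ r, D.plus.rowLen r = u r) ∧ ∀ r, D.hasCircle r = c r := by
  -- The outer diagram lengthens by one each row with a circle. The strict drop above such a row is
  -- what keeps its row lengths decreasing.
  have hv : Antitone fun r => u r + (c r).toNat := by
    refine antitone_nat_of_succ_le fun r => ?_
    have h1 := hu (Nat.le_succ r)
    cases hr : c (r + 1) with
    | false => simp only [Bool.toNat_false]; exact Nat.le_add_right_of_le h1
    | true =>
      have := h r hr
      simp only [Bool.toNat_true]
      omega
  have hvN : u N + (c N).toNat = 0 := by simp [hN, hc]
  have key : ∀ i j, (i, j) ∈ skew (diagramOfRows _ N hv) (diagramOfRows u N hu) ↔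
      j = u i ∧ c i = true := by
    intro i j
    simp only [skew, Finset.mem_sdiff, YoungDiagram.mem_cells]
    rw [mem_diagramOfRows (hu := hv) hvN, mem_diagramOfRows hN]
    cases c i <;> simp; omega
  refine ⟨⟨diagramOfRows u N hu, diagramOfRows _ N hv, ?_, ?_, ?_⟩, fun r => ?_, fun r => ?_⟩
  · rintro ⟨i, j⟩ hp
    rw [mem_diagramOfRows hN] at hp
    rw [mem_diagramOfRows (hu := hv) hvN]
    omega
  · rintro ⟨i, j⟩ hp ⟨i', j'⟩ hq (rfl : j = j')
    rw [key] at hp hq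
    have hlt : ∀ a b, a < b → c b = true → u b < u a := by
      intro a b hab hb
      obtain ⟨b, rfl⟩ : ∃ q, b = q + 1 := ⟨b - 1, by omega⟩
      exact (h b hb).trans_le (hu (by omega))
    rcases lt_trichotomy i i' with hi | hi | hi
    · have := hlt _ _ hi hq.2
      omega
    · rw [hi]
    · have := hlt _ _ hi hp.2
      omega
  · rintro ⟨i, j⟩ hp ⟨i', j'⟩ hq (rfl : i = i')
    rw [key] at hp hq
    rw [hp.1, hq.1]
  · exact rowLen_diagramOfRows (hu := hu) hN r
  · rw [Bool.eq_iff_iff, SuperDiagram.hasCircle_eq_true, SuperDiagram.mem_circleRows]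
    simp only [SuperDiagram.circles]
    rw [key, rowLen_diagramOfRows (hu := hu) hN]
    simp

theorem mem_skew {lam mu : YoungDiagram} {i j : ℕ} :
    (i, j) ∈ skew lam mu ↔ mu.rowLen i ≤ j ∧ j < lam.rowLen i := by
  simp only [skew, Finset.mem_sdiff, YoungDiagram.mem_cells, YoungDiagram.mem_iff_lt_rowLen]
  omega

theorem exists_mem_skew {lam mu : YoungDiagram} {r : ℕ} :
    (∃ p ∈ skew lam mu, p.1 = r) ↔ mu.rowLen r < lam.rowLen r := by
  constructor
  · rintro ⟨⟨i, j⟩, hp, rfl⟩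
    rw [mem_skew] at hp
    exact hp.1.trans_lt hp.2
  · intro h
    exact ⟨(r, mu.rowLen r), mem_skew.2 ⟨le_rfl, h⟩, rfl⟩

theorem le_iff_rowLen {mu lam : YoungDiagram} : mu ≤ lam ↔ ∀ r, mu.rowLen r ≤ lam.rowLen r := by
  constructor
  · intro h r
    by_contra hn
    rw [not_le, ← YoungDiagram.mem_iff_lt_rowLen] at hn
    have := h hn
    rw [YoungDiagram.mem_iff_lt_rowLen] at this
    exact lt_irrefl _ this
  · rintro h ⟨i, j⟩ hp
    rw [YoungDiagram.mem_iff_lt_rowLen] at hp ⊢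
    exact hp.trans_le (h i)

/-- Two cells of the strip in one column exist exactly when some row of `lam` extends beyond the row
of `mu` above it. Thus the column condition is interlacing. -/
theorem strip_iff {lam mu : YoungDiagram} {a : ℕ} : IsHorizontalStrip lam mu a ↔
    (∀ r, mu.rowLen r ≤ lam.rowLen r) ∧ (∀ r, lam.rowLen (r + 1) ≤ mu.rowLen r) ∧
      lam.card = mu.card + a := by
  unfold IsHorizontalStrip
  rw [le_iff_rowLen]
  constructor
  · rintro ⟨h1, h2, h3⟩
    refine ⟨h1, fun r => ?_, h2⟩
    by_contra hn
    rw [not_le] at hn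
    have h4 := lam.rowLen_anti r (r + 1) (Nat.le_succ r)
    have h5 := mu.rowLen_anti r (r + 1) (Nat.le_succ r)
    have := h3 (r, mu.rowLen r) (mem_skew.2 (by omega)) (r + 1, mu.rowLen r)
      (mem_skew.2 (by omega)) rfl
    simp at this
  · rintro ⟨h1, h2, h3⟩
    refine ⟨h1, h3, ?_⟩
    have key : ∀ i i' j, i < i' → (i, j) ∈ skew lam mu → (i', j) ∈ skew lam mu → False := by
      intro i i' j hi hp hq
      rw [mem_skew] at hp hq
      have := h2 i
      have := lam.rowLen_anti (i + 1) i' hi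
      omega
    rintro ⟨i, j⟩ hp ⟨i', j'⟩ hq (rfl : j = j')
    rcases lt_trichotomy i i' with hi | hi | hi
    · exact (key _ _ _ hi hp hq).elim
    · rw [hi]
    · exact (key _ _ _ hi hq hp).elim

end Superspace

/-! ### The defining conditions of a tableau step, row by row. -/

namespace Superspace

/-- A circle reaches row `r` either by staying there or by moving from row `r - 1`. As the left side
is at most one, the equation forbids both at once; this makes the list of new rows strictly
increasing, so equality of sets gives equality of sorted lists. -/
theorem circlesMove_iff {A : SuperDiagram} {mu : YoungDiagram} {R : Finset ℕ} :
    CirclesMove A mu R ↔ ∀ r, (decide (r ∈ R)).toNat =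
      (A.hasCircle r && !decide (A.plus.rowLen r < mu.rowLen r)).toNat +
        (pushed A.plus.rowLen mu.rowLen A.hasCircle r).toNat := by
  classical
  let f : ℕ → ℕ := fun r => if A.plus.rowLen r < mu.rowLen r then r + 1 else r
  have hf : ∀ r, (A.plus.rowLen r < mu.rowLen r ∧ f r = r + 1) ∨
      (¬ A.plus.rowLen r < mu.rowLen r ∧ f r = r) := by
    intro r
    by_cases h : A.plus.rowLen r < mu.rowLen r
    · exact Or.inl ⟨h, if_pos h⟩
    · exact Or.inr ⟨h, if_neg h⟩
  have h0 : CirclesMove A mu R ↔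
      R.sort (· ≤ ·) = (A.circleRows.sort (· ≤ ·)).map f := by
    unfold CirclesMove
    simp only [exists_mem_skew, f]
  have hmem : ∀ r, r ∈ (A.circleRows.sort (· ≤ ·)).map f ↔
      (A.hasCircle r && !decide (A.plus.rowLen r < mu.rowLen r)) = true ∨
        pushed A.plus.rowLen mu.rowLen A.hasCircle r = true := by
    intro r
    simp only [List.mem_map, Finset.mem_sort, ← SuperDiagram.hasCircle_eq_true]
    constructor
    · rintro ⟨s, hs, rfl⟩
      rcases hf s with ⟨h1, h2⟩ | ⟨h1, h2⟩
      · right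
        rw [h2]
        simp [pushed, hs, h1]
      · left
        rw [h2]
        simpa [hs] using h1
    · rintro (h | h)
      · simp only [Bool.and_eq_true, Bool.not_eq_true', decide_eq_false_iff_not] at h
        exact ⟨r, h.1, if_neg h.2⟩
      · cases r with
        | zero => simp [pushed] at h
        | succ r =>
          simp only [pushed, Bool.and_eq_true, decide_eq_true_eq] at h
          exact ⟨r, h.1, if_pos h.2⟩
  rw [h0]
  constructor
  · intro h r
    have h1 : r ∈ R ↔ r ∈ (A.circleRows.sort (· ≤ ·)).map f := by
      rw [← h, Finset.mem_sort]
    rw [hmem] at h1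
    have h2 : ¬ ((A.hasCircle r && !decide (A.plus.rowLen r < mu.rowLen r)) = true ∧
        pushed A.plus.rowLen mu.rowLen A.hasCircle r = true) := by
      rintro ⟨h3, h4⟩
      cases r with
      | zero => simp [pushed] at h4
      | succ r =>
        simp only [pushed, Bool.and_eq_true, Bool.not_eq_true', decide_eq_false_iff_not,
          decide_eq_true_eq, SuperDiagram.hasCircle_eq_true] at h3 h4
        have hn : ((A.circleRows.sort (· ≤ ·)).map f).Nodup := by
          rw [← h]
          exact Finset.sort_nodup _ _
        have := List.inj_on_of_nodup_map hn ((Finset.mem_sort _).2 h3.1)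
          ((Finset.mem_sort _).2 h4.1) (by simp [f, h3.2, h4.2])
        omega
    revert h1 h2
    by_cases hr : r ∈ R <;> simp only [hr] <;>
      cases (A.hasCircle r && !decide (A.plus.rowLen r < mu.rowLen r)) <;>
      cases pushed A.plus.rowLen mu.rowLen A.hasCircle r <;> simp
  · intro h
    have hR : ((A.circleRows.sort (· ≤ ·)).map f).toFinset = R := by
      ext r
      rw [List.mem_toFinset, hmem]
      have := h r
      revert this
      by_cases hr : r ∈ R <;> simp only [hr] <;>
        cases (A.hasCircle r && !decide (A.plus.rowLen r < mu.rowLen r)) <;>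
        cases pushed A.plus.rowLen mu.rowLen A.hasCircle r <;> simp
    have hlt : ((A.circleRows.sort (· ≤ ·)).map f).Pairwise (· < ·) := by
      rw [List.pairwise_map]
      refine (Finset.sortedLT_sort A.circleRows).pairwise.imp_of_mem ?_
      intro s t hs ht hst
      rw [Finset.mem_sort, ← SuperDiagram.hasCircle_eq_true] at hs ht
      rcases hf s with ⟨h1, h2⟩ | ⟨h1, h2⟩ <;> rcases hf t with ⟨h3, h4⟩ | ⟨h3, h4⟩ <;> rw [h2, h4]
      · omega
      -- Order could only fail if a circle moves down onto one that stays in the next row; the count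
      -- there would be two.
      · refine lt_of_le_of_ne hst ?_
        rintro rfl
        have := h (s + 1)
        revert this
        by_cases hr : s + 1 ∈ R <;> simp [hr, pushed, hs, ht, h1, h3]
      · omega
      · omega
    rw [← hR]
    exact (List.toFinset_sort _ (hlt.imp fun h => h.ne)).2 (hlt.imp fun h => h.le)

/-- A circle in row `s` lies in column `B.plus.rowLen s`. This column avoids the strip exactly when
row `s - 1` of `A` is strictly longer than row `s` of `B`. The columns to its left are all met
exactly when, from row `s` downwards, each next row of `B` reaches the end of the row of `A` above
it. -/
theorem isNewCircle_iff {A B : SuperDiagram} (h1 : ∀ r, A.plus.rowLen r ≤ B.plus.rowLen r)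
    (h2 : ∀ r, B.plus.rowLen (r + 1) ≤ A.plus.rowLen r) {s : ℕ} (hs : s ∈ B.circleRows) :
    IsNewCircle A B (s, B.plus.rowLen s) ↔
      (∀ r, s = r + 1 → B.plus.rowLen (r + 1) < A.plus.rowLen r) ∧
        ∀ r, s ≤ r → B.plus.rowLen (r + 1) = A.plus.rowLen r := by
  have hB := fun i j => B.plus.rowLen_anti i j
  have hA := fun i j => A.plus.rowLen_anti i j
  constructor
  · rintro ⟨_, h3, h4⟩
    constructor
    · rintro r rfl
      refine lt_of_le_of_ne (h2 r) fun he => ?_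
      exact h3 (r, B.plus.rowLen (r + 1)) (mem_skew.2 ⟨he.ge, SuperDiagram.rowLen_lt hs⟩) rfl
    · intro r hr
      refine le_antisymm (h2 r) (not_lt.1 fun hlt => ?_)
      have h5 := h1 r
      have h6 := hB s r hr
      obtain ⟨⟨i, j⟩, hq, rfl⟩ := h4 (B.plus.rowLen (r + 1)) (by simp only; omega)
      rw [mem_skew] at hq
      rcases le_or_gt i r with hi | hi
      · have := hA i r hi
        omega
      · have := hB (r + 1) i hi
        omega
  · rintro ⟨h3, h4⟩
    refine ⟨SuperDiagram.mem_circleRows.1 hs, ?_, ?_⟩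
    · rintro ⟨i, j⟩ hq (rfl : j = _)
      rw [mem_skew] at hq
      have hi : i < s := by
        by_contra hn
        have := hB s i (not_lt.1 hn)
        omega
      obtain ⟨s, rfl⟩ : ∃ q, s = q + 1 := ⟨s - 1, by omega⟩
      have := h3 s rfl
      have := hA i s (by omega)
      omega
    · intro c hc
      classical
      -- The first such `r` is the row of a strip cell in column `c`: its row in `A` has length
      -- `B.plus.rowLen (r + 1) ≤ c`, and by minimality its row in `B` is longer than `c`.
      have hex : ∃ r, s ≤ r ∧ B.plus.rowLen (r + 1) ≤ c := by
        refine ⟨max s (B.plus.colLen 0), le_max_left _ _, ?_⟩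
        by_contra hn
        have h5 : (max s (B.plus.colLen 0) + 1, 0) ∈ B.plus := by
          rw [YoungDiagram.mem_iff_lt_rowLen]
          omega
        rw [YoungDiagram.mem_iff_lt_colLen] at h5
        have := le_max_right s (B.plus.colLen 0)
        omega
      obtain ⟨h5, h6⟩ := Nat.find_spec hex
      refine ⟨(Nat.find hex, c), mem_skew.2 ⟨by rw [← h4 _ h5]; exact h6, ?_⟩, rfl⟩
      rcases h5.eq_or_lt with h7 | h7
      · rwa [← h7]
      · obtain ⟨q, hq⟩ : ∃ q, Nat.find hex = q + 1 := ⟨Nat.find hex - 1, by omega⟩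
        have := Nat.find_min hex (m := q) (by omega)
        rw [hq]
        by_contra hn
        exact this ⟨by omega, by omega⟩

/-- Whether an entry of a weight is barred. -/
def Weight.isBarred : Weight → Bool
  | .plain _ => false
  | .barred _ => true

/-- The absolute value of an entry of a weight. -/
def Weight.size : Weight → ℕ
  | .plain a => a
  | .barred a => a

theorem Weight.ext_iff {v w : Weight} : v = w ↔ v.isBarred = w.isBarred ∧ v.size = w.size := by
  cases v <;> cases w <;> simp [isBarred, size]

/-- The conditions on `df` carry no extra information, since they follow by counting the rows of the
moved circles. The size of the weight separates from the geometric condition `RowStep`, so that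
steps of all sizes can be summed together. -/
theorem isStep_iff {A B : SuperDiagram} {w : Weight} :
    IsStep A B w ↔ B.plus.card = A.plus.card + w.size ∧ ∃ n : Option ℕ, n.isSome = w.isBarred ∧
      RowStep A.plus.rowLen B.plus.rowLen A.hasCircle B.hasCircle n := by
  cases w with
  | plain a =>
    simp only [IsStep, strip_iff, circlesMove_iff, Weight.size, Weight.isBarred]
    constructor
    · rintro ⟨⟨h1, h2, h3⟩, _, h4⟩
      refine ⟨h3, none, rfl, h1, h2, by simp, by simp, fun r => ?_⟩
      simpa [SuperDiagram.hasCircle] using h4 r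
    · rintro ⟨h3, n, hn, h⟩
      have hn : n = none := by simpa using hn
      subst hn
      have h4 : ∀ r, (decide (r ∈ B.circleRows)).toNat =
        (A.hasCircle r && !decide (A.plus.rowLen r < B.plus.rowLen r)).toNat +
          (pushed A.plus.rowLen B.plus.rowLen A.hasCircle r).toNat := fun r => by
        simpa [SuperDiagram.hasCircle] using h.circ r
      refine ⟨⟨h.le, h.interlace, h3⟩, ?_, h4⟩
      have := (circlesMove_iff.2 h4).card_eq
      rwa [B.card_circleRows] at this
  | barred a =>
    simp only [IsStep, strip_iff, Weight.size, Weight.isBarred]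
    constructor
    · rintro ⟨⟨h1, h2, h3⟩, _, ⟨s, j⟩, hp, h4⟩
      have hj := B.snd_circle hp.1
      simp only at hj
      subst hj
      have hs : s ∈ B.circleRows := SuperDiagram.mem_circleRows.2 hp.1
      obtain ⟨h5, h6⟩ := (isNewCircle_iff h1 h2 hs).1 hp
      rw [circlesMove_iff] at h4
      refine ⟨h3, some s, rfl, h1, h2, ?_, ?_, fun r => ?_⟩
      · rintro r hr
        exact h5 r (Option.some.inj hr)
      · rintro t ht
        rw [← Option.some.inj ht]
        exact h6
      · rw [← h4 r, SuperDiagram.hasCircle]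
        by_cases hr : r = s
        · subst hr
          simp [hs]
        · simp [hr, Ne.symm hr]
    · rintro ⟨h3, n, hn, h⟩
      obtain ⟨s, rfl⟩ := Option.isSome_iff_exists.1 hn
      have hs : s ∈ B.circleRows := by
        have := h.circ s
        rw [decide_eq_true rfl] at this
        rw [← SuperDiagram.hasCircle_eq_true]
        cases hb : B.hasCircle s
        · simp [hb] at this
        · rfl
      have h4 : CirclesMove A B.plus (B.circleRows.erase s) := by
        rw [circlesMove_iff]
        intro r
        have := h.circ r
        rw [SuperDiagram.hasCircle] at this
        by_cases hr : r = s
        · subst hr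
          simp only [hs, decide_true, Bool.toNat_true] at this
          simp only [Finset.notMem_erase, decide_false, Bool.toNat_false]
          omega
        · simp only [Option.some.injEq, Ne.symm hr, decide_false, Bool.toNat_false,
            Nat.add_zero] at this
          simp only [Finset.mem_erase, ne_eq, hr, not_false_iff, true_and]
          exact this
      refine ⟨⟨h.le, h.interlace, h3⟩, ?_, (s, B.plus.rowLen s), ?_, h4⟩
      · have h5 := h4.card_eq
        rw [Finset.card_erase_of_mem hs, B.card_circleRows] at h5
        have : 0 < B.df := by
          rw [← B.card_circleRows]
          exact Finset.card_pos.2 ⟨s, hs⟩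
        omega
      · refine (isNewCircle_iff h.le h.interlace hs).2 ⟨?_, h.full s rfl⟩
        rintro r rfl
        exact h.gap r rfl

end Superspace

/-! ### Moves of arbitrary size and their signs. -/

namespace Superspace

theorem rowLen_eq_zero (mu : YoungDiagram) {r : ℕ} (h : mu.colLen 0 ≤ r) : mu.rowLen r = 0 := by
  by_contra hn
  have h1 : (r, 0) ∈ mu := YoungDiagram.mem_iff_lt_rowLen.2 (Nat.pos_of_ne_zero hn)
  rw [YoungDiagram.mem_iff_lt_colLen] at h1
  omega

theorem card_eq_sum_rowLen (mu : YoungDiagram) {N : ℕ} (h : mu.colLen 0 ≤ N) :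
    mu.card = ∑ r ∈ Finset.range N, mu.rowLen r := by
  classical
  rw [YoungDiagram.card, Finset.card_eq_sum_card_fiberwise (f := Prod.fst) (t := Finset.range N)]
  · refine Finset.sum_congr rfl fun r _ => ?_
    rw [YoungDiagram.rowLen_eq_card]
    rfl
  · rintro ⟨i, j⟩ hp
    have h1 : (i, 0) ∈ mu := mu.up_left_mem le_rfl (Nat.zero_le j) hp
    rw [YoungDiagram.mem_iff_lt_colLen] at h1
    simp only [Finset.coe_range, Set.mem_Iio]
    omega

theorem SuperDiagram.hasCircle_eq_false (D : SuperDiagram) {r : ℕ} (h : D.plus.colLen 0 < r) :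
    D.hasCircle r = false := by
  by_contra hn
  rw [Bool.not_eq_false, hasCircle_eq_true] at hn
  obtain ⟨r, rfl⟩ : ∃ q, r = q + 1 := ⟨r - 1, by omega⟩
  have h1 := rowLen_lt hn
  have h2 := rowLen_eq_zero D.plus (r := r) (by omega)
  omega

/-- The diagrams `A` and `B` are consecutive in a tableau, and `e` tells if a circle is added. -/
def IsMove (A B : SuperDiagram) (e : Bool) : Prop :=
  ∃ n : Option ℕ, n.isSome = e ∧ RowStep A.plus.rowLen B.plus.rowLen A.hasCircle B.hasCircle n

open Classical in
/-- The row of the new circle. -/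
noncomputable def newRow (A B : SuperDiagram) (e : Bool) : Option ℕ :=
  if h : IsMove A B e then h.choose else none

namespace IsMove

variable {A B : SuperDiagram} {e : Bool}

theorem isSome_newRow (h : IsMove A B e) : (newRow A B e).isSome = e := by
  unfold newRow
  rw [dif_pos h]
  exact h.choose_spec.1

theorem rowStep (h : IsMove A B e) :
    RowStep A.plus.rowLen B.plus.rowLen A.hasCircle B.hasCircle (newRow A B e) := by
  unfold newRow
  rw [dif_pos h]
  exact h.choose_spec.2

theorem le (h : IsMove A B e) : A.plus ≤ B.plus := le_iff_rowLen.2 h.rowStep.le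

theorem hasCircle_of_newRow (h : IsMove A B e) {s : ℕ} (hs : newRow A B e = some s) :
    B.hasCircle s = true := by
  have := h.rowStep.circ s
  rw [hs, decide_eq_true rfl] at this
  cases hb : B.hasCircle s
  · simp [hb] at this
  · rfl

end IsMove

theorem circleSign_eq_pow (c : ℕ → Bool) (s : ℕ) :
    circleSign c s = (-1) ^ ((Finset.range s).filter fun r => c r = true).card := by
  induction s with
  | zero => simp [circleSign]
  | succ s ih =>
    rw [Finset.range_add_one, Finset.filter_insert]
    cases h : c s
    · simp [circleSign, h, ih]
    · rw [if_pos rfl, Finset.card_insert_of_notMem (by simp), pow_succ, ← ih]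
      simp [circleSign, h]

open Classical in
/-- The number of circles above the new circle. -/
noncomputable def insertPos (A B : SuperDiagram) : ℕ :=
  (B.circles.filter fun q => ∃ p, IsNewCircle A B p ∧ q.1 < p.1).card

/-- The sign of the insertion of the new circle. -/
noncomputable def stepSign (A B : SuperDiagram) (e : Bool) : ℚ :=
  bif e then (-1) ^ insertPos A B else 1

/-- Each row has at most one circle, so the circles above the new one are counted by the earlier
rows containing a circle. -/
theorem IsMove.stepSign_eq {A B : SuperDiagram} {e : Bool} (h : IsMove A B e) :
    stepSign A B e = (newRow A B e).elim 1 (circleSign B.hasCircle) := by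
  classical
  have h1 := h.isSome_newRow
  have h2 := h.rowStep
  have h3 := fun s => h.hasCircle_of_newRow (s := s)
  cases hn : newRow A B e with
  | none =>
    rw [hn] at h1
    simp only [Option.isSome_none] at h1
    subst h1
    rfl
  | some s =>
    rw [hn] at h1 h2
    simp only [Option.isSome_some] at h1
    subst h1
    have hs := SuperDiagram.hasCircle_eq_true.1 (h3 s hn)
    have hnew := (isNewCircle_iff h2.le h2.interlace hs).2
      ⟨by rintro r rfl; exact h2.gap r rfl, h2.full s rfl⟩
    simp only [stepSign, cond_true, Option.elim_some, circleSign_eq_pow]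
    congr 1
    unfold insertPos
    refine Finset.card_nbij Prod.fst ?_ ?_ ?_
    · intro q hq
      simp only [Finset.coe_filter, Set.mem_ofPred_eq, Finset.mem_range] at hq ⊢
      obtain ⟨hq, p, hp, hlt⟩ := hq
      rw [hp.unique hnew] at hlt
      exact ⟨hlt, SuperDiagram.hasCircle_eq_true.2 (Finset.mem_image_of_mem _ hq)⟩
    · intro p hp q hq hpq
      simp only [Finset.coe_filter, Set.mem_ofPred_eq] at hp hq
      exact B.rows p hp.1 q hq.1 hpq
    · intro r hr
      simp only [Finset.coe_filter, Set.mem_ofPred_eq, Finset.mem_range] at hr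
      refine ⟨(r, B.plus.rowLen r), ?_, rfl⟩
      simp only [Finset.coe_filter, Set.mem_ofPred_eq]
      exact ⟨SuperDiagram.mem_circleRows.1 (SuperDiagram.hasCircle_eq_true.1 hr.2), _, hnew, hr.1⟩

end Superspace

/-! ### Correspondence between pairs of moves and runs of states. -/

namespace Superspace

theorem rowStep_bounds {lam mu nu : ℕ → ℕ} {rho m sigma : ℕ → Bool} {n1 n2 : Option ℕ}
    (h1 : RowStep lam mu rho m n1) (h2 : RowStep mu nu m sigma n2) (r : ℕ) :
    rowLo lam nu r ≤ mu r ∧ mu r ≤ rowHi lam nu r := by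
  refine ⟨max_le (h1.le r) (h2.interlace r), ?_⟩
  cases r with
  | zero => exact h2.le 0
  | succ r => exact le_min (h2.le _) (h1.interlace r)

/-- The new circle is the only term in the equation `circ` that depends on `n`, so its row is
determined. -/
theorem RowStep.unique {lam mu : ℕ → ℕ} {rho m : ℕ → Bool} {n n' : Option ℕ}
    (h : RowStep lam mu rho m n) (h' : RowStep lam mu rho m n') : n = n' := by
  refine Option.ext fun r => ?_
  have h1 := h.circ r
  rw [h'.circ r, Nat.add_left_cancel_iff] at h1
  have h2 : decide (n' = some r) = decide (n = some r) := by
    revert h1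
    cases decide (n' = some r) <;> cases decide (n = some r) <;> simp
  exact (decide_eq_decide.1 h2).symm

theorem rowHi_le (lam nu : ℕ → ℕ) (r : ℕ) : rowHi lam nu r ≤ nu r := by
  cases r with
  | zero => exact le_rfl
  | succ r => exact min_le_left _ _

/-- After shifting by one row, the terms agree: `a - min a b = max b a - b`. The term of row `0` on
the left vanishes. -/
theorem sum_rowLo_rowHi (lam nu : ℕ → ℕ) (N : ℕ) :
    ∑ r ∈ Finset.range (N + 1), (nu r - rowHi lam nu r) =
      ∑ r ∈ Finset.range N, (rowLo lam nu r - lam r) := by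
  rw [Finset.sum_range_succ']
  simp only [rowHi, rowLo, Nat.sub_self, Nat.add_zero]
  refine Finset.sum_congr rfl fun r _ => ?_
  omega

theorem prod_elim {n : Option ℕ} {c : ℕ → ℚ} {N : ℕ} (h : ∀ s, n = some s → s < N) :
    ∏ r : Fin N, (if n = some (r : ℕ) then c r else 1) = n.elim 1 c := by
  rw [Fin.prod_univ_eq_prod_range (fun r => if n = some r then c r else 1) N]
  cases n with
  | none => simp
  | some s =>
    rw [Finset.prod_eq_single_of_mem s (Finset.mem_range.2 (h s rfl))]
    · simp
    · intro r _ hr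
      rw [if_neg]
      simpa using hr.symm

/-- The state in which all rows have been passed. -/
def finalState (e1 e2 : Bool) : RowState := ⟨e1, e2, false, false, true⟩

section

variable {A B C : SuperDiagram} {e1 e2 : Bool}

/-- The states of a pair of moves. -/
noncomputable def pathState (A B C : SuperDiagram) (e1 e2 : Bool) : ℕ → RowState :=
  rowState A.plus.rowLen B.plus.rowLen C.plus.rowLen A.hasCircle B.hasCircle
    (newRow A B e1) (newRow B C e2)

theorem colLen_le {mu lam : YoungDiagram} (h : mu ≤ lam) : mu.colLen 0 ≤ lam.colLen 0 := by
  by_contra hn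
  rw [not_le, ← YoungDiagram.mem_iff_lt_colLen] at hn
  have := h hn
  rw [YoungDiagram.mem_iff_lt_colLen] at this
  exact lt_irrefl _ this

theorem newRow_lt (h : IsMove A B e1) (h' : B.plus ≤ C.plus) {s : ℕ} (hs : newRow A B e1 = some s) :
    s < C.plus.colLen 0 + 2 := by
  by_contra hn
  have h1 := h.hasCircle_of_newRow hs
  have := colLen_le h'
  rw [B.hasCircle_eq_false (by omega)] at h1
  simp at h1

/-- A circle may lie in row `colLen 0`, just below the boxes, and row states also look back at the
previous row. With two rows beyond the boxes, no circle remains to be pushed and both new circles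
have been passed. -/
theorem pathState_final (h1 : IsMove A B e1) (h2 : IsMove B C e2) :
    pathState A B C e1 e2 (C.plus.colLen 0 + 2) = finalState e1 e2 := by
  have hBC := colLen_le h2.le
  have hAB := colLen_le h1.le
  have key : ∀ (n : Option ℕ) (e : Bool) (N : ℕ), n.isSome = e → (∀ s, n = some s → s < N) →
      placed n N = e := by
    rintro (_ | s) e N rfl h
    · rfl
    · simpa [placed] using h s rfl
  refine RowState.ext ?_ ?_ ?_ ?_ ?_
  · exact key _ _ _ h1.isSome_newRow fun s hs => newRow_lt h1 h2.le hs
  · exact key _ _ _ h2.isSome_newRow fun s hs => newRow_lt h2 le_rfl hs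
  · change (A.hasCircle _ && _) = false
    rw [A.hasCircle_eq_false (by omega), Bool.false_and]
  · change (B.hasCircle _ && _) = false
    rw [B.hasCircle_eq_false (by omega), Bool.false_and]
  · change decide (_ = _) = true
    rw [rowLen_eq_zero _ (by omega), rowLen_eq_zero _ (by omega)]
    rfl

/-- The row factors measure lengths from the ends of their intervals instead of from the rows of `A`
and `C`. By `sum_rowLo_rowHi` the two defects have the same sum, so the correction is a power of `x
* y`, which is symmetric and independent of `B`. -/
theorem prod_rowFactor (h1 : IsMove A B e1) (h2 : IsMove B C e2) (x y : ℚ) :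
    (∏ r : Fin (C.plus.colLen 0 + 2), rowFactor A.plus.rowLen C.plus.rowLen A.hasCircle C.hasCircle
      x y r (B.plus.rowLen r) (pathState A B C e1 e2 r) (pathState A B C e1 e2 (r + 1))) *
        (x * y) ^ (∑ r ∈ Finset.range (C.plus.colLen 0 + 2),
          (rowLo A.plus.rowLen C.plus.rowLen r - A.plus.rowLen r)) =
      stepSign A B e1 * stepSign B C e2 *
        (x ^ (B.plus.card - A.plus.card) * y ^ (C.plus.card - B.plus.card)) := by
  have hlt1 := fun s => newRow_lt (s := s) h1 h2.le
  have hlt2 := fun s => newRow_lt (s := s) h2 le_rfl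
  generalize hN : C.plus.colLen 0 + 2 = N at *
  have hAC := colLen_le (h1.le.trans h2.le)
  have hBC := colLen_le h2.le
  have hb := rowStep_bounds h1.rowStep h2.rowStep
  simp only [pathState, h1.rowStep.rowFactor_eq h2.rowStep, Finset.prod_mul_distrib]
  rw [prod_elim hlt1, prod_elim hlt2,
    ← h1.stepSign_eq, ← h2.stepSign_eq]
  rw [Fin.prod_univ_eq_prod_range (fun r => x ^ (B.plus.rowLen r -
      rowLo A.plus.rowLen C.plus.rowLen r)) N,
    Fin.prod_univ_eq_prod_range (fun r => y ^ (rowHi A.plus.rowLen C.plus.rowLen r -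
      B.plus.rowLen r)) N, Finset.prod_pow_eq_pow_sum, Finset.prod_pow_eq_pow_sum]
  have hA := card_eq_sum_rowLen A.plus (N := N) (by omega)
  have hB := card_eq_sum_rowLen B.plus (N := N) (by omega)
  have hC := card_eq_sum_rowLen C.plus (N := N) (by omega)
  have e1 : B.plus.card - A.plus.card = ∑ r ∈ Finset.range N, (B.plus.rowLen r -
      rowLo A.plus.rowLen C.plus.rowLen r) + ∑ r ∈ Finset.range N,
        (rowLo A.plus.rowLen C.plus.rowLen r - A.plus.rowLen r) := by
    rw [hA, hB, ← Finset.sum_tsub_distrib _ fun r _ => h1.rowStep.le r, ← Finset.sum_add_distrib]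
    refine Finset.sum_congr rfl fun r _ => ?_
    have := (hb r).1
    have : A.plus.rowLen r ≤ rowLo A.plus.rowLen C.plus.rowLen r := le_max_left _ _
    omega
  have e3 : ∑ r ∈ Finset.range N, (C.plus.rowLen r - rowHi A.plus.rowLen C.plus.rowLen r) =
      ∑ r ∈ Finset.range N, (rowLo A.plus.rowLen C.plus.rowLen r - A.plus.rowLen r) := by
    rw [← sum_rowLo_rowHi, Finset.sum_range_succ, rowLen_eq_zero C.plus (r := N) (by omega)]
    simp
  have e2 : C.plus.card - B.plus.card = ∑ r ∈ Finset.range N,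
      (rowHi A.plus.rowLen C.plus.rowLen r - B.plus.rowLen r) + ∑ r ∈ Finset.range N,
        (rowLo A.plus.rowLen C.plus.rowLen r - A.plus.rowLen r) := by
    rw [hC, hB, ← Finset.sum_tsub_distrib _ fun r _ => h2.rowStep.le r, ← e3,
      ← Finset.sum_add_distrib]
    refine Finset.sum_congr rfl fun r _ => ?_
    have := (hb r).2
    have := rowHi_le A.plus.rowLen C.plus.rowLen r
    omega
  rw [e1, e2, mul_pow, pow_add, pow_add]
  ring

/-- A run of the states comes from a pair of moves. -/
theorem exists_of_run (hAC : A.plus ≤ C.plus) {u : ℕ → ℕ} {st : ℕ → RowState}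
    (h0 : st 0 = initialState) (hu : ∀ r, C.plus.colLen 0 + 2 ≤ r → u r = 0)
    (hst : ∀ r, C.plus.colLen 0 + 2 ≤ r → st r = finalState e1 e2)
    (h : ∀ r < C.plus.colLen 0 + 2, RowRel A.plus.rowLen C.plus.rowLen A.hasCircle C.hasCircle r
      (u r) (st r) (st (r + 1))) :
    ∃ B, IsMove A B e1 ∧ IsMove B C e2 ∧ (∀ r, B.plus.rowLen r = u r) ∧
      ∀ r, pathState A B C e1 e2 r = st r := by
  have hcol := colLen_le hAC
  -- Past the last row all lengths vanish and the final state repeats itself. The finite run thus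
  -- extends to all rows, where the reconstruction of the two steps applies.
  have hall : ∀ r, RowRel A.plus.rowLen C.plus.rowLen A.hasCircle C.hasCircle r
      (u r) (st r) (st (r + 1)) := by
    intro r
    by_cases hr : r < C.plus.colLen 0 + 2
    · exact h r hr
    have hr' : C.plus.colLen 0 + 2 ≤ r := not_lt.1 hr
    obtain ⟨q, rfl⟩ : ∃ q, r = q + 1 := ⟨r - 1, by omega⟩
    have z1 : A.plus.rowLen (q + 1) = 0 := rowLen_eq_zero _ (by omega)
    have z2 : C.plus.rowLen (q + 1 + 1) = 0 := rowLen_eq_zero _ (by omega)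
    have z3 : A.plus.rowLen q = 0 := rowLen_eq_zero _ (by omega)
    have z4 : C.plus.rowLen (q + 1) = 0 := rowLen_eq_zero _ (by omega)
    have z5 := A.hasCircle_eq_false (r := q + 1) (by omega)
    have z6 := C.hasCircle_eq_false (r := q + 1) (by omega)
    rw [hst _ hr', hst _ (by omega), hu _ hr']
    refine ⟨?_, Nat.zero_le _, ?_, ?_, ?_⟩
    · simp [rowLo, z1, z2]
    · simp [finalState, z5]
    · simp [finalState, z2]
    · rw [RowOK_iff]
      simp [finalState, midCount, gapAbove, z3, z4, z5, z6]
  have s1 := RowRel.rowStep_fst h0 hall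
  have s2 := RowRel.rowStep_snd h0 hall
  have hanti : Antitone u := antitone_nat_of_succ_le fun r => (s1.interlace r).trans (s1.le r)
  have hmN : ∀ r, C.plus.colLen 0 +
    2 ≤ r → runCircles A.plus.rowLen u A.hasCircle st r = false := by
    intro r hr
    unfold runCircles
    rw [hst _ hr, hst _ (by omega), A.hasCircle_eq_false (by omega)]
    simp [midCount, finalState]
  obtain ⟨B, hB1, hB2⟩ := exists_superDiagram (c := runCircles A.plus.rowLen u A.hasCircle st)
    hanti (hu _ le_rfl) (hmN _ le_rfl) (by
      intro r hr
      have h1 := s1.circ (r + 1)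
      have h2 := s1.interlace r
      have h3 := s1.le r
      rw [hr] at h1
      -- If rows `r` and `r + 1` of `u` were equal, interlacing would make both equal to row `r` of
      -- `A`. Then row `r` pushes nothing, there is no gap for a new circle, and an old circle in
      -- row `r + 1` must leave because that row of `A` is shorter.
      by_contra hn
      have h4 : A.plus.rowLen r = u r ∧ u (r + 1) = u r := by omega
      have h5 : ¬ (flagRow fun r => (st r).e1) = some (r + 1) := fun hf => by
        have := s1.gap r hf
        omega
      have h6 : A.hasCircle (r + 1) = true → A.plus.rowLen (r + 1) < u (r + 1) := fun hc => by
        have := SuperDiagram.rowLen_lt (SuperDiagram.hasCircle_eq_true.1 hc)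
        omega
      simp only [pushed, h4.1, lt_irrefl, decide_false, Bool.and_false, h5] at h1
      cases hc : A.hasCircle (r + 1) with
      | false => simp [hc] at h1
      | true => simp [hc, h6 hc] at h1)
  have f1 : B.plus.rowLen = u := funext hB1
  have f2 : B.hasCircle = runCircles A.plus.rowLen u A.hasCircle st := funext hB2
  have hfin := RowRel.rowState_flagRow h0 hall (C.plus.colLen 0 + 2)
  rw [hst _ le_rfl] at hfin
  have key : ∀ (n : Option ℕ) (e : Bool), placed n (C.plus.colLen 0 + 2) = e →
      (∀ s, n = some s → s < C.plus.colLen 0 + 2) → n.isSome = e := by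
    rintro (_ | s) e rfl h
    · rfl
    · simpa [placed] using h s rfl
  have m1 : IsMove A B e1 := by
    refine ⟨_, ?_, by rw [f1, f2]; exact s1⟩
    refine key _ _ (congrArg RowState.e1 hfin) fun s hs => ?_
    by_contra hn
    have := s1.circ s
    rw [hmN s (not_lt.1 hn), hs, decide_eq_true rfl] at this
    simp at this
  have m2 : IsMove B C e2 := by
    refine ⟨_, ?_, by rw [f1, f2]; exact s2⟩
    refine key _ _ (congrArg RowState.e2 hfin) fun s hs => ?_
    by_contra hn
    have := s2.circ s
    rw [C.hasCircle_eq_false (by omega), hs, decide_eq_true rfl] at this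
    simp at this
  refine ⟨B, m1, m2, hB1, fun r => ?_⟩
  have t1 := m1.rowStep
  have t2 := m2.rowStep
  rw [f1, f2] at t1 t2
  unfold pathState
  rw [f1, f2, t1.unique s1, t2.unique s2, RowRel.rowState_flagRow h0 hall]

end

end Superspace

/-! ### The generating function of two moves as a transfer product. -/

namespace Superspace

open Classical in
/-- The generating function of the diagrams between `A` and `C`. -/
noncomputable def pathSum (A C : SuperDiagram) (e1 e2 : Bool) (x y : ℚ) : ℚ :=
  ∑ B ∈ (finite_diagrams C.plus).toFinset with IsMove A B e1 ∧ IsMove B C e2,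
    stepSign A B e1 * stepSign B C e2 *
      (x ^ (B.plus.card - A.plus.card) * y ^ (C.plus.card - B.plus.card))

variable {A C : SuperDiagram}

theorem toNat_hasCircle_eq {B : SuperDiagram} {e1 e2 : Bool} (h : IsMove A B e1) (r : ℕ) :
    (B.hasCircle r).toNat = midCount (A.hasCircle r && !decide (A.plus.rowLen r < B.plus.rowLen r))
      (pathState A B C e1 e2 r) (pathState A B C e1 e2 (r + 1)).e1 := by
  simp only [midCount, pathState, rowState, placed_new, h.rowStep.circ r]

/-- Expanded into paths, the transfer vector has one possibly nonzero term for each middle diagram.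
A diagram is recovered from its path since the states determine its circles, and `exists_of_run`
shows that every path with nonzero weight arises in this way. -/
theorem pathSum_eq (hAC : A.plus ≤ C.plus) (e1 e2 : Bool) (x y : ℚ) :
    pathSum A C e1 e2 x y =
      rowVector A.plus.rowLen C.plus.rowLen A.hasCircle C.hasCircle x y (C.plus.colLen 0 + 2)
        (finalState e1 e2) * (x * y) ^ (∑ r ∈ Finset.range (C.plus.colLen 0 + 2),
          (rowLo A.plus.rowLen C.plus.rowLen r - A.plus.rowLen r)) := by
  classical
  have hcol := colLen_le hAC
  rw [sum_paths (K := C.plus.rowLen 0 + 1)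
    (rowFactor A.plus.rowLen C.plus.rowLen A.hasCircle C.hasCircle x y) initialState
    (rowVector A.plus.rowLen C.plus.rowLen A.hasCircle C.hasCircle x y) (fun _ => rfl)
    (C.plus.colLen 0 + 2)
    (fun r _ s' => rowVector_succ _ _ x y r s' (Nat.lt_succ_of_le
      ((rowHi_le _ _ r).trans (C.plus.rowLen_anti _ _ (Nat.zero_le r))))),
    ← Fintype.sum_prod_type', Finset.sum_mul]
  -- The minimum makes the length an element of `Fin` for arbitrary `B`; it changes nothing when `B`
  -- moves to `C`.
  have hK : ∀ B : SuperDiagram, ∀ r, min (B.plus.rowLen r) (C.plus.rowLen 0) <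
      C.plus.rowLen 0 + 1 := fun B r => Nat.lt_succ_of_le (min_le_right _ _)
  have hmin : ∀ B : SuperDiagram, IsMove B C e2 → ∀ r,
      min (B.plus.rowLen r) (C.plus.rowLen 0) = B.plus.rowLen r := fun B hB r =>
    min_eq_left ((hB.rowStep.le r).trans (C.plus.rowLen_anti _ _ (Nat.zero_le r)))
  refine Finset.sum_of_injOn
    (fun B => (fun r : Fin (C.plus.colLen 0 + 2 + 1) => pathState A B C e1 e2 r,
      fun r : Fin (C.plus.colLen 0 + 2) => ⟨min (B.plus.rowLen r) (C.plus.rowLen 0), hK B r⟩))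
    ?_ (fun _ _ => Finset.mem_coe.2 (Finset.mem_univ _)) ?_ ?_
  · intro B hB B' hB' he
    simp only [Finset.coe_filter, Set.mem_ofPred_eq] at hB hB'
    simp only [Prod.mk.injEq] at he
    have hrow : ∀ r, B.plus.rowLen r = B'.plus.rowLen r := by
      intro r
      by_cases hr : r < C.plus.colLen 0 + 2
      · have := congrArg Fin.val (congrFun he.2 ⟨r, hr⟩)
        simpa only [hmin B hB.2.2, hmin B' hB'.2.2] using this
      · have h1 := colLen_le hB.2.2.le
        have h2 := colLen_le hB'.2.2.le
        rw [rowLen_eq_zero _ (by omega), rowLen_eq_zero _ (by omega)]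
    refine SuperDiagram.ext_rows hrow fun r => ?_
    by_cases hr : r < C.plus.colLen 0 + 2
    · have h1 := toNat_hasCircle_eq (C := C) (e2 := e2) hB.2.1 r
      have h2 := toNat_hasCircle_eq (C := C) (e2 := e2) hB'.2.1 r
      have h3 := congrFun he.1 ⟨r, by omega⟩
      have h4 := congrFun he.1 ⟨r + 1, by omega⟩
      simp only at h3 h4
      rw [h3, h4, hrow r, ← h2] at h1
      revert h1
      cases B.hasCircle r <;> cases B'.hasCircle r <;> simp
    · have h1 := colLen_le hB.2.2.le
      have h2 := colLen_le hB'.2.2.le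
      rw [B.hasCircle_eq_false (by omega), B'.hasCircle_eq_false (by omega)]
  · rintro ⟨st, u⟩ _ hne
    by_contra hg
    apply hne
    have hg := left_ne_zero_of_mul hg
    split_ifs at hg with hend
    · simp only at hend hg
      rw [Finset.prod_ne_zero_iff] at hg
      let st' : ℕ → RowState := fun r =>
        if hr : r < C.plus.colLen 0 + 2 + 1 then st ⟨r, hr⟩ else finalState e1 e2
      let u' : ℕ → ℕ := fun r => if hr : r < C.plus.colLen 0 + 2 then u ⟨r, hr⟩ else 0
      have hst' : ∀ r, C.plus.colLen 0 + 2 ≤ r → st' r = finalState e1 e2 := by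
        intro r hr
        simp only [st']
        split_ifs with h
        · rw [← hend.2]
          congr 1
          exact Fin.ext (by simp; omega)
        · rfl
      have h0' : st' 0 = initialState := by
        rw [← hend.1]
        simp [st']
      have hu' : ∀ r, C.plus.colLen 0 + 2 ≤ r → u' r = 0 := fun r hr => dif_neg (by omega)
      have hrel : ∀ r < C.plus.colLen 0 + 2, RowRel A.plus.rowLen C.plus.rowLen A.hasCircle
          C.hasCircle r (u' r) (st' r) (st' (r + 1)) := by
        intro r hr
        have := RowRel.of_rowFactor_ne_zero (hg ⟨r, hr⟩ (Finset.mem_univ _))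
        simp only [st', u', hr, Nat.lt_succ_of_lt hr, Nat.succ_lt_succ hr, dif_pos]
        exact this
      obtain ⟨B, hB1, hB2, hB3, hB4⟩ := exists_of_run hAC h0' hu' hst' hrel
      refine ⟨B, ?_, ?_⟩
      · simp only [Finset.coe_filter, Set.mem_ofPred_eq, Set.Finite.mem_toFinset]
        exact ⟨hB2.le, hB1, hB2⟩
      · simp only [Prod.mk.injEq]
        constructor
        · funext r
          rw [hB4]
          exact dif_pos r.2
        · funext r
          refine Fin.ext ?_
          change min (B.plus.rowLen r) (C.plus.rowLen 0) = u r
          rw [hmin B hB2, hB3]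
          exact dif_pos r.2
    · exact absurd rfl hg
  · intro B hB
    simp only [Finset.mem_filter] at hB
    have hs0 : pathState A B C e1 e2 0 = initialState := by
      have : ∀ n, placed n 0 = false := by rintro (_ | n) <;> simp [placed]
      simp [pathState, rowState, initialState, this, pushed, tight]
    rw [if_pos ⟨hs0, pathState_final hB.2.1 hB.2.2⟩]
    simp only [hmin B hB.2.2]
    exact (prod_rowFactor hB.2.1 hB.2.2 x y).symm

end Superspace

/-! ### Exchange of two consecutive weights. -/

namespace Superspace

variable {A B C : SuperDiagram}

/-- Below the boxes of `C` the only possible middle row length is zero, which equals the next outer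
row length and forces `d` to be true. -/
theorem rowVector_final_false (x y : ℚ) (e1 e2 c1 c2 : Bool) :
    rowVector A.plus.rowLen C.plus.rowLen A.hasCircle C.hasCircle x y (C.plus.colLen 0 + 2)
      ⟨e1, e2, c1, c2, false⟩ = 0 := by
  have h1 := rowLen_eq_zero C.plus (r := C.plus.colLen 0 + 1) (by omega)
  have h2 := rowLen_eq_zero C.plus (r := C.plus.colLen 0 + 1 + 1) (by omega)
  have h3 := rowHi_le A.plus.rowLen C.plus.rowLen (C.plus.colLen 0 + 1)
  rw [rowVector_succ _ _ x y _ _ (Nat.lt_succ_of_le h3)]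
  refine Finset.sum_eq_zero fun u _ => Finset.sum_eq_zero fun s _ => ?_
  rw [rowFactor, if_neg, zero_mul]
  rintro ⟨-, h4, -, h5⟩
  have h6 := (decide_eq_false_iff_not.1 h5.symm)
  omega

/-- The sign of the exchange of two anticommuting variables, if they are present. -/
def swapSign (e1 e2 : Bool) : ℚ := bif e1 && e2 then -1 else 1

/-- Below the diagrams both neighbouring row lengths are zero, so the boundary is of type `eq`. At
the final states every correction term involves an entry with `d` false and vanishes; `Inv` then
states the exchange, including the minus sign for two new circles. -/
theorem pathSum_swap (hAC : A.plus ≤ C.plus) (e1 e2 : Bool) {x : ℚ} (hx : x ≠ 0) (y : ℚ) :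
    pathSum A C e2 e1 y x = swapSign e1 e2 * pathSum A C e1 e2 x y := by
  rw [pathSum_eq hAC, pathSum_eq hAC, mul_comm y x, ← mul_assoc]
  congr 1
  have h := inv_rowVector (lam := A.plus.rowLen) (nu := C.plus.rowLen) (rho := A.hasCircle)
    C.hasCircle (x := x) (y := y) hx
    (fun r hr => SuperDiagram.rowLen_lt (SuperDiagram.hasCircle_eq_true.1 hr))
    (C.plus.colLen 0 + 2)
  have ht : boundaryType A.plus.rowLen C.plus.rowLen (C.plus.colLen 0 + 2) = .eq := by
    have h1 := colLen_le hAC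
    rw [boundaryType, rowLen_eq_zero C.plus (by omega), rowLen_eq_zero A.plus (by omega)]
    rfl
  rw [ht] at h
  obtain ⟨-, -, h00, -, -, -, -, h01, h10, -, -, h11, -⟩ := h
  simp only [rowVector_final_false (A := A) (C :=
    C), mul_zero, add_zero, zero_add, sub_zero] at h00 h01 h10
  cases e1 <;> cases e2 <;> simp only [finalState, swapSign, Bool.and_self, Bool.and_false,
    Bool.and_true, cond_true, cond_false, one_mul, neg_mul]
  exacts [h00, h10, h01, h11]

theorem isStep_iff_isMove {w : Weight} :
    IsStep A B w ↔ B.plus.card = A.plus.card + w.size ∧ IsMove A B w.isBarred :=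
  isStep_iff

open Classical in
/-- The signed number of diagrams between `A` and `C`. -/
noncomputable def stepSum (A C : SuperDiagram) (a b : Weight) : ℚ :=
  ∑ B ∈ (finite_diagrams C.plus).toFinset with IsStep A B a ∧ IsStep B C b,
    stepSign A B a.isBarred * stepSign B C b.isBarred

theorem stepSum_eq_zero {a b : Weight}
    (h : ¬(A.plus ≤ C.plus ∧ C.plus.card = A.plus.card + (a.size + b.size))) :
    stepSum A C a b = 0 := by
  classical
  unfold stepSum
  rw [Finset.filter_false_of_mem, Finset.sum_empty]
  rintro B - ⟨h1, h2⟩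
  rw [isStep_iff_isMove] at h1 h2
  exact h ⟨h1.2.le.trans h2.2.le, by omega⟩

/-- The weight of a given size. -/
def Weight.mk (e : Bool) (a : ℕ) : Weight := bif e then .barred a else .plain a

@[simp]
theorem Weight.size_mk (e : Bool) (a : ℕ) : (Weight.mk e a).size = a := by cases e <;> rfl

@[simp]
theorem Weight.isBarred_mk (e : Bool) (a : ℕ) : (Weight.mk e a).isBarred = e := by cases e <;> rfl

theorem Weight.mk_isBarred_size (w : Weight) : Weight.mk w.isBarred w.size = w := by
  cases w <;> rfl

theorem pathSum_eq_sum_stepSum {n : ℕ} (hn : C.plus.card = A.plus.card + n) (e1 e2 : Bool)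
    (x y : ℚ) : pathSum A C e1 e2 x y = ∑ i ∈ Finset.range (n + 1),
      stepSum A C (.mk e1 i) (.mk e2 (n - i)) * (x ^ i * y ^ (n - i)) := by
  classical
  unfold pathSum stepSum
  rw [← Finset.sum_fiberwise_of_maps_to (t := Finset.range (n + 1))
    (g := fun B => B.plus.card - A.plus.card)]
  · refine Finset.sum_congr rfl fun i hi => ?_
    rw [Finset.mem_range] at hi
    rw [Finset.sum_mul, Finset.filter_filter]
    have hiff : ∀ B : SuperDiagram, (IsMove A B e1 ∧ IsMove B C e2) ∧
        B.plus.card - A.plus.card = i ↔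
        IsStep A B (.mk e1 i) ∧ IsStep B C (.mk e2 (n - i)) := by
      intro B
      simp only [isStep_iff_isMove, Weight.size_mk, Weight.isBarred_mk]
      constructor
      · rintro ⟨⟨h1, h2⟩, h3⟩
        have h4 := Finset.card_le_card h1.le
        have h5 := Finset.card_le_card h2.le
        change A.plus.card ≤ B.plus.card at h4
        change B.plus.card ≤ C.plus.card at h5
        refine ⟨⟨?_, h1⟩, ?_, h2⟩ <;> omega
      · rintro ⟨⟨h1, h2⟩, h3, h4⟩
        exact ⟨⟨h2, h4⟩, by omega⟩
    rw [Finset.filter_congr fun B _ => hiff B]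
    refine Finset.sum_congr rfl fun B hB => ?_
    obtain ⟨-, h1, h2⟩ := Finset.mem_filter.1 hB
    simp only [isStep_iff_isMove, Weight.size_mk] at h1 h2
    simp only [Weight.isBarred_mk]
    rw [show B.plus.card - A.plus.card = i by omega,
      show C.plus.card - B.plus.card = n - i by omega]
  · intro B hB
    obtain ⟨-, h1, h2⟩ := Finset.mem_filter.1 hB
    have h5 := Finset.card_le_card h2.le
    change B.plus.card ≤ C.plus.card at h5
    rw [Finset.mem_range]
    omega

theorem eq_of_sum_pow_eq {n : ℕ} {c d : ℕ → ℚ}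
    (h : ∀ x : ℚ, x ≠ 0 → ∑ i ∈ Finset.range n, c i * x ^ i = ∑ i ∈ Finset.range n, d i * x ^ i)
    {i : ℕ} (hi : i < n) : c i = d i := by
  have hp : (∑ i ∈ Finset.range n, Polynomial.C (c i) * Polynomial.X ^ i : Polynomial ℚ) =
      ∑ i ∈ Finset.range n, Polynomial.C (d i) * Polynomial.X ^ i := by
    refine Polynomial.eq_of_infinite_eval_eq _ _ (Set.Infinite.mono (s := {0}ᶜ) ?_
      (Set.finite_singleton 0).infinite_compl)
    intro x hx
    simpa [Polynomial.eval_finsetSum] using h x hx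
  have := congrArg (fun p : Polynomial ℚ => p.coeff i) hp
  simpa [Polynomial.finsetSum_coeff, Polynomial.coeff_C_mul, Polynomial.coeff_X_pow, hi] using this

/-- At `y = 1`, the equality of `pathSum_swap` holds for all nonzero rational `x`, so it is an
equality of polynomials. The coefficient of `x ^ a.size` is the claim. If the sizes do not fit the
two diagrams, both sides are zero. -/
theorem stepSum_swap (a b : Weight) :
    stepSum A C b a = swapSign a.isBarred b.isBarred * stepSum A C a b := by
  by_cases h : A.plus ≤ C.plus ∧ C.plus.card = A.plus.card + (a.size + b.size)
  · obtain ⟨hAC, hn⟩ := h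
    have h1 : ∀ x : ℚ, x ≠ 0 → ∑ i ∈ Finset.range (a.size + b.size + 1),
        stepSum A C (.mk b.isBarred (a.size + b.size - i)) (.mk a.isBarred i) * x ^ i =
        ∑ i ∈ Finset.range (a.size + b.size + 1), swapSign a.isBarred b.isBarred *
          stepSum A C (.mk a.isBarred i) (.mk b.isBarred (a.size + b.size - i)) * x ^ i := by
      intro x hx
      have h2 := pathSum_swap hAC a.isBarred b.isBarred hx 1
      rw [pathSum_eq_sum_stepSum hn, pathSum_eq_sum_stepSum hn, Finset.mul_sum,
        ← Finset.sum_range_reflect] at h2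
      simp only [one_pow, mul_one, one_mul, ← mul_assoc] at h2
      rw [← h2]
      refine Finset.sum_congr rfl fun i hi => ?_
      rw [Finset.mem_range] at hi
      rw [show a.size + b.size + 1 - 1 - i = a.size + b.size - i by omega,
        show a.size + b.size - (a.size + b.size - i) = i by omega]
    have h3 := eq_of_sum_pow_eq h1 (i := a.size) (by omega)
    rwa [Nat.add_sub_cancel_left, Weight.mk_isBarred_size, Weight.mk_isBarred_size] at h3
  · rw [stepSum_eq_zero h, stepSum_eq_zero (by rwa [Nat.add_comm a.size b.size] at h), mul_zero]

end Superspace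

/-! ### Signed counts of chains and of tableaux with a given weight. -/

namespace Superspace

open Classical in
/-- The signed number of steps from `A` to `B` with a given weight. -/
noncomputable def stepEntry (A B : SuperDiagram) (a : Weight) : ℚ :=
  if IsStep A B a then stepSign A B a.isBarred else 0

/-- The super Young diagrams with boxes in a given diagram. -/
abbrev Below (mu : YoungDiagram) : Type := {B : SuperDiagram // B.plus ≤ mu}

noncomputable instance (mu : YoungDiagram) : Fintype (Below mu) := (finite_diagrams mu).fintype

variable {mu : YoungDiagram}

theorem sum_stepEntry (A C : Below mu) (a b : Weight) :
    ∑ B : Below mu, stepEntry A.1 B.1 a * stepEntry B.1 C.1 b = stepSum A.1 C.1 a b := by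
  classical
  have h1 : ∀ B : SuperDiagram, stepEntry A.1 B a * stepEntry B C.1 b =
      if IsStep A.1 B a ∧ IsStep B C.1 b then
        stepSign A.1 B a.isBarred * stepSign B C.1 b.isBarred else 0 := by
    intro B
    simp only [stepEntry, ite_and, mul_ite, ite_mul, zero_mul, mul_zero]
    split_ifs <;> rfl
  simp only [h1]
  rw [← Finset.sum_subtype (finite_diagrams mu).toFinset (by simp)
    (f := fun B => if IsStep A.1 B a ∧ IsStep B C.1 b then
        stepSign A.1 B a.isBarred * stepSign B C.1 b.isBarred else 0), stepSum,
    ← Finset.sum_filter]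
  refine Finset.sum_congr (Finset.ext fun B => ?_) fun _ _ => rfl
  simp only [Finset.mem_filter, Set.Finite.mem_toFinset, Set.mem_ofPred_eq]
  constructor
  · rintro ⟨-, h2, h3⟩
    exact ⟨(isStep_iff_isMove.1 h3).2.le, h2, h3⟩
  · rintro ⟨h, h2, h3⟩
    exact ⟨h.trans C.2, h2, h3⟩

open Classical in
/-- The signed number of chains of a given length and weight that end at a given diagram. -/
noncomputable def chainVector (mu : YoungDiagram) (w : ℕ → Weight) : ℕ → Below mu → ℚ
  | 0 => fun B => if B.1 = SuperDiagram.empty then 1 else 0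
  | n + 1 => fun C => ∑ B, stepEntry B.1 C.1 (w n) * chainVector mu w n B

theorem chainVector_congr {v w : ℕ → Weight} {n : ℕ} (h : ∀ i < n, v i = w i) :
    chainVector mu v n = chainVector mu w n := by
  induction n with
  | zero => rfl
  | succ n ih =>
    funext C
    simp only [chainVector, h n (Nat.lt_succ_self n), ih fun i hi => h i (Nat.lt_succ_of_lt hi)]

theorem chainVector_add_two (w : ℕ → Weight) (k : ℕ) (C : Below mu) :
    chainVector mu w (k + 2) C =
      ∑ A, stepSum A.1 C.1 (w k) (w (k + 1)) * chainVector mu w k A := by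
  simp only [chainVector, ← sum_stepEntry, Finset.mul_sum, Finset.sum_mul]
  rw [Finset.sum_comm]
  refine Finset.sum_congr rfl fun A _ => Finset.sum_congr rfl fun B _ => ?_
  ring

/-- The steps `k` and `k + 1` enter only through `stepSum`, which may be exchanged. The earlier and
later steps see the same weights as before. -/
theorem chainVector_swap (w : ℕ → Weight) (k : ℕ) {n : ℕ} (hn : k + 2 ≤ n) (C : Below mu) :
    chainVector mu (w ∘ Equiv.swap k (k + 1)) n C =
      swapSign (w k).isBarred (w (k + 1)).isBarred * chainVector mu w n C := by
  induction n, hn using Nat.le_induction generalizing C with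
  | base =>
    have h1 : chainVector mu (w ∘ Equiv.swap k (k + 1)) k = chainVector mu w k := by
      refine chainVector_congr fun i hi => ?_
      rw [Function.comp_apply, Equiv.swap_apply_of_ne_of_ne (by omega) (by omega)]
    rw [chainVector_add_two, chainVector_add_two, h1, Finset.mul_sum]
    simp only [Function.comp_apply, Equiv.swap_apply_left, Equiv.swap_apply_right]
    refine Finset.sum_congr rfl fun A _ => ?_
    rw [stepSum_swap, mul_assoc]
  | succ n hn ih =>
    simp only [chainVector, ih, Function.comp_apply, Finset.mul_sum]
    rw [Equiv.swap_apply_of_ne_of_ne (by omega) (by omega)]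
    refine Finset.sum_congr rfl fun B _ => ?_
    ring

theorem IsStep.eq_of_plain_zero {A B : SuperDiagram} (h : IsStep A B (.plain 0)) : A = B := by
  obtain ⟨h1, -, h3⟩ := h
  have hp : A.plus = B.plus := YoungDiagram.ext
    (Finset.eq_of_subset_of_card_le h1.1 (by simpa [YoungDiagram.card] using h1.2.1.le))
  refine SuperDiagram.ext_of_rows hp ?_
  have h0 : skew B.plus A.plus = ∅ := by simp [skew, hp]
  simp only [CirclesMove, h0, Finset.notMem_empty, false_and, exists_false, if_false,
    List.map_id'] at h3
  have := congrArg List.toFinset h3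
  simpa using this.symm

namespace Tableau

variable {D : SuperDiagram}

/-- The sign of the tableau with labels at most `n`. -/
noncomputable def signAt (T : Tableau D) (n : ℕ) : ℚ :=
  ∏ i ∈ Finset.range n, stepSign (T.chain i) (T.chain (i + 1)) (T.weight i).isBarred

theorem chain_eq_of_weight (T : Tableau D) {N : ℕ} (h : ∀ i, N ≤ i → T.weight i = .plain 0) :
    ∀ i, N ≤ i → T.chain i = D := by
  have hconst : ∀ i j, N ≤ i → i ≤ j → T.chain i = T.chain j := by
    intro i j hi hij
    induction j, hij using Nat.le_induction with
    | base => rfl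
    | succ j hj ih =>
      have hs := T.step j
      rw [h j (by omega)] at hs
      rw [ih, hs.eq_of_plain_zero]
  intro i hi
  obtain ⟨M, hM⟩ := T.eventually
  rw [hconst i (max i M) hi (le_max_left _ _), hM _ (le_max_right _ _)]

-- A tableau of weight `w` is constant from `N` on, because a step of weight `plain 0` is trivial.
-- Such tableaux are therefore the paths of length `N` from the empty diagram to `D` with nonzero
-- step entries.
open Classical in
theorem finsum_signAt {w : ℕ → Weight} {N : ℕ} (h : ∀ i, N ≤ i → w i = .plain 0) :
    ∑ᶠ T : Tableau D, (if T.weight = w then T.signAt N else 0) =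
      chainVector D.plus w N ⟨D, le_rfl⟩ := by
  have hfin : {T : Tableau D | T.weight = w}.Finite :=
    (finite_stable N).subset fun T hT => T.chain_eq_of_weight (by
      rw [Set.mem_ofPred_eq] at hT
      rw [hT]
      exact h)
  rw [finsum_eq_sum_of_support_subset (s := hfin.toFinset) _ (by
    intro T hT
    rw [Set.Finite.coe_toFinset]
    by_contra hn
    exact hT (if_neg hn))]
  have hemp : (SuperDiagram.empty).plus ≤ D.plus := bot_le
  -- There is no additional choice along a step here, so the auxiliary index of the paths has a
  -- single value.
  rw [sum_paths (K := 1) (fun r _ A B => stepEntry A.1 B.1 (w r)) ⟨SuperDiagram.empty, hemp⟩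
    (chainVector D.plus w) (fun s => by simp only [chainVector, Subtype.ext_iff]) N
    (fun r _ s' => by simp [chainVector])]
  simp only [Fintype.sum_unique]
  refine Finset.sum_of_injOn (fun T (i : Fin (N + 1)) => ⟨T.chain i, T.plus_le i⟩) ?_
    (fun _ _ => Finset.mem_coe.2 (Finset.mem_univ _)) ?_ ?_
  · intro T hT T' hT' he
    rw [Set.Finite.coe_toFinset, Set.mem_ofPred_eq] at hT hT'
    refine ext_chain (funext fun i => ?_)
    by_cases hi : i < N + 1
    · exact congrArg Subtype.val (congrFun he ⟨i, hi⟩)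
    · rw [T.chain_eq_of_weight (N := N) (by rwa [hT]) _ (by omega),
        T'.chain_eq_of_weight (N := N) (by rwa [hT']) _ (by omega)]
  · intro st _ hne
    by_contra hg
    apply hne
    split_ifs at hg with hend
    · replace hg := Finset.prod_ne_zero_iff.1 hg
      let c : ℕ → SuperDiagram := fun i => if hi : i < N + 1 then (st ⟨i, hi⟩).1 else D
      have hD : ∀ i, N ≤ i → c i = D := by
        intro i hi
        simp only [c]
        split_ifs with h'
        · have : (⟨i, h'⟩ : Fin (N + 1)) = Fin.last N := Fin.ext (by simp; omega)
          rw [this, hend.2]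
        · rfl
      have hstep : ∀ i, IsStep (c i) (c (i + 1)) (w i) := by
        intro i
        by_cases hi : i < N
        · have := hg ⟨i, hi⟩ (Finset.mem_univ _)
          simp only [stepEntry, ne_eq, ite_eq_right_iff, Classical.not_imp] at this
          simp only [c, Nat.lt_succ_of_lt hi, Nat.succ_lt_succ hi, dif_pos]
          exact this.1
        · rw [hD i (by omega), hD (i + 1) (by omega), h i (by omega)]
          refine ⟨⟨le_rfl, rfl, by intro p hp; simp [skew] at hp⟩, rfl, ?_⟩
          simp [CirclesMove, skew]
      refine ⟨⟨c, w, ?_, hstep, N, hD⟩, by simp, ?_⟩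
      · simp only [c, Nat.zero_lt_succ, dif_pos]
        exact congrArg Subtype.val hend.1
      · funext i
        refine Subtype.ext ?_
        exact dif_pos i.2
    · exact absurd rfl hg
  · intro T hT
    rw [Set.Finite.mem_toFinset, Set.mem_ofPred_eq] at hT
    rw [if_pos hT, if_pos]
    · rw [signAt, ← Fin.prod_univ_eq_prod_range (fun i =>
        stepSign (T.chain i) (T.chain (i + 1)) (T.weight i).isBarred)]
      refine Finset.prod_congr rfl fun i _ => ?_
      simp only [Fin.val_castSucc, Fin.val_succ]
      rw [stepEntry, ← hT, if_pos (T.step i)]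
    · refine ⟨Subtype.ext T.chain_zero, Subtype.ext ?_⟩
      exact T.chain_eq_of_weight (N := N) (by rwa [hT]) _ le_rfl

end Tableau

end Superspace

/-! ### Content of the box word and sign of the circle word. -/

namespace Superspace

/-- The number of ways to arrange the values of `f` to a given word. -/
def arrangements {n : ℕ} (f : Fin n → ℕ+) (b : List ℕ+) : ℕ :=
  (Finset.univ.filter fun s : Equiv.Perm (Fin n) => (List.ofFn fun k => f (s k)) = b).card

theorem arrangements_comp {n : ℕ} (f : Fin n → ℕ+) (t : Equiv.Perm (Fin n)) (b : List ℕ+) :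
    arrangements (f ∘ t) b = arrangements f b := by
  refine Finset.card_nbij' (fun s => t * s) (fun s => t⁻¹ * s) ?_ ?_ ?_ ?_ <;> intro s <;> simp

theorem arrangements_congr {m n : ℕ} (h : m = n) {f : Fin m → ℕ+} {g : Fin n → ℕ+}
    (hfg : ∀ i, f i = g (Fin.cast h i)) (b : List ℕ+) : arrangements f b = arrangements g b := by
  subst h
  congr 1
  exact funext hfg

/-- Equal multiplicities give bijections between corresponding fibres, and these assemble to a
permutation. -/
theorem exists_perm_of_map_eq {n : ℕ} {f g : Fin n → ℕ+}
    (h : Finset.univ.val.map f = Finset.univ.val.map g) : ∃ t : Equiv.Perm (Fin n), f = g ∘ t := by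
  have h1 : ∀ c, Fintype.card {i // f i = c} = Fintype.card {i // g i = c} := by
    intro c
    have h2 := congrArg (Multiset.count c) h
    rw [Multiset.count_map, Multiset.count_map, ← Finset.filter_val, ← Finset.filter_val,
      ← Finset.card_def, ← Finset.card_def] at h2
    rw [Fintype.card_subtype, Fintype.card_subtype]
    simpa only [eq_comm] using h2
  refine ⟨Equiv.ofFiberEquiv fun c => Fintype.equivOfCardEq (h1 c), ?_⟩
  funext i
  exact (Equiv.ofFiberEquiv_map _ i).symm

theorem arrangements_of_perm {w b : List ℕ+} (h : w.Perm b) (c : List ℕ+) :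
    arrangements w.get c = arrangements b.get c := by
  have h1 : (Finset.univ : Finset (Fin w.length)).val.map w.get =
      Finset.univ.val.map (fun i : Fin w.length => b.get (Fin.cast h.length_eq i)) := by
    rw [Fin.univ_val_map, Fin.univ_val_map, List.ofFn_get, Multiset.coe_eq_coe]
    refine h.trans (List.Perm.of_eq ?_)
    refine List.ext_get (by simp [h.length_eq]) ?_
    intro i h1 h2
    simp
  obtain ⟨t, ht⟩ := exists_perm_of_map_eq h1
  rw [ht, arrangements_comp]
  exact arrangements_congr h.length_eq (fun _ => rfl) c

theorem arrangements_eq_zero {w b : List ℕ+} (h : ¬w.Perm b) : arrangements w.get b = 0 := by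
  unfold arrangements
  rw [Finset.card_eq_zero, Finset.filter_eq_empty_iff]
  rintro s - rfl
  refine h ?_
  have := Equiv.Perm.ofFn_comp_perm s w.get
  rw [List.ofFn_get] at this
  exact this.symm

theorem arrangements_map {s : ℕ+ → ℕ+} (hs : Function.Injective s) (b : List ℕ+) :
    arrangements (b.map s).get (b.map s) = arrangements b.get b := by
  rw [arrangements_congr (g := fun i => s (b.get i)) (List.length_map s) (by intro i; simp)]
  unfold arrangements
  congr 1
  refine Finset.filter_congr fun t _ => ?_
  rw [show (List.ofFn fun k => s (b.get (t k))) = (List.ofFn fun k => b.get (t k)).map s by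
    rw [List.map_ofFn]; rfl]
  exact (List.map_injective_iff.2 hs).eq_iff

/-- A letter larger than all others forms an inversion with exactly the letters after it. -/
theorem inv_insertIdx {a : ℕ+} {w : List ℕ+} (hw : ∀ b ∈ w, b < a) {p : ℕ} (hp : p ≤ w.length) :
    inv (w.insertIdx p a) = inv w + (w.length - p) := by
  induction w generalizing p with
  | nil =>
    obtain rfl : p = 0 := by simpa using hp
    rfl
  | cons b w ih =>
    cases p with
    | zero =>
      have h : (b :: w).countP (fun c => decide (c < a)) = (b :: w).length :=
        List.countP_eq_length.2 fun c hc => decide_eq_true (hw c hc)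
      rw [List.insertIdx_zero, inv, h, Nat.sub_zero, Nat.add_comm]
    | succ p =>
      have hp' : p ≤ w.length := by simpa using hp
      have h : ¬a < b := (hw b List.mem_cons_self).le.not_gt
      rw [List.insertIdx_succ_cons, inv, inv, ih (fun c hc => hw c (List.mem_cons_of_mem _ hc)) hp',
        (List.perm_insertIdx a w hp').countP_eq, List.countP_cons_of_neg (by simpa using h),
        List.length_cons, Nat.add_sub_add_right, Nat.add_assoc]

/-- The sign of the reversal of a word of length `n`. -/
def reversalSign (n : ℕ) : ℚ := ∏ i ∈ Finset.range n, (-1) ^ i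

namespace Tableau

variable {D : SuperDiagram} (T : Tableau D)

theorem circleWordAt_succ_plain {n : ℕ} (h : (T.weight n).isBarred = false) :
    T.circleWordAt (n + 1) = T.circleWordAt n := by
  rw [circleWordAt]
  revert h
  cases T.weight n <;> simp [Weight.isBarred]

theorem circleWordAt_succ_barred {n : ℕ} (h : (T.weight n).isBarred = true) :
    insertPos (T.chain n) (T.chain (n + 1)) ≤ (T.circleWordAt n).length ∧
    T.circleWordAt (n + 1) = (T.circleWordAt n).insertIdx
      (insertPos (T.chain n) (T.chain (n + 1))) (Nat.succPNat n) := by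
  cases hw : T.weight n with
  | plain a => simp [hw, Weight.isBarred] at h
  | barred a =>
    refine ⟨?_, ?_⟩
    · rw [length_circleWordAt]
      exact T.insert_pos_le n a hw
    · rw [circleWordAt]
      simp only [hw]
      rfl

theorem mem_circleWordAt {n : ℕ} {c : ℕ+} :
    c ∈ T.circleWordAt n ↔ ∃ j < n, (T.weight j).isBarred = true ∧ Nat.succPNat j = c := by
  induction n with
  | zero => simp [circleWordAt]
  | succ n ih =>
    cases h : (T.weight n).isBarred
    · rw [T.circleWordAt_succ_plain h, ih]
      constructor
      · rintro ⟨j, hj, h1⟩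
        exact ⟨j, by omega, h1⟩
      · rintro ⟨j, hj, h1, h2⟩
        refine ⟨j, ?_, h1, h2⟩
        rcases Nat.lt_succ_iff_lt_or_eq.1 hj with h3 | rfl
        · exact h3
        · rw [h] at h1
          simp at h1
    · obtain ⟨h1, h2⟩ := T.circleWordAt_succ_barred h
      rw [h2, List.mem_insertIdx h1, ih]
      constructor
      · rintro (rfl | ⟨j, hj, h3⟩)
        · exact ⟨n, by omega, h, rfl⟩
        · exact ⟨j, by omega, h3⟩
      · rintro ⟨j, hj, h3, h4⟩
        rcases Nat.lt_succ_iff_lt_or_eq.1 hj with h5 | rfl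
        · exact Or.inr ⟨j, h5, h3, h4⟩
        · exact Or.inl h4.symm

theorem lt_of_mem_circleWordAt {n : ℕ} : ∀ c ∈ T.circleWordAt n, c < Nat.succPNat n := by
  intro c hc
  obtain ⟨j, hj, -, rfl⟩ := T.mem_circleWordAt.1 hc
  exact Nat.succPNat_lt_succPNat.2 hj

theorem nodup_circleWordAt (n : ℕ) : (T.circleWordAt n).Nodup := by
  induction n with
  | zero => exact List.nodup_nil
  | succ n ih =>
    cases h : (T.weight n).isBarred
    · rwa [T.circleWordAt_succ_plain h]
    · obtain ⟨h1, h2⟩ := T.circleWordAt_succ_barred h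
      rw [h2, (List.perm_insertIdx _ _ h1).nodup_iff, List.nodup_cons]
      exact ⟨fun hc => lt_irrefl _ (T.lt_of_mem_circleWordAt _ hc), ih⟩

/-- New labels exceed all earlier ones, so an insertion into a word of length `l` at position `p`
contributes `(-1) ^ (l - p) = (-1) ^ l * (-1) ^ p`. The first factors multiply to `reversalSign`,
which depends only on the final length; the second are the step signs. -/
theorem sign_circleWordAt (n : ℕ) : (-1 : ℚ) ^ inv (T.circleWordAt n) =
    reversalSign (T.circleWordAt n).length * T.signAt n := by
  induction n with
  | zero => simp [circleWordAt, signAt, reversalSign, inv]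
  | succ n ih =>
    rw [signAt, Finset.prod_range_succ, ← signAt]
    cases h : (T.weight n).isBarred
    · rw [T.circleWordAt_succ_plain h, ih, stepSign, cond_false, mul_one]
    · obtain ⟨h1, h2⟩ := T.circleWordAt_succ_barred h
      rw [h2, inv_insertIdx T.lt_of_mem_circleWordAt h1, List.length_insertIdx_of_le_length h1,
        pow_add, ih, stepSign, cond_true, reversalSign, reversalSign, Finset.prod_range_succ]
      have h3 : (-1 : ℚ) ^ ((T.circleWordAt n).length - insertPos (T.chain n) (T.chain (n + 1))) =
          (-1) ^ (T.circleWordAt n).length * (-1) ^ insertPos (T.chain n) (T.chain (n + 1)) := by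
        obtain ⟨d, hd⟩ := Nat.exists_eq_add_of_le h1
        rw [hd, Nat.add_sub_cancel_left, pow_add, mul_right_comm, ← mul_pow]
        simp
      rw [h3]
      ring

theorem boxLabel_eq_iff {p : ℕ × ℕ} (hp : p ∈ D.plus) (i : ℕ) :
    T.boxLabel p = Nat.succPNat i ↔ p ∈ skew (T.chain (i + 1)).plus (T.chain i).plus := by
  have hne : {j | p ∈ (T.chain (j + 1)).plus}.Nonempty := by
    obtain ⟨N, hN⟩ := T.eventually
    exact ⟨N, by rw [Set.mem_ofPred_eq, hN _ (Nat.le_succ N)]; exact hp⟩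
  have h0 : ∀ q, q ∉ (T.chain 0).plus := by
    intro q
    rw [T.chain_zero]
    exact YoungDiagram.notMem_bot q
  simp only [boxLabel, Nat.succPNat_inj, skew, Finset.mem_sdiff, YoungDiagram.mem_cells]
  constructor
  · rintro rfl
    refine ⟨Nat.sInf_mem hne, fun hn => ?_⟩
    cases hi : sInf {j | p ∈ (T.chain (j + 1)).plus} with
    | zero =>
      rw [hi] at hn
      exact h0 _ hn
    | succ j =>
      rw [hi] at hn
      have := Nat.sInf_le (s := {j | p ∈ (T.chain (j + 1)).plus}) hn
      omega
  · rintro ⟨h1, h2⟩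
    refine le_antisymm (Nat.sInf_le h1) (le_csInf hne fun k hk => ?_)
    by_contra hn
    exact h2 (T.plus_mono (show k + 1 ≤ i by omega) hk)

theorem boxWord_perm : (T.boxWord : Multiset ℕ+) = D.plus.cells.val.map T.boxLabel := by
  have h1 : T.boxWord = ((List.range (D.plus.colLen 0)).flatMap fun i =>
      (List.range (D.plus.rowLen i)).map fun j => (i, j)).map T.boxLabel := by
    simp [boxWord, List.map_flatMap, Function.comp_def]
  rw [h1, ← Multiset.map_coe]
  congr 1
  refine (Multiset.Nodup.ext ?_ D.plus.cells.nodup).2 ?_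
  · rw [Multiset.coe_nodup, List.nodup_flatMap]
    refine ⟨fun i _ => (List.nodup_range).map fun a b h => (Prod.ext_iff.1 h).2, ?_⟩
    refine List.nodup_range.imp ?_
    intro i j hij p hp hq
    simp only [List.mem_map] at hp hq
    obtain ⟨a, -, rfl⟩ := hp
    obtain ⟨b, -, h⟩ := hq
    exact hij (Prod.ext_iff.1 h).1.symm
  · rintro ⟨i, j⟩
    simp only [Multiset.mem_coe, List.mem_flatMap, List.mem_range, List.mem_map, Finset.mem_val,
      YoungDiagram.mem_cells]
    constructor
    · rintro ⟨r, -, c, hc, h⟩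
      rw [Prod.mk.injEq] at h
      obtain ⟨rfl, rfl⟩ := h
      exact YoungDiagram.mem_iff_lt_rowLen.2 hc
    · intro h
      refine ⟨i, ?_, j, YoungDiagram.mem_iff_lt_rowLen.1 h, rfl⟩
      exact YoungDiagram.mem_iff_lt_colLen.1 (D.plus.up_left_mem le_rfl (Nat.zero_le j) h)

theorem count_boxWord (i : ℕ) : T.boxWord.count (Nat.succPNat i) = (T.weight i).size := by
  have h := isStep_iff_isMove.1 (T.step i)
  rw [← Multiset.coe_count, boxWord_perm, Multiset.count_map]
  have h1 : D.plus.cells.filter (fun p => Nat.succPNat i = T.boxLabel p) =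
      skew (T.chain (i + 1)).plus (T.chain i).plus := by
    ext p
    rw [Finset.mem_filter]
    constructor
    · rintro ⟨hp, hl⟩
      exact (T.boxLabel_eq_iff hp i).1 hl.symm
    · intro hp
      have hD : p ∈ D.plus := T.plus_le _ (Finset.mem_sdiff.1 hp).1
      exact ⟨hD, ((T.boxLabel_eq_iff hD i).2 hp).symm⟩
  have h2 := congrArg Finset.card h1
  rw [Finset.card_def, Finset.filter_val] at h2
  rw [h2, skew, Finset.card_sdiff_of_subset h.2.le]
  have h3 := h.1
  simp only [YoungDiagram.card] at h3
  omega

end Tableau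

end Superspace

/-! ### Coefficients of the Schur function and reduction to adjacent exchanges. -/

namespace Superspace

/-- The weight of the tableaux in whose terms a given monomial occurs. -/
def weightOf (u : Finset ℕ+ × List ℕ+) (i : ℕ) : Weight :=
  .mk (decide (Nat.succPNat i ∈ u.1)) (u.2.count (Nat.succPNat i))

theorem exists_weightOf_eq (u : Finset ℕ+ × List ℕ+) :
    ∃ N, ∀ i, N ≤ i → weightOf u i = .plain 0 := by
  classical
  refine ⟨(u.1 ∪ u.2.toFinset).sup fun a => (a : ℕ), fun i hi => ?_⟩
  have h : Nat.succPNat i ∉ u.1 ∪ u.2.toFinset := by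
    intro h
    have := Finset.le_sup (f := fun a : ℕ+ => (a : ℕ)) h
    simp only [Nat.succPNat_coe] at this
    omega
  rw [Finset.mem_union, not_or, List.mem_toFinset] at h
  rw [weightOf, decide_eq_false h.1, List.count_eq_zero.2 h.2]
  rfl

theorem IsStep.eq_plain_zero {A : SuperDiagram} {a : Weight} (h : IsStep A A a) :
    a = .plain 0 := by
  have h1 := (isStep_iff_isMove.1 h).1
  cases a with
  | plain a =>
    have : a = 0 := by simpa [Weight.size] using h1
    rw [this]
  | barred a => exact absurd h.2.1 (by omega)

namespace Tableau

variable {D : SuperDiagram} (T : Tableau D)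

open Classical in
theorem weight_of_find_le {i : ℕ} (h : Nat.find T.eventually ≤ i) : T.weight i = .plain 0 := by
  have hs := T.step i
  rw [T.chain_of_find_le h, T.chain_of_find_le (h.trans (Nat.le_succ i))] at hs
  exact hs.eq_plain_zero

theorem mem_circleWord (i : ℕ) :
    Nat.succPNat i ∈ T.circleWord ↔ (T.weight i).isBarred = true := by
  classical
  rw [circleWord, mem_circleWordAt]
  constructor
  · rintro ⟨j, -, hj, h⟩
    rwa [← Nat.succPNat_inj.1 h]
  · intro h
    refine ⟨i, ?_, h, rfl⟩
    by_contra hn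
    rw [T.weight_of_find_le (not_lt.1 hn)] at h
    simp [Weight.isBarred] at h

theorem sign_circleWord {N : ℕ} (hN : ∀ i, N ≤ i → T.weight i = .plain 0) :
    (-1 : ℚ) ^ inv T.circleWord = reversalSign T.circleWord.length * T.signAt N := by
  classical
  have hle : Nat.find T.eventually ≤ N := Nat.find_min' _ (T.chain_eq_of_weight hN)
  rw [circleWord, sign_circleWordAt]
  congr 1
  refine Finset.prod_subset (Finset.range_subset_range.2 hle) fun i _ hi => ?_
  rw [Finset.mem_range, not_lt] at hi
  rw [T.weight_of_find_le hi]
  rfl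

theorem weight_eq_weightOf_iff (u : Finset ℕ+ × List ℕ+) :
    T.weight = weightOf u ↔ T.circleWord.toFinset = u.1 ∧ T.boxWord.Perm u.2 := by
  rw [Finset.ext_iff, List.perm_iff_count, funext_iff, ← forall_and]
  have hp : ∀ P : ℕ+ → Prop, (∀ c, P c) ↔ ∀ i, P (Nat.succPNat i) := fun P =>
    ⟨fun h i => h _, fun h c => by rw [← PNat.succPNat_natPred c]; exact h _⟩
  rw [hp]
  refine forall_congr' fun i => ?_
  rw [Weight.ext_iff, weightOf, Weight.isBarred_mk, Weight.size_mk, count_boxWord,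
    List.mem_toFinset, mem_circleWord, Bool.eq_iff_iff, decide_eq_true_iff]

theorem term_apply {u : Finset ℕ+ × List ℕ+} {N : ℕ}
    (hN : ∀ i, N ≤ i → weightOf u i = .plain 0) [Decidable (T.weight = weightOf u)] :
    T.term.1 u = reversalSign u.1.card * arrangements u.2.get u.2 *
      if T.weight = weightOf u then T.signAt N else 0 := by
  have h1 : T.term.1 u = ∑ s : Equiv.Perm (Fin T.boxWord.length),
      monomialFun T.circleWord (List.ofFn fun k => T.boxWord.get (s k)) u := by
    rw [term, Submodule.coe_sum, Finset.sum_apply]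
    rfl
  have hnd : T.circleWord.Nodup := T.nodup_circleWordAt _
  simp only [h1, monomialFun, hnd, true_and]
  by_cases hS : T.circleWord.toFinset = u.1
  · simp only [hS, true_and]
    rw [← Finset.sum_filter, Finset.sum_const, nsmul_eq_mul]
    change (arrangements T.boxWord.get u.2 : ℚ) * _ = _
    by_cases hb : T.boxWord.Perm u.2
    · have hw := (T.weight_eq_weightOf_iff u).2 ⟨hS, hb⟩
      rw [if_pos hw, arrangements_of_perm hb, T.sign_circleWord (by rwa [hw]), ← hS,
        List.toFinset_card_of_nodup hnd]
      ring
    · rw [arrangements_eq_zero hb, if_neg fun hw => hb ((T.weight_eq_weightOf_iff u).1 hw).2]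
      simp
  · rw [if_neg fun hw => hS ((T.weight_eq_weightOf_iff u).1 hw).1, mul_zero]
    exact Finset.sum_eq_zero fun s _ => if_neg fun h => hS h.1

end Tableau

/-- Only tableaux of weight `weightOf u` contribute. They all have the same number of circles and
the same content of boxes, so the reversal sign and the number of arrangements leave the sum. -/
theorem schurOfDiagram_apply (D : SuperDiagram) {u : Finset ℕ+ × List ℕ+} {N : ℕ}
    (hN : ∀ i, N ≤ i → weightOf u i = .plain 0) :
    (schurOfDiagram D).1 u = reversalSign u.1.card * arrangements u.2.get u.2 *
      chainVector D.plus (weightOf u) N ⟨D, le_rfl⟩ := by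
  classical
  change ∑ᶠ T : Tableau D, T.term.1 u = _
  simp only [Tableau.term_apply _ hN]
  rw [← mul_finsum, Tableau.finsum_signAt hN]

/-- The sign of sorting the image of a finite set under a permutation. -/
def sortSign (s : Equiv.Perm ℕ+) (S : Finset ℕ+) : ℚ := (-1) ^ inv ((S.sort (· ≤ ·)).map s)

/-- By `inv_map_perm`, the sign of `s` on an unsorted word differs from the sign on the sorted one
by the sign of sorting the word. This cocycle rule makes `permute` an action. -/
theorem sortSign_mul (s t : Equiv.Perm ℕ+) (S : Finset ℕ+) :
    sortSign (s * t) S = sortSign s (S.map t.toEmbedding) * sortSign t S := by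
  have hp : ((S.sort (· ≤ ·)).map t).Perm ((S.map t.toEmbedding).sort (· ≤ ·)) := by
    rw [List.perm_ext_iff_of_nodup ((Finset.sort_nodup _ _).map t.injective)
      (Finset.sort_nodup _ _)]
    intro c
    simp only [List.mem_map, Finset.mem_sort, Finset.mem_map, Equiv.coe_toEmbedding]
  have h := inv_map_perm s s.injective hp ((Finset.sort_nodup _ _).map t.injective)
  rw [inv_sorted (Finset.pairwise_sort _ _), pow_zero, mul_one, List.map_map] at h
  rw [sortSign, sortSign, ← h, sortSign, mul_assoc, ← mul_pow]
  simp

theorem permute_apply (s : Equiv.Perm ℕ+) (f : SSeries) (u : Finset ℕ+ × List ℕ+) :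
    (permute s f).1 u = sortSign s (u.1.map s.symm.toEmbedding) *
      f.1 (u.1.map s.symm.toEmbedding, u.2.map s.symm) := rfl

theorem permute_mul (s t : Equiv.Perm ℕ+) (f : SSeries) :
    permute (s * t) f = permute s (permute t f) := by
  refine Subtype.ext (funext fun u => ?_)
  rw [permute_apply, permute_apply, permute_apply, sortSign_mul]
  have h1 : (u.1.map s.symm.toEmbedding).map t.symm.toEmbedding =
      u.1.map (s * t).symm.toEmbedding := by
    rw [Finset.map_map]
    rfl
  have h2 : ((u.1.map (s * t).symm.toEmbedding).map t.toEmbedding) =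
      u.1.map s.symm.toEmbedding := by
    rw [← h1, Finset.map_map]
    ext
    simp
  have h3 : (u.2.map s.symm).map t.symm = u.2.map (s * t).symm := by
    rw [List.map_map]
    rfl
  simp only [h1, h2, h3, mul_assoc]

theorem permute_one (f : SSeries) : permute 1 f = f := by
  refine Subtype.ext (funext fun u => ?_)
  have h1 : u.1.map (1 : Equiv.Perm ℕ+).symm.toEmbedding = u.1 := by
    ext
    simp
  have h2 : u.2.map (1 : Equiv.Perm ℕ+).symm = u.2 := List.map_id _
  rw [permute_apply, h1, h2, sortSign]
  have h3 : (u.1.sort (· ≤ ·)).map (1 : Equiv.Perm ℕ+) = u.1.sort (· ≤ ·) := List.map_id _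
  rw [h3, inv_sorted (Finset.pairwise_sort _ _), pow_zero, one_mul]

/-- The exchange of two consecutive indices. -/
def adjacentSwap (k : ℕ) : Equiv.Perm ℕ+ := Equiv.swap (Nat.succPNat k) (Nat.succPNat (k + 1))

theorem isSymmetric_of_adjacentSwap {f : SSeries} (h : ∀ k, permute (adjacentSwap k) f = f) :
    IsSymmetric f := by
  -- Indices are shifted by one: `s` fixes all labels above `n + 1`, and `d` is the distance by
  -- which it lowers the label `n + 1`. Splitting off an adjacent exchange on the left reduces `d`;
  -- when `d` is zero, `n` can be lowered.
  have main : ∀ (n d : ℕ) (s : Equiv.Perm ℕ+), (∀ i, n < i → s (Nat.succPNat i) = Nat.succPNat i) →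
      (s (Nat.succPNat n) : ℕ) + d = n + 1 → permute s f = f := by
    intro n
    induction n with
    | zero =>
      intro d s hs hd
      have hpos := (s (Nat.succPNat 0)).pos
      have : s = 1 := by
        refine Equiv.ext fun c => ?_
        rw [← PNat.succPNat_natPred c]
        rcases Nat.eq_zero_or_pos c.natPred with h0 | h0
        · rw [h0]
          refine PNat.eq ?_
          rw [Equiv.Perm.one_apply, Nat.succPNat_coe]
          omega
        · exact hs _ h0
      rw [this, permute_one]
    | succ n ihn =>
      intro d
      induction d with
      | zero =>
        intro s hs hd
        have hfix : s (Nat.succPNat (n + 1)) = Nat.succPNat (n + 1) := PNat.eq (by simpa using hd)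
        have hs' : ∀ i, n < i → s (Nat.succPNat i) = Nat.succPNat i := by
          intro i hi
          rcases (Nat.succ_le_of_lt hi).eq_or_lt with rfl | h1
          · exact hfix
          · exact hs i h1
        have hle : (s (Nat.succPNat n) : ℕ) ≤ n + 1 := by
          by_contra hn
          have h1 := hs' ((s (Nat.succPNat n) : ℕ) - 1) (by omega)
          have h2 : Nat.succPNat ((s (Nat.succPNat n) : ℕ) - 1) = s (Nat.succPNat n) :=
            PNat.eq (by simp only [Nat.succPNat_coe]; omega)
          rw [h2] at h1
          have h3 := s.injective h1
          rw [h3] at hn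
          simp only [Nat.succPNat_coe] at hn
          omega
        exact ihn (n + 1 - (s (Nat.succPNat n) : ℕ)) s hs' (by omega)
      | succ d ihd =>
        intro s hs hd
        have hpos := (s (Nat.succPNat (n + 1))).pos
        obtain ⟨m, hm⟩ : ∃ m, s (Nat.succPNat (n + 1)) = Nat.succPNat m :=
          ⟨_, (PNat.succPNat_natPred _).symm⟩
        have hmn : m + d = n := by
          rw [hm, Nat.succPNat_coe] at hd
          omega
        have hs' : s = adjacentSwap m * (adjacentSwap m * s) := by
          rw [← mul_assoc, adjacentSwap, Equiv.swap_mul_self, one_mul]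
        rw [hs', permute_mul, ihd, h]
        · intro i hi
          rw [Equiv.Perm.mul_apply, hs i hi, adjacentSwap]
          exact Equiv.swap_apply_of_ne_of_ne (by rw [ne_eq, Nat.succPNat_inj]; omega)
            (by rw [ne_eq, Nat.succPNat_inj]; omega)
        · rw [Equiv.Perm.mul_apply, hm, adjacentSwap, Equiv.swap_apply_left, Nat.succPNat_coe]
          omega
  intro n s hs
  refine main n (n + 1 - (s (Nat.succPNat n) : ℕ)) s (fun i hi => hs _ ?_) ?_
  · rw [Nat.succPNat_coe]
    omega
  · rw [hs (Nat.succPNat n) (by simp), Nat.succPNat_coe]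
    omega

/-- An adjacent exchange preserves the order of every other pair of labels, so an increasing word
acquires an inversion only if it contains both exchanged labels. -/
theorem sortSign_adjacentSwap (k : ℕ) (S : Finset ℕ+) :
    sortSign (adjacentSwap k) S =
      swapSign (decide (Nat.succPNat k ∈ S)) (decide (Nat.succPNat (k + 1) ∈ S)) := by
  have hlt : Nat.succPNat k < Nat.succPNat (k +
    1) := Nat.succPNat_lt_succPNat.2 (Nat.lt_succ_self k)
  have key : ∀ l : List ℕ+, l.Pairwise (· < ·) → (-1 : ℚ) ^ inv (l.map (adjacentSwap k)) =
      swapSign (decide (Nat.succPNat k ∈ l)) (decide (Nat.succPNat (k + 1) ∈ l)) := by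
    intro l hl
    induction l with
    | nil => simp [inv, swapSign]
    | cons a l ih =>
      rw [List.pairwise_cons] at hl
      have ih := ih hl.2
      have hnd : l.Nodup := hl.2.imp ne_of_lt
      rw [List.map_cons, inv, List.countP_map, pow_add, ih]
      by_cases ha : a = Nat.succPNat k
      · subst ha
        have hk : Nat.succPNat k ∉ l := fun hm => lt_irrefl _ (hl.1 _ hm)
        have hc : l.countP ((fun b => decide (b < adjacentSwap k (Nat.succPNat k))) ∘
            adjacentSwap k) = l.count (Nat.succPNat (k + 1)) := by
          refine List.countP_congr fun b hb => ?_
          have h1 := hl.1 b hb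
          simp only [Function.comp_apply, decide_eq_true_iff, adjacentSwap,
            Equiv.swap_apply_left, beq_iff_eq]
          constructor
          · intro h2
            by_contra hn
            rw [Equiv.swap_apply_of_ne_of_ne h1.ne' hn] at h2
            rw [← PNat.coe_lt_coe, Nat.succPNat_coe] at h1 h2
            omega
          · rintro rfl
            rwa [Equiv.swap_apply_right]
        rw [hc]
        by_cases hm : Nat.succPNat (k + 1) ∈ l
        · simp [List.count_eq_one_of_mem hnd hm, hm, hk, swapSign]
        · simp [List.count_eq_zero.2 hm, hm, hk, hlt.ne', swapSign]
      · have hc : l.countP ((fun b => decide (b < adjacentSwap k a)) ∘ adjacentSwap k) = 0 := by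
          rw [List.countP_eq_zero]
          intro b hb
          have h1 := hl.1 b hb
          suffices h2 : adjacentSwap k a ≤ adjacentSwap k b by
            simpa only [Function.comp_apply, decide_eq_true_iff, not_lt] using h2
          simp only [adjacentSwap, Equiv.swap_apply_def, if_neg ha]
          rw [← PNat.coe_inj] at ha
          rw [← PNat.coe_lt_coe] at h1
          simp only [← PNat.coe_inj, Nat.succPNat_coe] at ha ⊢
          split_ifs <;> simp only [← PNat.coe_le_coe, Nat.succPNat_coe] <;> omega
        rw [hc, pow_zero, one_mul]
        by_cases hq : a = Nat.succPNat (k + 1)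
        · subst hq
          have hk : Nat.succPNat k ∉ l := fun hm => lt_asymm hlt (hl.1 _ hm)
          simp [hk, hlt.ne, swapSign]
        · simp [Ne.symm ha, Ne.symm hq]
  rw [sortSign, key _ (Finset.sortedLT_sort S).pairwise]
  simp

theorem weightOf_adjacentSwap (u : Finset ℕ+ × List ℕ+) (k : ℕ) :
    weightOf (u.1.map (adjacentSwap k).symm.toEmbedding, u.2.map (adjacentSwap k).symm) =
      weightOf u ∘ Equiv.swap k (k + 1) := by
  have h1 : ∀ i, adjacentSwap k (Nat.succPNat i) = Nat.succPNat (Equiv.swap k (k + 1) i) :=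
    fun i => (Nat.succPNat_injective.map_swap _ _ _).symm
  funext i
  simp only [weightOf, Function.comp_apply]
  congr 1
  · rw [← h1]
    simp
  · have h2 : Nat.succPNat i = (adjacentSwap k).symm (Nat.succPNat (Equiv.swap k (k + 1) i)) := by
      rw [← h1, Equiv.symm_apply_apply]
    rw [h2, List.count_map_of_injective _ _ (adjacentSwap k).symm.injective]

theorem isSymmetric_schurOfDiagram (D : SuperDiagram) : IsSymmetric (schurOfDiagram D) := by
  refine isSymmetric_of_adjacentSwap fun k => Subtype.ext (funext fun u => ?_)
  obtain ⟨N, hN⟩ := exists_weightOf_eq u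
  have hN1 : ∀ i, max N (k + 2) ≤ i → weightOf u i = .plain 0 :=
    fun i hi => hN i ((le_max_left _ _).trans hi)
  have hN2 : ∀ i, max N (k + 2) ≤ i → weightOf (u.1.map (adjacentSwap k).symm.toEmbedding,
      u.2.map (adjacentSwap k).symm) i = .plain 0 := by
    intro i hi
    have := (le_max_right _ _).trans hi
    rw [weightOf_adjacentSwap, Function.comp_apply,
      Equiv.swap_apply_of_ne_of_ne (by omega) (by omega), hN1 i hi]
  have hsq : ∀ a b, swapSign a b * swapSign a b = 1 := by
    intro a b
    cases a <;> cases b <;> simp [swapSign]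
  have hs : sortSign (adjacentSwap k) (u.1.map (adjacentSwap k).symm.toEmbedding) =
      swapSign (weightOf u k).isBarred (weightOf u (k + 1)).isBarred := by
    rw [sortSign_adjacentSwap, weightOf, weightOf, Weight.isBarred_mk, Weight.isBarred_mk,
      swapSign, swapSign, Bool.and_comm]
    simp [adjacentSwap]
  rw [permute_apply, schurOfDiagram_apply D hN1, schurOfDiagram_apply D hN2,
    weightOf_adjacentSwap, chainVector_swap _ k (le_max_right _ _), hs, Finset.card_map,
    arrangements_map (adjacentSwap k).symm.injective]
  -- The exchange sign occurs twice, from sorting the `θ`s and from the chain count, and its square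
  -- is one.
  linear_combination reversalSign u.1.card * arrangements u.2.get u.2 *
    chainVector D.plus (weightOf u) (max N (k + 2)) ⟨D, le_rfl⟩ *
      hsq (weightOf u k).isBarred (weightOf u (k + 1)).isBarred

end Superspace

/-- The Schur function in noncommuting variables in superspace of every superpartition is
symmetric. -/
theorem mainTheorem9 (L : Superspace.Superpartition) : Superspace.IsSymmetric (Superspace.schur L) :=
  Superspace.isSymmetric_schurOfDiagram _
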